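/- Let $m=6$ and, for $k\in\mathbb Z$, let $L_k$ be the linear polynomial $L_k(x,y)=y-\bigl(\cos\frac{k\pi}{18}-x\bigr)\tan\frac{k\pi}{36}-\sin\frac{k\pi}{18}$ (for $k=18$ the line $L_k=0$ is read as $x=-1$). Put $\bar J_6^C(x,y)=\prod_{\nu=0}^{5}L_{6\nu+1}(x,y)$ and $J_6^C(x,y)=\bar J_6^C(x,-y)$, and let $G_{2,2,4}(z)=z^2\,P_1^{(1/2,-2)}(1-2z)^4=\frac{1}{16}z^2(z-3)^4$, where $P_n^{(a,b)}$ are the Jacobi polynomials. An $A_j$-singularity of a hypersurface in $\mathbf P^n(\mathbf C)$ is a point at which the hypersurface has, in suitable local holomorphic coordinates, the equation $x_0^{j+1}+x_1^2+\dots+x_{n-1}^2=0$; a node is an $A_1$-singularity. For a point $p_{k\cap l}$ we mean the intersection of the lines $L_k=0$ and $L_l=0$, and we identify the real plane with $\mathbb C$ by $(x,y)\mapsto x+iy$. Write $\alpha=e^{i\pi/9}$, $r=e^{2\pi i/3}$. (1) Let $J$ be $J_6^C$ or $\bar J_6^C$. The projective closure in $\mathbf P^3(\mathbf C)$ of the sextic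 surface $J(x,y)+G_{2,2,4}(z)=0$ has exactly $22$ $A_1$-singularities and exactly $15$ $A_3$-singularities; it has no other singular points, and all its singular points are real. (2) Let $J$ be $J_6^C$ or $\bar J_6^C$. The projective closure in $\mathbf P^4(\mathbf C)$ of the three-fold $J(x_0,x_1)-J(x_2,x_3)=0$ has exactly $283$ nodes; it has no other singular points, and all its singular points are real. (3) The critical values of $\bar J_6^C$ on the real plane are $0$, $-1$ and $8$. There are exactly $15$ critical points with value $0$. The critical points with value $-1$ are exactly the local minima, which are the seven points $0,\ \alpha,\ r\alpha,\ r^2\alpha,\ 2,\ 2r,\ 2r^2$; they are the images of $p_{0\cap 6}$, $p_{0\cap 12}$, $p_{2\cap 8}$ under the rotations by powers of $r$. The critical points with value $8$ are exactly the local maxima, which are the three points $\alpha^*,\ r^*\alpha^*,\ r^{*2}\alpha^*$ (with $*$ complex conjugation); they are the images of $p_{4\cap 10}$ under the rotations by powers of $r$. The same holds for $J_6^C$ with all critical points replaced by their complex conjugates. -/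

import Mathlib

open MvPolynomial

noncomputable section

namespace SexticHypersurfaces

/-! ### The lines and the line products -/

/-- The line `L_{k,m}`, `y - (cos (kπ/3m) - x) tan (kπ/6m) - sin (kπ/3m) = 0`, in the real plane;
for `k = 3m`, where the tangent is infinite, it is the line `x = -1`. -/
def line (m : ℕ) (k : ℤ) : MvPolynomial (Fin 2) ℝ :=
  if k = 3 * (m : ℤ) then X 0 + 1
  else X 1 - (C (Real.cos (k * Real.pi / (3 * m))) - X 0) * C (Real.tan (k * Real.pi / (6 * m)))
    - C (Real.sin (k * Real.pi / (3 * m)))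

/-- The normalized product `J̄_m` of the `m = 3q` lines `L_{6ν+1,m}`, `0 ≤ ν < m`. -/
def barJ (q : ℕ) : MvPolynomial (Fin 2) ℝ :=
  C ((3 : ℝ) ^ ((1 - (-1 : ℝ) ^ (3 * q)) / 4) * (-1) ^ ((q + 1) / 2 + 1)) *
    ∏ ν ∈ Finset.range (3 * q), line (3 * q) (6 * (ν : ℤ) + 1)

/-- The mirror image `J_m(x, y) = J̄_m(x, -y)`, `m = 3q`. -/
def plainJ (q : ℕ) : MvPolynomial (Fin 2) ℝ :=
  aeval ![X 0, -X 1] (barJ q)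

/-- The slope parameter `t_{k,m} = tan (kπ/6m)`. -/
def slope (m : ℕ) (k : ℤ) : ℝ := Real.tan (k * Real.pi / (6 * m))

/-- `B_{k,m} = (3t - t³)/(1 + t²)` with `t = t_{k,m}`. -/
def offset (m : ℕ) (k : ℤ) : ℝ :=
  (3 * slope m k - slope m k ^ 3) / (1 + slope m k ^ 2)

/-- The intersection point `p_{k∩l}` of the lines `y + t_k x = B_k` and `y + t_l x = B_l`,
as a complex number `x + iy`. -/
def crossing (m : ℕ) (k l : ℤ) : ℂ where
  re := (offset m k - offset m l) / (slope m k - slope m l)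
  im := (offset m l * slope m k - offset m k * slope m l) / (slope m k - slope m l)

/-! ### Critical points of real plane polynomials -/

/-- The function on the plane, identified with `ℂ` through `z = x + iy`, given by `P(x, y)`. -/
def planeFun (P : MvPolynomial (Fin 2) ℝ) (z : ℂ) : ℝ :=
  eval ![z.re, z.im] P

/-- `z = x + iy` is a (real) critical point of `P(x, y)`. -/
def IsCritical (P : MvPolynomial (Fin 2) ℝ) (z : ℂ) : Prop :=
  ∀ i, planeFun (pderiv i P) z = 0

/-- `α = exp(iπ/9)`. -/
def alpha : ℂ := Complex.exp (Complex.I * Real.pi / 9)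

/-- `r = exp(2iπ/3)`. -/
def rot : ℂ := Complex.exp (2 * Complex.I * Real.pi / 3)

/-- The points `0, α, rα, r²α, 2, 2r, 2r²`. -/
def minPts : Set ℂ :=
  {0, alpha, rot * alpha, rot ^ 2 * alpha, 2, 2 * rot, 2 * rot ^ 2}

/-- The points `α*, r*α*, r*²α*`, where `*` is complex conjugation. -/
def maxPts : Set ℂ :=
  {star alpha, star rot * star alpha, star rot ^ 2 * star alpha}

/-! ### The polynomials `G_{a,b,c}` -/

/-- The Jacobi polynomial `P_n^{(a,b)}`, in the form
`(1/n!) ∑_k binom(n,k) (n+a+b+1)_k (a+k+1)_{n-k} ((z-1)/2)^k`, with rising factorials, which is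
valid for all real parameters. -/
def jacobiPoly (n : ℕ) (a b : ℝ) : Polynomial ℝ :=
  Polynomial.C (1 / (n.factorial : ℝ)) * ∑ k ∈ Finset.range (n + 1),
    Polynomial.C ((n.choose k : ℝ) * (ascPochhammer ℝ k).eval (n + a + b + 1) *
        (ascPochhammer ℝ (n - k)).eval (a + k + 1)) *
      (Polynomial.C (1 / 2) * (Polynomial.X - 1)) ^ k

/-- `G_{a,b,c}(z) = z^a (P_{b-1}^{(a/c,-b)}(1 - 2z))^c`, for `b, c ≥ 1`. -/
def polyG (a b c : ℕ) : Polynomial ℝ :=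
  Polynomial.X ^ a *
    ((jacobiPoly (b - 1) ((a : ℝ) / c) (-(b : ℝ))).comp (1 - 2 * Polynomial.X)) ^ c

/-! ### Projective hypersurfaces and their singularities -/

/-- Complex projective space `P^n`. -/
abbrev PSpace (n : ℕ) : Type := Projectivization ℂ (Fin (n + 1) → ℂ)

/-- The homogenization of a complex polynomial in `n` variables (of its total degree) by a new
variable, which gets the index `0`. Its zero set in `P^n` is the projective hypersurface with
the affine equation `f = 0`. -/
def homogenization {n : ℕ} (f : MvPolynomial (Fin n) ℂ) : MvPolynomial (Fin (n + 1)) ℂ :=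
  ∑ d ∈ f.support, monomial (Finsupp.cons (f.totalDegree - d.degree) d) (f.coeff d)

/-- The form in `P^n` that defines the projective hypersurface with the real affine
equation `f = 0`. -/
def projForm {n : ℕ} (f : MvPolynomial (Fin n) ℝ) : MvPolynomial (Fin (n + 1)) ℂ :=
  homogenization (MvPolynomial.map (algebraMap ℝ ℂ) f)

/-- The point `p` of `P^n` has real homogeneous coordinates. -/
def IsRealPoint {n : ℕ} (p : PSpace n) : Prop :=
  ∃ (v : Fin (n + 1) → ℝ) (hv : (fun i => (v i : ℂ)) ≠ 0),
    p = Projectivization.mk ℂ (fun i => (v i : ℂ)) hv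

/-- `p` is a singular point of the hypersurface `F = 0` (`F` a form): `F` and all its partial
derivatives vanish at `p`. -/
def IsSingularPt {n : ℕ} (F : MvPolynomial (Fin (n + 1)) ℂ) (p : PSpace n) : Prop :=
  eval p.rep F = 0 ∧ ∀ i, eval p.rep (pderiv i F) = 0

/-- The hypersurface germ `(f = 0, a)` in `ℂ^(n+1)` is isomorphic to the germ at the origin of
`x_0^(j+1) + x_1² + ⋯ + x_n² = 0`: there are local holomorphic coordinates at `a` in which `f` is
this polynomial up to a holomorphic function without zeros. -/
def IsAGerm {n : ℕ} (j : ℕ) (f : (Fin (n + 1) → ℂ) → ℂ) (a : Fin (n + 1) → ℂ) : Prop :=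
  ∃ (φ : (Fin (n + 1) → ℂ) → (Fin (n + 1) → ℂ)) (h : (Fin (n + 1) → ℂ) → ℂ)
    (L : (Fin (n + 1) → ℂ) ≃L[ℂ] (Fin (n + 1) → ℂ)),
    AnalyticAt ℂ φ 0 ∧ φ 0 = a ∧ HasFDerivAt φ (L : (Fin (n + 1) → ℂ) →L[ℂ] (Fin (n + 1) → ℂ)) 0 ∧
    AnalyticAt ℂ h 0 ∧ h 0 ≠ 0 ∧
    ∀ᶠ x in nhds (0 : Fin (n + 1) → ℂ),
      f (φ x) = h x * (x 0 ^ (j + 1) + ∑ i : Fin n, x i.succ ^ 2)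

/-- The hypersurface `F = 0` in `P^(n+1)` (`F` a form) has an `A_j`-singularity at `p`: in an affine
chart `x_i = 1` around `p`, its germ at `p` is an `A_j`-germ. -/
def IsASingularity {n : ℕ} (j : ℕ) (F : MvPolynomial (Fin (n + 2)) ℂ) (p : PSpace (n + 1)) : Prop :=
  ∃ i : Fin (n + 2), p.rep i ≠ 0 ∧
    IsAGerm j (fun x : Fin (n + 1) → ℂ => eval (i.insertNth 1 x : Fin (n + 2) → ℂ) F)
      (fun k => p.rep (i.succAbove k) / p.rep i)

/-- The affine equation `P(x, y) + g(z)` of a surface in `P³`. -/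
def surfaceEq (P : MvPolynomial (Fin 2) ℝ) (g : Polynomial ℝ) : MvPolynomial (Fin 3) ℝ :=
  rename ![0, 1] P + Polynomial.aeval (X 2) g

/-- The affine equation `P(x_0, x_1) - P(x_2, x_3)` of a three-fold in `P⁴`. -/
def threefoldEq (P : MvPolynomial (Fin 2) ℝ) : MvPolynomial (Fin 4) ℝ :=
  rename ![0, 1] P - rename ![2, 3] P

end SexticHypersurfaces

end

noncomputable section

namespace SexticHypersurfaces

open Filter Topology

/-! ### The sextic in the coordinates `v = x - iy`, `w = x + iy` -/

/-- The primitive sixth root of unity `exp(iπ/3)`. -/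
def eta : ℂ := Complex.exp (Real.pi / 3 * Complex.I)

/-- `exp(iπ/18)`, a sixth root of `eta`. -/
def baseRoot : ℂ := Complex.exp (Real.pi / 18 * Complex.I)

/-- The parameters of the six lines: the sixth roots of `eta`. -/
def lineRoot (ν : ℕ) : ℂ := baseRoot * eta ^ ν

/-- The line with parameter `s`, in the coordinates `v, w`. -/
def lineForm (s v w : ℂ) : ℂ := 1 - v * s + w * s ^ 2 - s ^ 3

/-- The sixth power sum of the roots of `t³ - v t² + w t - 1`. -/
def powSum (v w : ℂ) : ℂ :=
  v ^ 6 - 6 * v ^ 4 * w + 6 * v ^ 3 + 9 * v ^ 2 * w ^ 2 - 12 * v * w - 2 * w ^ 3 + 3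

/-- The complete symmetric polynomial of degree `4` of the roots of `t³ - v t² + w t - 1`. -/
def homSymm4 (v w : ℂ) : ℂ := v ^ 4 - 3 * v ^ 2 * w + w ^ 2 + 2 * v

/-- The complete symmetric polynomial of degree `5` of the roots of `t³ - v t² + w t - 1`. -/
def homSymm5 (v w : ℂ) : ℂ := v ^ 5 - 4 * v ^ 3 * w + 3 * v * w ^ 2 + 3 * v ^ 2 - 2 * w

/-- The sextic in the coordinates `v, w`. -/
def sextic (v w : ℂ) : ℂ := 2 - eta * powSum v w - (1 - eta) * powSum w v

/-- The derivative of the sextic with respect to `v`. -/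
def sexticV (v w : ℂ) : ℂ := -6 * eta * homSymm5 v w + 6 * (1 - eta) * homSymm4 w v

/-- The derivative of the sextic with respect to `w`. -/
def sexticW (v w : ℂ) : ℂ := 6 * eta * homSymm4 v w - 6 * (1 - eta) * homSymm5 w v

/-- The coefficient of `V²` in the second order Taylor expansion of `powSum`, with remainder. -/
def powSumA (v w V W : ℂ) : ℂ :=
  15 * v ^ 4 + 20 * v ^ 3 * V + 15 * v ^ 2 * V ^ 2 + 6 * v * V ^ 3 + V ^ 4
    - 6 * (6 * v ^ 2 + 4 * v * V + V ^ 2) * (w + W) + 6 * (3 * v + V) + 9 * (w + W) ^ 2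

/-- The coefficient of `W²` in the second order Taylor expansion of `powSum`, with remainder. -/
def powSumC (v w V W : ℂ) : ℂ := 9 * (v ^ 2 + 2 * v * V) - 2 * (3 * w + W)

/-- The coefficient of `V²` in the second order Taylor expansion of the sextic, with remainder. -/
def sexticA (v w V W : ℂ) : ℂ := -eta * powSumA v w V W - (1 - eta) * powSumC w v W V

/-- The mixed second derivative of the sextic. -/
def sexticB (v w : ℂ) : ℂ :=
  -eta * (-24 * v ^ 3 + 36 * v * w - 12) - (1 - eta) * (-24 * w ^ 3 + 36 * v * w - 12)

/-- The coefficient of `W²` in the second order Taylor expansion of the sextic, with remainder. -/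
def sexticC (v w V W : ℂ) : ℂ := -eta * powSumC v w V W - (1 - eta) * powSumA w v W V

theorem sextic_taylor (v w V W : ℂ) :
    sextic (v + V) (w + W) = sextic v w + sexticV v w * V + sexticW v w * W
      + sexticA v w V W * V ^ 2 + sexticB v w * (V * W) + sexticC v w V W * W ^ 2 := by
  simp only [sextic, sexticV, sexticW, sexticA, sexticB, sexticC, powSumA, powSumC, powSum,
    homSymm4, homSymm5]
  ring

theorem eta_eq : eta = ⟨1 / 2, Real.sqrt 3 / 2⟩ := by
  have h : eta = Complex.exp ((Real.pi / 3 : ℝ) * Complex.I) := by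
    rw [eta]; push_cast; rfl
  rw [h]
  apply Complex.ext
  · rw [Complex.exp_ofReal_mul_I_re, Real.cos_pi_div_three]
  · rw [Complex.exp_ofReal_mul_I_im, Real.sin_pi_div_three]

theorem eta_sq : eta ^ 2 = eta - 1 := by
  have h3 : Real.sqrt 3 * Real.sqrt 3 = 3 := Real.mul_self_sqrt (by norm_num)
  rw [eta_eq, sq]
  apply Complex.ext
  · simp; nlinarith
  · simp; ring

theorem star_eta : (starRingEnd ℂ) eta = 1 - eta := by
  rw [eta_eq]
  apply Complex.ext
  · simp; norm_num
  · simp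

theorem eta_ne_zero : eta ≠ 0 := Complex.exp_ne_zero _

theorem one_sub_eta_ne_zero : 1 - eta ≠ 0 := by
  intro h
  have h2 := eta_sq
  have h1 : eta = 1 := by linear_combination -h
  rw [h1] at h2
  norm_num at h2

theorem eta_pow_three : eta ^ 3 = -1 := by linear_combination (eta + 1) * eta_sq

theorem eta_mul_one_sub : eta * (1 - eta) = 1 := by linear_combination -eta_sq

theorem norm_eta : ‖eta‖ = 1 := by
  have h : eta = Complex.exp ((Real.pi / 3 : ℝ) * Complex.I) := by
    rw [eta]; push_cast; rfl
  rw [h, Complex.norm_exp_ofReal_mul_I]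

theorem norm_one_sub_eta : ‖1 - eta‖ = 1 := by
  rw [← star_eta, Complex.norm_conj, norm_eta]

theorem baseRoot_pow : baseRoot ^ 6 = eta := by
  rw [baseRoot, eta, ← Complex.exp_nat_mul]
  congr 1
  push_cast
  ring

theorem eta_pow_six : eta ^ 6 = 1 := by
  linear_combination (eta ^ 3 - 1) * eta_pow_three

theorem lineRoot_pow (ν : ℕ) : lineRoot ν ^ 6 = eta := by
  rw [lineRoot, mul_pow, baseRoot_pow, ← pow_mul, mul_comm ν, pow_mul, eta_pow_six, one_pow,
    mul_one]

theorem lineRoot_ne_zero (ν : ℕ) : lineRoot ν ≠ 0 := by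
  intro h
  have := lineRoot_pow ν
  rw [h] at this
  exact eta_ne_zero (by rw [← this]; norm_num)

theorem norm_lineRoot (ν : ℕ) : ‖lineRoot ν‖ = 1 := by
  have h : baseRoot = Complex.exp ((Real.pi / 18 : ℝ) * Complex.I) := by
    rw [baseRoot]; push_cast; rfl
  rw [lineRoot, norm_mul, norm_pow, norm_eta, one_pow, mul_one, h,
    Complex.norm_exp_ofReal_mul_I]

theorem prod_lineForm (v w : ℂ) :
    ∏ ν ∈ Finset.range 6, lineForm (lineRoot ν) v w = sextic v w := by
  have e2 := eta_sq
  have e3 := eta_pow_three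
  have e4 : eta ^ 4 = -eta := by linear_combination eta * e3
  have e5 : eta ^ 5 = 1 - eta := by linear_combination eta ^ 2 * e3 - e2
  have hpair : ∀ s, lineForm s v w * lineForm (-s) v w
      = 1 + (2 * w - v ^ 2) * s ^ 2 + (w ^ 2 - 2 * v) * s ^ 4 - s ^ 6 := by
    intro s; simp only [lineForm]; ring
  have hnorm : ∀ x y z : ℂ, (x + y + z) * (x + (eta - 1) * y - eta * z) *
      (x - eta * y + (eta - 1) * z) = x ^ 3 + y ^ 3 + z ^ 3 - 3 * x * y * z := by
    intro x y z
    linear_combination ((x + y + z) * (-(y * y) - z * z + 2 * y * z)) * e2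
  have h0 := hpair baseRoot
  have h1 := hpair (baseRoot * eta)
  have h2 := hpair (baseRoot * eta ^ 2)
  have b6 := baseRoot_pow
  simp only [Finset.prod_range_succ, Finset.prod_range_zero, lineRoot, pow_zero, pow_one, e3, e4,
    e5, mul_one, one_mul]
  have r3 : baseRoot * -1 = -baseRoot := by ring
  have r4 : baseRoot * -eta = -(baseRoot * eta) := by ring
  have r5 : baseRoot * (1 - eta) = -(baseRoot * eta ^ 2) := by rw [e2]; ring
  rw [r3, r4, r5]
  have key := hnorm (1 - eta) ((2 * w - v ^ 2) * baseRoot ^ 2) ((w ^ 2 - 2 * v) * baseRoot ^ 4)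
  have h0' : lineForm baseRoot v w * lineForm (-baseRoot) v w =
      (1 - eta) + (2 * w - v ^ 2) * baseRoot ^ 2 + (w ^ 2 - 2 * v) * baseRoot ^ 4 := by
    rw [h0, b6]; ring
  have h1' : lineForm (baseRoot * eta) v w * lineForm (-(baseRoot * eta)) v w =
      (1 - eta) + (eta - 1) * ((2 * w - v ^ 2) * baseRoot ^ 2)
        - eta * ((w ^ 2 - 2 * v) * baseRoot ^ 4) := by
    rw [h1, mul_pow, mul_pow, mul_pow, b6, eta_pow_six, e2, e4]; ring
  have h2' : lineForm (baseRoot * eta ^ 2) v w * lineForm (-(baseRoot * eta ^ 2)) v w =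
      (1 - eta) - eta * ((2 * w - v ^ 2) * baseRoot ^ 2)
        + (eta - 1) * ((w ^ 2 - 2 * v) * baseRoot ^ 4) := by
    have e8 : (eta ^ 2) ^ 4 = eta - 1 := by
      linear_combination eta ^ 2 * eta_pow_six + e2
    have e4' : (eta ^ 2) ^ 2 = -eta := by rw [← e4]; ring
    have e12 : (eta ^ 2) ^ 6 = 1 := by
      linear_combination (eta ^ 6 + 1) * eta_pow_six
    rw [h2, mul_pow, mul_pow, mul_pow, b6, e4', e8, e12]; ring
  have hprod : sextic v w = (1 - eta) ^ 3 + ((2 * w - v ^ 2) * baseRoot ^ 2) ^ 3 +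
      ((w ^ 2 - 2 * v) * baseRoot ^ 4) ^ 3 - 3 * (1 - eta) * ((2 * w - v ^ 2) * baseRoot ^ 2) *
      ((w ^ 2 - 2 * v) * baseRoot ^ 4) := by
    have c1 : ((2 * w - v ^ 2) * baseRoot ^ 2) ^ 3 = (2 * w - v ^ 2) ^ 3 * eta := by
      rw [← b6]; ring
    have c2 : ((w ^ 2 - 2 * v) * baseRoot ^ 4) ^ 3 = (w ^ 2 - 2 * v) ^ 3 * (eta - 1) := by
      rw [← e2, ← b6]; ring
    have c3 : 3 * (1 - eta) * ((2 * w - v ^ 2) * baseRoot ^ 2) * ((w ^ 2 - 2 * v) * baseRoot ^ 4)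
        = 3 * (2 * w - v ^ 2) * (w ^ 2 - 2 * v) := by
      have : baseRoot ^ 2 * baseRoot ^ 4 = eta := by rw [← b6]; ring
      linear_combination 3 * (1 - eta) * (2 * w - v ^ 2) * (w ^ 2 - 2 * v) * this +
        3 * (2 * w - v ^ 2) * (w ^ 2 - 2 * v) * eta_mul_one_sub
    rw [c1, c2, c3]
    simp only [sextic, powSum]
    linear_combination (eta - 2) * e2
  rw [hprod, ← key, ← h0', ← h1', ← h2']
  ring

/-! ### The critical points of the sextic -/

section Certificates

variable (v w : ℂ)

theorem sextic_mul_homSymm4 (hv : sexticV v w = 0) (hw : sexticW v w = 0) :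
    sextic v w * homSymm4 v w = 0 := by
  simp only [sextic, sexticV, sexticW, powSum, homSymm4, homSymm5] at *
  linear_combination ((-1 / 3 + (1 / 3) * eta) * w + (0 + (1 / 6) * eta) * w ^ 4 + (1 / 2 + (-1
      / 2) * eta) * v * w ^ 2 + (1 / 2 + (1 / 6) * eta) * v ^ 2 + (-2 / 3) * v ^ 3 * w + (1 / 6) *
      v ^ 5) * hv + ((-1 / 6) + (1 / 6 + (1 / 6) * eta) * w ^ 3 + (1 + (-1 / 3) * eta) * v * w +
      (-1 / 2) * v ^ 2 * w ^ 2 + (-1 / 3) * v ^ 3 + (1 / 6) * v ^ 4 * w) * hw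
      - ((2) * w ^ 5 + (-8) * v * w ^ 3 + (-3) * v * w ^ 6 + (-8) * v ^ 2 * w + (3) * v ^ 2 * w ^
      4 + (20) * v ^ 3 * w ^ 2 + (4) * v ^ 3 * w ^ 5 + (-4) * v ^ 4 + (-11) * v ^ 4 * w ^ 3 + (-1)
      * v ^ 5 * w ^ 4 + (3) * v ^ 6 * w ^ 2 + (-1) * v ^ 7) * eta_sq

theorem sextic_mul_homSymm5 (hv : sexticV v w = 0) (hw : sexticW v w = 0) :
    sextic v w * homSymm5 v w = 0 := by
  simp only [sextic, sexticV, sexticW, powSum, homSymm4, homSymm5] at *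
  linear_combination ((1 / 6) + (-1 / 3 + (-2 / 3) * eta) * w ^ 3 + (0 + (-1 / 6) * eta) * w ^ 6
      + (-5 / 3 + (1) * eta) * v * w + (0 + (5 / 6) * eta) * v * w ^ 4 + (3 / 2 + (-1) * eta) * v
      ^ 2 * w ^ 2 + (5 / 6 + (1 / 6) * eta) * v ^ 3 + (-1) * v ^ 4 * w + (1 / 6) * v ^ 6) * hv +
      ((-1 / 6 + (-1 / 2) * eta) * w ^ 2 + (0 + (-1 / 6) * eta) * w ^ 5 + (-1 / 3 + (1 / 3) * eta)
      * v + (0 + (2 / 3) * eta) * v * w ^ 3 + (1 / 2 + (-1 / 2) * eta) * v ^ 2 * w + (-1 / 6) * v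
      ^ 4) * hw
      - ((-12) * w ^ 4 + (-3) * w ^ 7 + (8) * v * w ^ 2 + (24) * v * w ^ 5 + (3) * v * w ^ 8 +
      (-4) * v ^ 2 * w ^ 3 + (-9) * v ^ 2 * w ^ 6 + (-24) * v ^ 3 * w + (-25) * v ^ 3 * w ^ 4 +
      (-4) * v ^ 3 * w ^ 7 + (45) * v ^ 4 * w ^ 2 + (19) * v ^ 4 * w ^ 5 + (-2) * v ^ 5 + (-16) *
      v ^ 5 * w ^ 3 + (1) * v ^ 5 * w ^ 6 + (-5) * v ^ 6 * w + (-5) * v ^ 6 * w ^ 4 + (6) * v ^ 7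
      * w ^ 2 + (-1) * v ^ 8) * eta_sq

end Certificates

theorem sextic_critical_of_ne_zero {v w : ℂ} (hv : sexticV v w = 0) (hw : sexticW v w = 0)
    (h0 : sextic v w ≠ 0) :
    (v = 0 ∧ w = 0) ∨ (v ^ 3 = 8 ∧ w = v ^ 2 / 2) ∨ (v * w = 1 ∧ v ^ 3 = 1 - eta) ∨
      (v * w = 1 ∧ v ^ 3 = eta) := by
  have h4 := (mul_eq_zero.1 (sextic_mul_homSymm4 v w hv hw)).resolve_left h0
  have h5 := (mul_eq_zero.1 (sextic_mul_homSymm5 v w hv hw)).resolve_left h0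
  have k4 : homSymm4 w v = 0 := by
    rw [sexticV, h5] at hv
    have : (1 - eta) * homSymm4 w v = 0 := by linear_combination hv / 6
    exact (mul_eq_zero.1 this).resolve_left one_sub_eta_ne_zero
  have k5 : homSymm5 w v = 0 := by
    rw [sexticW, h4] at hw
    have : (1 - eta) * homSymm5 w v = 0 := by linear_combination -hw / 6
    exact (mul_eq_zero.1 this).resolve_left one_sub_eta_ne_zero
  simp only [homSymm4, homSymm5] at h4 h5 k4 k5
  have a1 : (v ^ 2 - 2 * w) * (v * w - 1) = 0 := by linear_combination v * h4 - h5
  have a2 : (w ^ 2 - 2 * v) * (v * w - 1) = 0 := by linear_combination w * k4 - k5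
  rcases mul_eq_zero.1 a1 with b1 | b1
  · rcases mul_eq_zero.1 a2 with b2 | b2
    · have c : v * (v ^ 3 - 8) = 0 := by linear_combination (v ^ 2 + 2 * w) * b1 + 4 * b2
      rcases mul_eq_zero.1 c with c | c
      · left
        refine ⟨c, ?_⟩
        rw [c] at b1
        linear_combination -b1 / 2
      · right; left
        exact ⟨by linear_combination c, by linear_combination -b1 / 2⟩
    · exfalso
      have hc : v ^ 3 = 2 := by linear_combination v * b1 + 2 * b2
      have hd : v ^ 6 - v ^ 3 + 1 = 0 := by
        linear_combination v ^ 2 * h4 + (3 * v ^ 3 - v * w - 1) * b2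
      have : (v ^ 3) ^ 2 - v ^ 3 + 1 = 0 := by linear_combination hd
      rw [hc] at this
      norm_num at this
  · right; right
    have hd : v ^ 6 - v ^ 3 + 1 = 0 := by
      linear_combination v ^ 2 * h4 + (3 * v ^ 3 - v * w - 1) * b1
    have he : (v ^ 3 - (1 - eta)) * (v ^ 3 - eta) = 0 := by
      linear_combination hd - eta_sq
    have hvw : v * w = 1 := by linear_combination b1
    rcases mul_eq_zero.1 he with f | f
    · left; exact ⟨hvw, by linear_combination f⟩
    · right; exact ⟨hvw, by linear_combination f⟩

theorem hasDerivAt_sextic (v w : ℂ) : HasDerivAt (fun x => sextic x w) (sexticV v w) v := by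
  have h : HasDerivAt (fun x : ℂ => 2 - eta * (x ^ 6 - 6 * x ^ 4 * w + 6 * x ^ 3
      + 9 * x ^ 2 * w ^ 2 - 12 * x * w - 2 * w ^ 3 + 3) - (1 - eta) * (w ^ 6 - 6 * w ^ 4 * x
      + 6 * w ^ 3 + 9 * w ^ 2 * x ^ 2 - 12 * w * x - 2 * x ^ 3 + 3)) (sexticV v w) v := by
    have hp : ∀ n : ℕ, HasDerivAt (fun x : ℂ => x ^ n) (n * v ^ (n - 1)) v :=
      fun n => hasDerivAt_pow n v
    have h1 := hasDerivAt_id' v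
    refine (HasDerivAt.sub (((((((((hp 6).sub (((hp 4).const_mul 6).mul_const w)).add
      ((hp 3).const_mul 6)).add (((hp 2).const_mul 9).mul_const (w ^ 2))).sub
      ((h1.const_mul 12).mul_const w)).sub_const (2 * w ^ 3)).add_const 3).const_mul eta).const_sub
      2) (((((((h1.const_mul (6 * w ^ 4)).const_sub (w ^ 6)).add_const (6 * w ^ 3)).add
      ((hp 2).const_mul (9 * w ^ 2))).sub (h1.const_mul (12 * w))).sub
      ((hp 3).const_mul 2)).add_const 3 |>.const_mul (1 - eta))).congr_deriv ?_
    simp only [sexticV, homSymm4, homSymm5]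
    push_cast
    ring
  exact h

theorem sextic_critical_of_eq_zero {v w : ℂ} (hv : sexticV v w = 0) (h0 : sextic v w = 0) :
    ∃ i j, i < j ∧ j < 6 ∧ lineForm (lineRoot i) v w = 0 ∧ lineForm (lineRoot j) v w = 0 := by
  have hp := prod_lineForm v w
  rw [h0, Finset.prod_eq_zero_iff] at hp
  obtain ⟨i, hi, hli⟩ := hp
  set R : ℂ → ℂ := fun x => ∏ ν ∈ (Finset.range 6).erase i, lineForm (lineRoot ν) x w with hR
  have hl : HasDerivAt (fun x => lineForm (lineRoot i) x w) (-lineRoot i) v := by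
    have := (((((hasDerivAt_id' v).mul_const (lineRoot i)).const_sub 1).add_const
      (w * lineRoot i ^ 2)).sub_const (lineRoot i ^ 3))
    simpa [lineForm] using this
  have hRd : DifferentiableAt ℂ R v := by
    have : ∀ ν ∈ (Finset.range 6).erase i,
        DifferentiableAt ℂ (fun x => lineForm (lineRoot ν) x w) v := by
      intro ν _
      simp only [lineForm]
      fun_prop
    have h := DifferentiableAt.fun_finsetProd this
    exact h
  have hmul := hl.mul hRd.hasDerivAt
  have hEq : ((fun x => lineForm (lineRoot i) x w) * R) = fun x => sextic x w := by
    funext x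
    rw [← prod_lineForm x w, ← Finset.mul_prod_erase _ _ hi]
    rfl
  rw [hEq] at hmul
  have hu := hmul.unique (hasDerivAt_sextic v w)
  rw [hli, hv, zero_mul, add_zero] at hu
  have hR0 : R v = 0 := by
    rcases mul_eq_zero.1 hu with h | h
    · exact absurd (neg_eq_zero.1 h) (lineRoot_ne_zero i)
    · exact h
  rw [hR] at hR0
  obtain ⟨j, hj, hlj⟩ := Finset.prod_eq_zero_iff.1 hR0
  rw [Finset.mem_erase, Finset.mem_range] at hj
  rw [Finset.mem_range] at hi
  rcases lt_or_gt_of_ne hj.1 with h | h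
  · exact ⟨j, i, h, hi, hlj, hli⟩
  · exact ⟨i, j, h, hj.2, hli, hlj⟩

theorem hasDerivAt_sextic_right (v w : ℂ) :
    HasDerivAt (fun x => sextic v x) (sexticW v w) w := by
  have h : HasDerivAt (fun x : ℂ => 2 - (1 - eta) * (x ^ 6 - 6 * x ^ 4 * v + 6 * x ^ 3
      + 9 * x ^ 2 * v ^ 2 - 12 * x * v - 2 * v ^ 3 + 3) - eta * (v ^ 6 - 6 * v ^ 4 * x
      + 6 * v ^ 3 + 9 * v ^ 2 * x ^ 2 - 12 * v * x - 2 * x ^ 3 + 3)) (sexticW v w) w := by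
    have hp : ∀ n : ℕ, HasDerivAt (fun x : ℂ => x ^ n) (n * w ^ (n - 1)) w :=
      fun n => hasDerivAt_pow n w
    have h1 := hasDerivAt_id' w
    refine (HasDerivAt.sub (((((((((hp 6).sub (((hp 4).const_mul 6).mul_const v)).add
      ((hp 3).const_mul 6)).add (((hp 2).const_mul 9).mul_const (v ^ 2))).sub
      ((h1.const_mul 12).mul_const v)).sub_const (2 * v ^ 3)).add_const 3).const_mul
      (1 - eta)).const_sub
      2) (((((((h1.const_mul (6 * v ^ 4)).const_sub (v ^ 6)).add_const (6 * v ^ 3)).add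
      ((hp 2).const_mul (9 * v ^ 2))).sub (h1.const_mul (12 * v))).sub
      ((hp 3).const_mul 2)).add_const 3 |>.const_mul eta)).congr_deriv ?_
    simp only [sexticW, homSymm4, homSymm5]
    push_cast
    ring
  have e : (fun x : ℂ => 2 - (1 - eta) * (x ^ 6 - 6 * x ^ 4 * v + 6 * x ^ 3
      + 9 * x ^ 2 * v ^ 2 - 12 * x * v - 2 * v ^ 3 + 3) - eta * (v ^ 6 - 6 * v ^ 4 * x
      + 6 * v ^ 3 + 9 * v ^ 2 * x ^ 2 - 12 * v * x - 2 * x ^ 3 + 3)) = fun x => sextic v x := by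
    funext x
    simp only [sextic, powSum]
    ring
  rwa [e] at h

/-- The product of the lines other than the `i`-th and the `j`-th. -/
def lineCofactor (i j : ℕ) (v w : ℂ) : ℂ :=
  ∏ ν ∈ ((Finset.range 6).erase i).erase j, lineForm (lineRoot ν) v w

theorem sextic_eq_mul_lineCofactor {i j : ℕ} (hij : i ≠ j) (hi : i < 6) (hj : j < 6) (v w : ℂ) :
    sextic v w =
      lineForm (lineRoot i) v w * lineForm (lineRoot j) v w * lineCofactor i j v w := by
  rw [← prod_lineForm, ← Finset.mul_prod_erase _ _ (Finset.mem_range.2 hi),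
    ← Finset.mul_prod_erase _ _ (Finset.mem_erase.2 ⟨hij.symm, Finset.mem_range.2 hj⟩), mul_assoc]
  rfl

/-- `(v, w)` is a critical point of the sextic. -/
def IsSexticCritical (v w : ℂ) : Prop := sexticV v w = 0 ∧ sexticW v w = 0

theorem HasDerivAt.eq_zero_of_mul_eq {f g k F : ℂ → ℂ} {x F' : ℂ} (hF : HasDerivAt F F' x)
    (e : ∀ y, F y = f y * g y * k y) (hf : DifferentiableAt ℂ f x) (hg : DifferentiableAt ℂ g x)
    (hk : DifferentiableAt ℂ k x) (hf0 : f x = 0) (hg0 : g x = 0) : F' = 0 := by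
  have h := (hf.hasDerivAt.mul hg.hasDerivAt).mul hk.hasDerivAt
  have e' : F = f * g * k := funext e
  rw [← e'] at h
  have := hF.unique h
  rw [this]
  simp [hf0, hg0]

theorem isSexticCritical_of_two_lines {i j : ℕ} (hij : i ≠ j) (hi : i < 6) (hj : j < 6) {v w : ℂ}
    (h1 : lineForm (lineRoot i) v w = 0) (h2 : lineForm (lineRoot j) v w = 0) :
    IsSexticCritical v w := by
  have dv : ∀ s : ℂ, DifferentiableAt ℂ (fun x => lineForm s x w) v := by
    intro s; simp only [lineForm]; fun_prop
  have dw : ∀ s : ℂ, DifferentiableAt ℂ (fun x => lineForm s v x) w := by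
    intro s; simp only [lineForm]; fun_prop
  constructor
  · exact HasDerivAt.eq_zero_of_mul_eq (hasDerivAt_sextic v w)
      (fun y => sextic_eq_mul_lineCofactor hij hi hj y w) (dv _) (dv _)
      (DifferentiableAt.fun_finsetProd fun ν _ => dv _) h1 h2
  · exact HasDerivAt.eq_zero_of_mul_eq (hasDerivAt_sextic_right v w)
      (fun y => sextic_eq_mul_lineCofactor hij hi hj v y) (dw _) (dw _)
      (DifferentiableAt.fun_finsetProd fun ν _ => dw _) h1 h2

theorem isPrimitiveRoot_eta : IsPrimitiveRoot eta 6 := by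
  have h := Complex.isPrimitiveRoot_exp 6 (by norm_num)
  have e : eta = Complex.exp (2 * Real.pi * Complex.I / (6 : ℕ)) := by
    rw [eta]; congr 1; push_cast; ring
  rwa [e]

theorem lineRoot_inj {i j : ℕ} (hi : i < 6) (hj : j < 6) (h : lineRoot i = lineRoot j) : i = j := by
  have hb : baseRoot ≠ 0 := Complex.exp_ne_zero _
  exact isPrimitiveRoot_eta.pow_inj hi hj (mul_left_cancel₀ hb h)

theorem lineForm_unique {s t v w v' w' : ℂ} (hs : s ≠ 0) (ht : t ≠ 0) (hst : s ≠ t)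
    (h1 : lineForm s v w = 0) (h2 : lineForm t v w = 0) (h3 : lineForm s v' w' = 0)
    (h4 : lineForm t v' w' = 0) : v = v' ∧ w = w' := by
  simp only [lineForm] at *
  have hd : s - t ≠ 0 := sub_ne_zero.2 hst
  have hw : (s * t * (s - t)) * (w - w') = 0 := by
    linear_combination t * (h1 - h3) - s * (h2 - h4)
  have hv : (s * t * (s - t)) * (v - v') = 0 := by
    linear_combination t ^ 2 * (h1 - h3) - s ^ 2 * (h2 - h4)
  have h0 : s * t * (s - t) ≠ 0 := mul_ne_zero (mul_ne_zero hs ht) hd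
  exact ⟨sub_eq_zero.1 ((mul_eq_zero.1 hv).resolve_left h0),
    sub_eq_zero.1 ((mul_eq_zero.1 hw).resolve_left h0)⟩

theorem mul_mul_eq_one_of_lineForm {s t u v w : ℂ} (hst : s ≠ t) (hsu : s ≠ u) (htu : t ≠ u)
    (h1 : lineForm s v w = 0) (h2 : lineForm t v w = 0) (h3 : lineForm u v w = 0) :
    s * t * u = 1 := by
  simp only [lineForm] at *
  have d1 : -v + w * (s + t) - (s ^ 2 + s * t + t ^ 2) = 0 := by
    apply mul_left_cancel₀ (sub_ne_zero.2 hst)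
    linear_combination h1 - h2
  have d2 : -v + w * (s + u) - (s ^ 2 + s * u + u ^ 2) = 0 := by
    apply mul_left_cancel₀ (sub_ne_zero.2 hsu)
    linear_combination h1 - h3
  have d3 : w - (s + t + u) = 0 := by
    apply mul_left_cancel₀ (sub_ne_zero.2 htu)
    linear_combination d1 - d2
  linear_combination -h1 + s * d1 - s * t * d3

theorem eq_or_eq_of_lineForm {i j k : ℕ} (hij : i ≠ j) (hi : i < 6) (hj : j < 6) (hk : k < 6)
    {v w : ℂ} (h1 : lineForm (lineRoot i) v w = 0) (h2 : lineForm (lineRoot j) v w = 0)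
    (h3 : lineForm (lineRoot k) v w = 0) : k = i ∨ k = j := by
  by_contra! hne
  have h := mul_mul_eq_one_of_lineForm (fun e => hij (lineRoot_inj hi hj e))
    (fun e => hne.1 (lineRoot_inj hi hk e).symm) (fun e => hne.2 (lineRoot_inj hj hk e).symm)
    h1 h2 h3
  have h6 : (lineRoot i * lineRoot j * lineRoot k) ^ 6 = eta ^ 3 := by
    rw [mul_pow, mul_pow, lineRoot_pow, lineRoot_pow, lineRoot_pow]; ring
  rw [h, eta_pow_three] at h6
  norm_num at h6

theorem lineCofactor_ne_zero {i j : ℕ} (hij : i ≠ j) (hi : i < 6) (hj : j < 6)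
    {v w : ℂ} (h1 : lineForm (lineRoot i) v w = 0) (h2 : lineForm (lineRoot j) v w = 0) :
    lineCofactor i j v w ≠ 0 := by
  intro h
  obtain ⟨k, hk, h3⟩ := Finset.prod_eq_zero_iff.1 h
  simp only [Finset.mem_erase, Finset.mem_range] at hk
  rcases eq_or_eq_of_lineForm hij hi hj hk.2.2 h1 h2 h3 with e | e
  · exact hk.2.1 e
  · exact hk.1 e

theorem star_lineRoot (i : ℕ) : (starRingEnd ℂ) (lineRoot i) = (lineRoot i)⁻¹ :=
  (Complex.inv_eq_conj (norm_lineRoot i)).symm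

theorem lineForm_star {i : ℕ} {v w : ℂ} (h : lineForm (lineRoot i) v w = 0) :
    lineForm (lineRoot i) ((starRingEnd ℂ) w) ((starRingEnd ℂ) v) = 0 := by
  have h' := congrArg (starRingEnd ℂ) h
  have h0 := lineRoot_ne_zero i
  simp only [lineForm, map_sub, map_add, map_mul, map_pow, map_one, map_zero,
    star_lineRoot] at h' ⊢
  field_simp at h'
  linear_combination -h'

/-- The intersection point of the `i`-th and the `j`-th line. -/
def linePoint (i j : ℕ) : ℂ := lineRoot i + lineRoot j + (lineRoot i * lineRoot j)⁻¹

theorem lineForm_linePoint (i j : ℕ) :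
    lineForm (lineRoot i) ((starRingEnd ℂ) (linePoint i j)) (linePoint i j) = 0 ∧
      lineForm (lineRoot j) ((starRingEnd ℂ) (linePoint i j)) (linePoint i j) = 0 := by
  have hi := lineRoot_ne_zero i
  have hj := lineRoot_ne_zero j
  simp only [lineForm, linePoint, map_add, map_mul, map_inv₀, star_lineRoot]
  constructor
  · field_simp; ring
  · field_simp; ring

theorem eq_of_norm_of_mul {v w : ℂ} (h : v * w = ‖v‖ ^ 2) (h0 : v ≠ 0) :
    v = (starRingEnd ℂ) w := by
  have : w = (starRingEnd ℂ) v := by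
    apply mul_left_cancel₀ h0
    rw [h, Complex.mul_conj']
  rw [this, Complex.conj_conj]

theorem norm_eq_of_pow_three {v a : ℂ} {b : ℝ} (hb : 0 ≤ b) (h : v ^ 3 = a) (ha : ‖a‖ = b ^ 3) :
    ‖v‖ = b := by
  have := congrArg norm h
  rw [norm_pow, ha] at this
  exact (pow_left_inj₀ (norm_nonneg _) hb (by norm_num)).1 this

theorem IsSexticCritical.eq_star {v w : ℂ} (h : IsSexticCritical v w) :
    v = (starRingEnd ℂ) w := by
  by_cases h0 : sextic v w = 0
  · obtain ⟨i, j, hij, hj, h1, h2⟩ := sextic_critical_of_eq_zero h.1 h0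
    exact (lineForm_unique (lineRoot_ne_zero i) (lineRoot_ne_zero j)
      (fun e => hij.ne (lineRoot_inj (hij.trans hj) hj e)) h1 h2 (lineForm_star h1)
      (lineForm_star h2)).1
  · rcases sextic_critical_of_ne_zero h.1 h.2 h0 with ⟨rfl, rfl⟩ | ⟨h3, hw⟩ | ⟨h1, h3⟩ | ⟨h1, h3⟩
    · simp
    · have hn : ‖v‖ = 2 := norm_eq_of_pow_three (by norm_num) h3 (by norm_num)
      apply eq_of_norm_of_mul
      · rw [hn, hw]; push_cast; linear_combination h3 / 2
      · intro e; rw [e] at hn; norm_num at hn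
    · have hn : ‖v‖ = 1 := norm_eq_of_pow_three (by norm_num) h3 (by rw [norm_one_sub_eta]; norm_num)
      apply eq_of_norm_of_mul
      · rw [hn, h1]; norm_num
      · intro e; rw [e] at hn; norm_num at hn
    · have hn : ‖v‖ = 1 := norm_eq_of_pow_three (by norm_num) h3 (by rw [norm_eta]; norm_num)
      apply eq_of_norm_of_mul
      · rw [hn, h1]; norm_num
      · intro e; rw [e] at hn; norm_num at hn

theorem powSum_eq (v w : ℂ) : powSum v w = (v ^ 3) ^ 2 - 6 * v ^ 3 * (v * w) + 6 * v ^ 3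
    + 9 * (v * w) ^ 2 - 12 * (v * w) - 2 * w ^ 3 + 3 := by
  rw [powSum]; ring

theorem homSymm_eq_zero {v w : ℂ} (h : v * w = 1) (h3 : (v ^ 3) ^ 2 - v ^ 3 + 1 = 0) :
    homSymm4 v w = 0 ∧ homSymm5 v w = 0 := by
  have h0 : v ≠ 0 := left_ne_zero_of_mul_eq_one h
  constructor
  · apply mul_left_cancel₀ (pow_ne_zero 2 h0)
    rw [homSymm4]
    linear_combination h3 + (-3 * v ^ 3 + v * w + 1) * h
  · apply mul_left_cancel₀ h0
    rw [homSymm5]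
    linear_combination h3 + (-4 * v ^ 3 + 3 * v * w + 1) * h

theorem isSexticCritical_of_homSymm {v w : ℂ} (h : homSymm4 v w = 0 ∧ homSymm5 v w = 0)
    (h' : homSymm4 w v = 0 ∧ homSymm5 w v = 0) : IsSexticCritical v w := by
  constructor
  · rw [sexticV, h.2, h'.1]; ring
  · rw [sexticW, h.1, h'.2]; ring

/-- The critical point `w` (with `v` its conjugate) is a nondegenerate extremum:
the Hessian is definite. -/
def HasDefiniteHessian (v w : ℂ) (b : ℝ) : Prop :=
  sexticB v w = b ∧ ‖sexticA v w 0 0‖ + ‖sexticC v w 0 0‖ < |b|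

theorem norm_sexticC (w : ℂ) :
    ‖sexticC ((starRingEnd ℂ) w) w 0 0‖ = ‖sexticA ((starRingEnd ℂ) w) w 0 0‖ := by
  rw [← Complex.norm_conj]
  congr 1
  simp only [sexticC, sexticA, powSumA, powSumC, map_sub, map_add, map_mul, map_neg, map_pow,
    Complex.conj_conj, star_eta, map_one, map_zero, map_ofNat]
  ring

theorem sextic_at_zero :
    IsSexticCritical 0 0 ∧ sextic 0 0 = -1 ∧ HasDefiniteHessian 0 0 12 := by
  refine ⟨isSexticCritical_of_homSymm ?_ ?_, ?_, ?_, ?_⟩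
  · simp [homSymm4, homSymm5]
  · simp [homSymm4, homSymm5]
  · simp [sextic, powSum]; ring
  · simp [sexticB]; ring
  · simp [sexticA, sexticC, powSumA, powSumC]

theorem sextic_at_cube_eight {w : ℂ} (h : w ^ 3 = 8) :
    IsSexticCritical ((starRingEnd ℂ) w) w ∧ sextic ((starRingEnd ℂ) w) w = -1 ∧
      HasDefiniteHessian ((starRingEnd ℂ) w) w 60 := by
  have hn : ‖w‖ = 2 := norm_eq_of_pow_three (by norm_num) h (by norm_num)
  have hC := norm_sexticC w
  have hn' : ‖(starRingEnd ℂ) w‖ = 2 := by rw [Complex.norm_conj, hn]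
  have hm : (starRingEnd ℂ) w * w = 4 := by
    rw [Complex.conj_mul', hn]; norm_num
  have h' : (starRingEnd ℂ) w ^ 3 = 8 := by rw [← map_pow, h, Complex.conj_ofNat]
  set v := (starRingEnd ℂ) w
  have hw0 : w ≠ 0 := by intro e; rw [e] at hn; norm_num at hn
  have hv0 : v ≠ 0 := by intro e; rw [e] at hn'; norm_num at hn'
  have e1 : w ^ 2 = 2 * v := by
    apply mul_left_cancel₀ hw0; linear_combination h - 2 * hm
  have e2 : v ^ 2 = 2 * w := by
    apply mul_left_cancel₀ hv0; linear_combination h' - 2 * hm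
  refine ⟨isSexticCritical_of_homSymm ⟨?_, ?_⟩ ⟨?_, ?_⟩, ?_, ?_, ?_⟩
  · rw [homSymm4]; linear_combination v * h' + e1 - 3 * v * hm
  · rw [homSymm5]
    linear_combination (v ^ 2 - 4 * w) * h' + 3 * w * hm + 11 * e2
  · rw [homSymm4]; linear_combination w * h + e2 - 3 * w * hm
  · rw [homSymm5]
    linear_combination (w ^ 2 - 4 * v) * h + 3 * v * hm + 11 * e1
  · rw [sextic, powSum_eq, powSum_eq, mul_comm w v, hm, h, h']; ring
  · have : sexticB v w = -eta * (-24 * v ^ 3 + 36 * (v * w) - 12)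
      - (1 - eta) * (-24 * w ^ 3 + 36 * (v * w) - 12) := by rw [sexticB]; ring
    rw [this, hm, h, h']; push_cast; ring
  · rw [hC]
    have : sexticA v w 0 0 = -12 * v := by
      simp only [sexticA, powSumA, powSumC]
      linear_combination -eta * (15 * v * h' - 36 * v * hm + 9 * e1) - (1 - eta) * (9 * e1)
    rw [this, norm_mul, hn']
    norm_num

theorem sextic_at_cube_eta {w : ℂ} (h : w ^ 3 = eta) :
    IsSexticCritical ((starRingEnd ℂ) w) w ∧ sextic ((starRingEnd ℂ) w) w = -1 ∧
      HasDefiniteHessian ((starRingEnd ℂ) w) w 24 := by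
  have hn : ‖w‖ = 1 := norm_eq_of_pow_three (by norm_num) h (by rw [norm_eta]; norm_num)
  have hC := norm_sexticC w
  have hn' : ‖(starRingEnd ℂ) w‖ = 1 := by rw [Complex.norm_conj, hn]
  have hm : (starRingEnd ℂ) w * w = 1 := by
    rw [Complex.conj_mul', hn]; norm_num
  have h' : (starRingEnd ℂ) w ^ 3 = 1 - eta := by rw [← map_pow, h, star_eta]
  set v := (starRingEnd ℂ) w
  have e2 := eta_sq
  have hw0 : w ≠ 0 := by intro e; rw [e] at hn; norm_num at hn
  have ew : w ^ 2 = eta * v := by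
    apply mul_left_cancel₀ hw0; linear_combination h - eta * hm
  refine ⟨isSexticCritical_of_homSymm (homSymm_eq_zero hm ?_) (homSymm_eq_zero ?_ ?_), ?_, ?_, ?_⟩
  · rw [h']; linear_combination e2
  · rw [mul_comm, hm]
  · rw [h]; linear_combination e2
  · rw [sextic, powSum_eq, powSum_eq, mul_comm w v, hm, h, h']
    linear_combination 5 * e2
  · have : sexticB v w = -eta * (-24 * v ^ 3 + 36 * (v * w) - 12)
      - (1 - eta) * (-24 * w ^ 3 + 36 * (v * w) - 12) := by rw [sexticB]; ring
    rw [this, hm, h, h']; push_cast; linear_combination -48 * e2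
  · rw [hC]
    have : sexticA v w 0 0 = -v * (6 + 3 * (1 - eta)) := by
      simp only [sexticA, powSumA, powSumC]
      linear_combination -eta * (15 * v * h' - 36 * v * hm + 9 * ew) - (1 - eta) * (9 * ew)
        + 15 * v * e2
    have hb : ‖6 + 3 * (1 - eta)‖ ≤ 9 := by
      refine (norm_add_le _ _).trans ?_
      rw [norm_mul, norm_one_sub_eta]; norm_num
    rw [this, norm_mul, norm_neg, hn', one_mul]
    rw [abs_of_pos (by norm_num)]
    linarith

theorem sextic_at_cube_one_sub_eta {w : ℂ} (h : w ^ 3 = 1 - eta) :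
    IsSexticCritical ((starRingEnd ℂ) w) w ∧ sextic ((starRingEnd ℂ) w) w = 8 ∧
      HasDefiniteHessian ((starRingEnd ℂ) w) w (-48) := by
  have hn : ‖w‖ = 1 := norm_eq_of_pow_three (by norm_num) h (by rw [norm_one_sub_eta]; norm_num)
  have hC := norm_sexticC w
  have hn' : ‖(starRingEnd ℂ) w‖ = 1 := by rw [Complex.norm_conj, hn]
  have hm : (starRingEnd ℂ) w * w = 1 := by
    rw [Complex.conj_mul', hn]; norm_num
  have h' : (starRingEnd ℂ) w ^ 3 = eta := by
    rw [← map_pow, h, map_sub, star_eta, map_one]; ring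
  set v := (starRingEnd ℂ) w
  have e2 := eta_sq
  have hw0 : w ≠ 0 := by intro e; rw [e] at hn; norm_num at hn
  have ew : w ^ 2 = (1 - eta) * v := by
    apply mul_left_cancel₀ hw0; linear_combination h - (1 - eta) * hm
  refine ⟨isSexticCritical_of_homSymm (homSymm_eq_zero hm ?_) (homSymm_eq_zero ?_ ?_), ?_, ?_, ?_⟩
  · rw [h']; linear_combination e2
  · rw [mul_comm, hm]
  · rw [h]; linear_combination e2
  · rw [sextic, powSum_eq, powSum_eq, mul_comm w v, hm, h, h']
    linear_combination -7 * e2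
  · have : sexticB v w = -eta * (-24 * v ^ 3 + 36 * (v * w) - 12)
      - (1 - eta) * (-24 * w ^ 3 + 36 * (v * w) - 12) := by rw [sexticB]; ring
    rw [this, hm, h, h']; push_cast; linear_combination 48 * e2
  · rw [hC]
    have : sexticA v w 0 0 = v * (9 + 9 * eta + 3 * (1 - eta)) := by
      simp only [sexticA, powSumA, powSumC]
      linear_combination -eta * (15 * v * h' - 36 * v * hm + 9 * ew) - (1 - eta) * (9 * ew)
        - 15 * v * e2
    have hb : ‖9 + 9 * eta + 3 * (1 - eta)‖ ≤ 21 := by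
      refine (norm_add₃_le).trans ?_
      rw [norm_mul, norm_mul, norm_one_sub_eta, norm_eta]; norm_num
    rw [this, norm_mul, hn', one_mul]
    rw [abs_of_neg (by norm_num)]
    linarith

/-! ### The special points -/

theorem rot_eq : rot = eta ^ 2 := by
  rw [rot, eta, ← Complex.exp_nat_mul]
  congr 1
  push_cast
  ring

theorem alpha_eq : alpha = Complex.exp ((Real.pi / 9 : ℝ) * Complex.I) := by
  rw [alpha]; congr 1; push_cast; ring

theorem alpha_pow : alpha ^ 3 = eta := by
  rw [alpha, eta, ← Complex.exp_nat_mul]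
  congr 1
  push_cast
  ring

theorem rot_pow_three : rot ^ 3 = 1 := by
  rw [rot_eq, ← pow_mul, eta_pow_six]

theorem rot_sq_add : rot ^ 2 + rot + 1 = 0 := by
  rw [rot_eq]; linear_combination (eta ^ 2 + eta + 1) * eta_sq

theorem rot_ne_zero : rot ≠ 0 := Complex.exp_ne_zero _

theorem rot_ne_one : rot ≠ 1 := by
  intro h
  have := rot_sq_add
  rw [h] at this
  norm_num at this

theorem star_rot : star rot = rot ^ 2 := by
  have : (starRingEnd ℂ) rot = rot ^ 2 := by
    rw [rot_eq, map_pow, star_eta]; linear_combination -(eta ^ 2 + eta - 1) * eta_sq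
  exact this

theorem star_alpha_pow : (star alpha) ^ 3 = 1 - eta := by
  rw [← star_pow, alpha_pow]; exact star_eta

theorem pow_three_eq_iff {β z : ℂ} :
    z ^ 3 = β ^ 3 ↔ z = β ∨ z = rot * β ∨ z = rot ^ 2 * β := by
  have h : z ^ 3 - β ^ 3 = (z - β) * ((z - rot * β) * (z - rot ^ 2 * β)) := by
    linear_combination (β * (z - β) * z) * rot_sq_add + (z - β) * β ^ 2 * (-1) * rot_pow_three
  rw [← sub_eq_zero, h, mul_eq_zero, mul_eq_zero, sub_eq_zero, sub_eq_zero, sub_eq_zero]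

theorem ncard_cube_roots {β : ℂ} (hβ : β ≠ 0) : {z : ℂ | z ^ 3 = β ^ 3}.ncard = 3 := by
  have h : {z : ℂ | z ^ 3 = β ^ 3} = {β, rot * β, rot ^ 2 * β} := by
    ext z; simp [pow_three_eq_iff]
  have h1 := rot_ne_one
  have h0 := rot_ne_zero
  rw [h, Set.ncard_eq_three]
  refine ⟨β, rot * β, rot ^ 2 * β, ?_, ?_, ?_, rfl⟩
  · intro e
    apply h1; apply mul_right_cancel₀ hβ; rw [← e, one_mul]
  · intro e
    have e1 : rot ^ 2 = 1 := by apply mul_right_cancel₀ hβ; rw [← e, one_mul]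
    apply h1; linear_combination rot_pow_three - rot * e1
  · intro e
    have e1 : rot = rot ^ 2 := mul_right_cancel₀ hβ e
    apply h1; apply mul_left_cancel₀ h0; linear_combination -e1

theorem mem_minPts {z : ℂ} : z ∈ minPts ↔ z = 0 ∨ z ^ 3 = 8 ∨ z ^ 3 = eta := by
  have e8 : (8 : ℂ) = 2 ^ 3 := by norm_num
  rw [e8, ← alpha_pow, pow_three_eq_iff, pow_three_eq_iff, minPts, mul_comm rot 2,
    mul_comm (rot ^ 2) 2]
  simp only [Set.mem_insert_iff, Set.mem_singleton_iff]
  tauto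

theorem mem_maxPts {z : ℂ} : z ∈ maxPts ↔ z ^ 3 = 1 - eta := by
  have e : (star rot) ^ 2 = rot := by
    rw [star_rot]; linear_combination rot * rot_pow_three
  rw [← star_alpha_pow, pow_three_eq_iff, maxPts, e, star_rot]
  simp only [Set.mem_insert_iff, Set.mem_singleton_iff]
  tauto

theorem minPts_eq_union :
    minPts = {0} ∪ ({z : ℂ | z ^ 3 = 2 ^ 3} ∪ {z : ℂ | z ^ 3 = alpha ^ 3}) := by
  ext z
  rw [mem_minPts, alpha_pow]
  norm_num

theorem alpha_ne_zero : alpha ≠ 0 := Complex.exp_ne_zero _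

theorem finite_cube_roots {β : ℂ} (hβ : β ≠ 0) : {z : ℂ | z ^ 3 = β ^ 3}.Finite :=
  Set.finite_of_ncard_ne_zero (by rw [ncard_cube_roots hβ]; norm_num)

theorem finite_minPts : minPts.Finite := by
  rw [minPts_eq_union]
  exact (Set.finite_singleton _).union
    ((finite_cube_roots two_ne_zero).union (finite_cube_roots alpha_ne_zero))

theorem ncard_minPts : minPts.ncard = 7 := by
  have f2 := finite_cube_roots (two_ne_zero (α := ℂ))
  have fa := finite_cube_roots alpha_ne_zero
  rw [minPts_eq_union, Set.ncard_union_eq _ (Set.finite_singleton _) (f2.union fa),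
    Set.ncard_union_eq _ f2 fa, ncard_cube_roots two_ne_zero, ncard_cube_roots alpha_ne_zero,
    Set.ncard_singleton]
  · rw [Set.disjoint_left]
    intro z h1 h2
    have h : alpha ^ 3 = 2 ^ 3 := by rw [← h1.out, ← h2.out]
    have := congrArg norm h
    rw [alpha_pow, norm_eta] at this
    norm_num at this
  · rw [Set.disjoint_left]
    rintro z rfl (h | h)
    · have := h.out; norm_num at this
    · have := h.out
      rw [alpha_pow] at this
      exact eta_ne_zero (by rw [← this]; norm_num)

theorem maxPts_eq : maxPts = {z : ℂ | z ^ 3 = (star alpha) ^ 3} := by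
  ext z
  rw [mem_maxPts, star_alpha_pow]
  rfl

theorem ncard_maxPts : maxPts.ncard = 3 := by
  rw [maxPts_eq]
  exact ncard_cube_roots (star_ne_zero.2 alpha_ne_zero)

theorem finite_maxPts : maxPts.Finite :=
  Set.finite_of_ncard_ne_zero (by rw [ncard_maxPts]; norm_num)

theorem offset_eq {m : ℕ} {k : ℤ} {θ φ : ℝ} (hθ : (k * Real.pi / (6 * m) : ℝ) = θ)
    (hc : Real.cos θ ≠ 0) (h : Real.sin (φ + θ) = Real.sin (3 * θ)) :
    offset m k = Real.sin φ + slope m k * Real.cos φ := by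
  rw [offset, slope, hθ, Real.tan_eq_sin_div_cos]
  rw [Real.sin_add, Real.sin_three_mul] at h
  have h1 := Real.sin_sq_add_cos_sq θ
  have h2 : 1 + (Real.sin θ / Real.cos θ) ^ 2 = 1 / Real.cos θ ^ 2 := by
    field_simp; linarith
  rw [h2]
  field_simp
  linear_combination -h + 3 * Real.sin θ * h1

theorem crossing_eq {m : ℕ} {k l : ℤ} {z : ℂ} (hne : slope m k ≠ slope m l)
    (hk : offset m k = z.im + slope m k * z.re) (hl : offset m l = z.im + slope m l * z.re) :
    crossing m k l = z := by
  have hd := sub_ne_zero.2 hne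
  apply Complex.ext
  · simp only [crossing]
    rw [hk, hl]; field_simp; ring
  · simp only [crossing]
    rw [hk, hl]; field_simp; ring

theorem crossing_zero_six : crossing 6 0 6 = 2 := by
  have h0 : slope 6 0 = 0 := by simp [slope]
  have h6 : slope 6 6 = 1 / Real.sqrt 3 := by
    rw [slope, ← Real.tan_pi_div_six]; congr 1; push_cast; ring
  have h3 : Real.sqrt 3 ^ 2 = 3 := Real.sq_sqrt (by norm_num)
  have hs : Real.sqrt 3 ≠ 0 := by positivity
  apply crossing_eq
  · rw [h0, h6]; positivity
  · simp [offset, h0]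
  · rw [offset, h6]; simp only [Complex.im_ofNat, Complex.re_ofNat]
    field_simp
    rw [h3]; norm_num

theorem crossing_zero_twelve : crossing 6 0 12 = 0 := by
  have h0 : slope 6 0 = 0 := by simp [slope]
  have h6 : slope 6 12 = Real.sqrt 3 := by
    rw [slope, ← Real.tan_pi_div_three]; congr 1; push_cast; ring
  have h3 : Real.sqrt 3 ^ 2 = 3 := Real.sq_sqrt (by norm_num)
  have hs : Real.sqrt 3 ≠ 0 := by positivity
  apply crossing_eq
  · rw [h0, h6]; exact hs.symm
  · simp [offset, h0]
  · rw [offset, h6]; simp only [Complex.zero_im, Complex.zero_re]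
    field_simp
    rw [h3]; norm_num

theorem tan_ne_tan {x y : ℝ} (hx : 0 < x) (hxy : x < y) (hy : y < Real.pi / 2) :
    Real.tan x ≠ Real.tan y := by
  have hp := Real.pi_pos
  exact (Real.tan_lt_tan_of_lt_of_lt_pi_div_two (by linarith) hy hxy).ne

theorem cos_ne_zero_of_pos {x : ℝ} (hx : 0 < x) (hy : x < Real.pi / 2) : Real.cos x ≠ 0 :=
  (Real.cos_pos_of_mem_Ioo ⟨by linarith, hy⟩).ne'

theorem crossing_two_eight : crossing 6 2 8 = alpha := by
  have hp := Real.pi_pos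
  have e2 : (((2 : ℤ) : ℝ) * Real.pi / (6 * (6 : ℕ)) : ℝ) = Real.pi / 18 := by push_cast; ring
  have e8 : (((8 : ℤ) : ℝ) * Real.pi / (6 * (6 : ℕ)) : ℝ) = 2 * Real.pi / 9 := by push_cast; ring
  apply crossing_eq
  · rw [slope, slope, e2, e8]
    apply tan_ne_tan <;> linarith
  · rw [alpha_eq, Complex.exp_ofReal_mul_I_re, Complex.exp_ofReal_mul_I_im]
    apply offset_eq e2 (cos_ne_zero_of_pos (by linarith) (by linarith))
    congr 1; ring
  · rw [alpha_eq, Complex.exp_ofReal_mul_I_re, Complex.exp_ofReal_mul_I_im]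
    apply offset_eq e8 (cos_ne_zero_of_pos (by linarith) (by linarith))
    rw [← Real.sin_pi_sub]
    congr 1; ring

theorem rot_mul_star_alpha : rot * star alpha = Complex.exp ((5 * Real.pi / 9 : ℝ) * Complex.I) := by
  have h : star alpha = Complex.exp ((-(Real.pi / 9) : ℝ) * Complex.I) := by
    rw [alpha_eq]
    change (starRingEnd ℂ) _ = _
    rw [← Complex.exp_conj, map_mul, Complex.conj_I, Complex.conj_ofReal]
    congr 1; push_cast; ring
  rw [h, rot, ← Complex.exp_add]
  congr 1; push_cast; ring

theorem crossing_four_ten : crossing 6 4 10 = rot * star alpha := by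
  have hp := Real.pi_pos
  have e4 : (((4 : ℤ) : ℝ) * Real.pi / (6 * (6 : ℕ)) : ℝ) = Real.pi / 9 := by push_cast; ring
  have e10 : (((10 : ℤ) : ℝ) * Real.pi / (6 * (6 : ℕ)) : ℝ) = 5 * Real.pi / 18 := by
    push_cast; ring
  rw [rot_mul_star_alpha]
  apply crossing_eq
  · rw [slope, slope, e4, e10]
    apply tan_ne_tan <;> linarith
  · rw [Complex.exp_ofReal_mul_I_re, Complex.exp_ofReal_mul_I_im]
    apply offset_eq e4 (cos_ne_zero_of_pos (by linarith) (by linarith))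
    rw [← Real.sin_pi_sub]
    congr 1; ring
  · rw [Complex.exp_ofReal_mul_I_re, Complex.exp_ofReal_mul_I_im]
    apply offset_eq e10 (cos_ne_zero_of_pos (by linarith) (by linarith))
    congr 1; ring

theorem minPts_eq_crossing : minPts = {z | ∃ i : ℕ, z = rot ^ i * crossing 6 0 6 ∨
    z = rot ^ i * crossing 6 0 12 ∨ z = rot ^ i * crossing 6 2 8} := by
  rw [crossing_zero_six, crossing_zero_twelve, crossing_two_eight]
  ext z
  have e8 : (8 : ℂ) = 2 ^ 3 := by norm_num
  constructor
  · intro h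
    rw [mem_minPts, e8, ← alpha_pow, pow_three_eq_iff, pow_three_eq_iff] at h
    rcases h with h | (h | h | h) | (h | h | h)
    · exact ⟨0, Or.inr (Or.inl (by simpa using h))⟩
    · exact ⟨0, Or.inl (by simpa using h)⟩
    · exact ⟨1, Or.inl (by simpa using h)⟩
    · exact ⟨2, Or.inl h⟩
    · exact ⟨0, Or.inr (Or.inr (by simpa using h))⟩
    · exact ⟨1, Or.inr (Or.inr (by simpa using h))⟩
    · exact ⟨2, Or.inr (Or.inr h)⟩
  · rintro ⟨i, h⟩
    have hi : (rot ^ i) ^ 3 = 1 := by rw [← pow_mul, mul_comm, pow_mul, rot_pow_three, one_pow]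
    rw [mem_minPts]
    rcases h with rfl | rfl | rfl
    · right; left; rw [mul_pow, hi]; norm_num
    · left; simp
    · right; right; rw [mul_pow, hi, alpha_pow, one_mul]

theorem maxPts_eq_crossing : maxPts = {z | ∃ i : ℕ, z = rot ^ i * crossing 6 4 10} := by
  rw [crossing_four_ten]
  ext z
  constructor
  · intro h
    rw [mem_maxPts, ← star_alpha_pow, pow_three_eq_iff] at h
    rcases h with h | h | h
    · exact ⟨2, by rw [h, ← mul_assoc, ← pow_succ, rot_pow_three, one_mul]⟩
    · exact ⟨0, by rw [h, pow_zero, one_mul]⟩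
    · exact ⟨1, by rw [h]; ring⟩
  · rintro ⟨i, rfl⟩
    have hi : (rot ^ i) ^ 3 = 1 := by rw [← pow_mul, mul_comm, pow_mul, rot_pow_three, one_pow]
    rw [mem_maxPts, mul_pow, mul_pow, hi, rot_pow_three, star_alpha_pow]; ring

/-! ### The sextic on the real plane -/

/-- The critical points of the sextic on the real plane with value `c`. -/
def levelPts (c : ℂ) : Set ℂ :=
  {z | IsSexticCritical ((starRingEnd ℂ) z) z ∧ sextic ((starRingEnd ℂ) z) z = c}

theorem IsSexticCritical.cases {z : ℂ} (h : IsSexticCritical ((starRingEnd ℂ) z) z) :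
    sextic ((starRingEnd ℂ) z) z = 0 ∨ z ∈ minPts ∨ z ∈ maxPts := by
  by_cases h0 : sextic ((starRingEnd ℂ) z) z = 0
  · exact Or.inl h0
  right
  have conj : ∀ a : ℂ, (starRingEnd ℂ) z ^ 3 = a → z ^ 3 = (starRingEnd ℂ) a := by
    intro a ha
    rw [← ha, ← map_pow, Complex.conj_conj]
  rcases sextic_critical_of_ne_zero h.1 h.2 h0 with h | h | h | h
  · left; rw [mem_minPts]; exact Or.inl h.2
  · left; rw [mem_minPts, conj _ h.1, Complex.conj_ofNat]; simp
  · left; rw [mem_minPts, conj _ h.2, map_sub, map_one, star_eta]; simp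
  · right; rw [mem_maxPts, conj _ h.2, star_eta]

theorem sextic_of_mem_minPts {z : ℂ} (h : z ∈ minPts) :
    IsSexticCritical ((starRingEnd ℂ) z) z ∧ sextic ((starRingEnd ℂ) z) z = -1 ∧
      ∃ b > 0, HasDefiniteHessian ((starRingEnd ℂ) z) z b := by
  rcases mem_minPts.1 h with rfl | h | h
  · rw [map_zero]
    exact ⟨sextic_at_zero.1, sextic_at_zero.2.1, 12, by norm_num, sextic_at_zero.2.2⟩
  · have := sextic_at_cube_eight h
    exact ⟨this.1, this.2.1, 60, by norm_num, this.2.2⟩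
  · have := sextic_at_cube_eta h
    exact ⟨this.1, this.2.1, 24, by norm_num, this.2.2⟩

theorem sextic_of_mem_maxPts {z : ℂ} (h : z ∈ maxPts) :
    IsSexticCritical ((starRingEnd ℂ) z) z ∧ sextic ((starRingEnd ℂ) z) z = 8 ∧
      ∃ b < 0, HasDefiniteHessian ((starRingEnd ℂ) z) z b := by
  have := sextic_at_cube_one_sub_eta (mem_maxPts.1 h)
  exact ⟨this.1, this.2.1, -48, by norm_num, this.2.2⟩

theorem levelPts_neg_one : levelPts (-1) = minPts := by
  ext z
  constructor
  · rintro ⟨h, h1⟩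
    rcases h.cases with h0 | h0 | h0
    · rw [h0] at h1; norm_num at h1
    · exact h0
    · rw [(sextic_of_mem_maxPts h0).2.1] at h1; norm_num at h1
  · intro h
    exact ⟨(sextic_of_mem_minPts h).1, (sextic_of_mem_minPts h).2.1⟩

theorem levelPts_eight : levelPts 8 = maxPts := by
  ext z
  constructor
  · rintro ⟨h, h1⟩
    rcases h.cases with h0 | h0 | h0
    · rw [h0] at h1; norm_num at h1
    · rw [(sextic_of_mem_minPts h0).2.1] at h1; norm_num at h1
    · exact h0
  · intro h
    exact ⟨(sextic_of_mem_maxPts h).1, (sextic_of_mem_maxPts h).2.1⟩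

/-- The pairs of lines. -/
def linePairs : Finset (ℕ × ℕ) :=
  ((Finset.range 6) ×ˢ (Finset.range 6)).filter fun p => p.1 < p.2

theorem mem_linePairs {p : ℕ × ℕ} : p ∈ linePairs ↔ p.1 < p.2 ∧ p.2 < 6 := by
  simp only [linePairs, Finset.mem_filter, Finset.mem_product, Finset.mem_range]
  omega

theorem levelPts_zero : levelPts 0 = (fun p : ℕ × ℕ => linePoint p.1 p.2) '' linePairs := by
  ext z
  constructor
  · rintro ⟨h, h0⟩
    obtain ⟨i, j, hij, hj, h1, h2⟩ := sextic_critical_of_eq_zero h.1 h0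
    refine ⟨(i, j), mem_linePairs.2 ⟨hij, hj⟩, ?_⟩
    have h3 := lineForm_linePoint i j
    exact (lineForm_unique (lineRoot_ne_zero i) (lineRoot_ne_zero j)
      (fun e => hij.ne (lineRoot_inj (hij.trans hj) hj e)) h3.1 h3.2 h1 h2).2
  · rintro ⟨⟨i, j⟩, hp, rfl⟩
    obtain ⟨hij, hj⟩ := mem_linePairs.1 hp
    have h3 := lineForm_linePoint i j
    refine ⟨isSexticCritical_of_two_lines hij.ne (hij.trans hj) hj h3.1 h3.2, ?_⟩
    rw [sextic_eq_mul_lineCofactor hij.ne (hij.trans hj) hj, h3.1]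
    ring

theorem ncard_levelPts_zero : (levelPts 0).ncard = 15 := by
  rw [levelPts_zero, Set.InjOn.ncard_image]
  · rw [Set.ncard_coe_finset]; rfl
  · rintro ⟨i, j⟩ hp ⟨k, l⟩ hq he
    obtain ⟨hij, hj⟩ := mem_linePairs.1 hp
    obtain ⟨hkl, hl⟩ := mem_linePairs.1 hq
    have h3 := lineForm_linePoint i j
    have h4 := lineForm_linePoint k l
    simp only at he hij hj hkl hl
    rw [← he] at h4
    have a := eq_or_eq_of_lineForm hij.ne (hij.trans hj) hj (hkl.trans hl) h3.1 h3.2 h4.1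
    have b := eq_or_eq_of_lineForm hij.ne (hij.trans hj) hj hl h3.1 h3.2 h4.2
    rw [Prod.mk.injEq]
    omega

theorem finite_levelPts_zero : (levelPts 0).Finite :=
  Set.finite_of_ncard_ne_zero (by rw [ncard_levelPts_zero]; norm_num)

theorem finite_critical : {z | IsSexticCritical ((starRingEnd ℂ) z) z}.Finite := by
  refine (finite_levelPts_zero.union (finite_minPts.union finite_maxPts)).subset ?_
  intro z hz
  rcases hz.out.cases with h | h
  · exact Or.inl ⟨hz, h⟩
  · exact Or.inr h

/-- The sextic on the real plane. -/
def realSextic (z : ℂ) : ℝ := (sextic ((starRingEnd ℂ) z) z).re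

theorem realSextic_cast (z : ℂ) : (realSextic z : ℂ) = sextic ((starRingEnd ℂ) z) z := by
  apply Complex.conj_eq_iff_re.1
  simp only [sextic, powSum, map_sub, map_add, map_mul, map_pow, map_one, map_ofNat, star_eta,
    Complex.conj_conj]
  ring

theorem star_sexticV (z : ℂ) :
    (starRingEnd ℂ) (sexticV ((starRingEnd ℂ) z) z) = sexticW ((starRingEnd ℂ) z) z := by
  simp only [sexticV, sexticW, homSymm4, homSymm5, map_sub, map_add, map_mul, map_neg, map_pow,
    map_one, map_ofNat, star_eta, Complex.conj_conj]
  ring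

theorem hasDerivAt_sextic_line (v w V W : ℂ) :
    HasDerivAt (fun t : ℂ => sextic (v + t * V) (w + t * W))
      (sexticV v w * V + sexticW v w * W) 0 := by
  set K : ℂ → ℂ := fun t => sexticA v w (t * V) (t * W) * V ^ 2 + sexticB v w * (V * W)
    + sexticC v w (t * V) (t * W) * W ^ 2 with hK
  have hKd : DifferentiableAt ℂ K 0 := by
    simp only [hK, sexticA, sexticC, powSumA, powSumC]
    fun_prop
  have e : (fun t : ℂ => sextic (v + t * V) (w + t * W)) =
      fun t => sextic v w + (sexticV v w * V + sexticW v w * W) * t + t ^ 2 * K t := by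
    funext t
    rw [sextic_taylor]
    simp only [hK]
    ring
  rw [e]
  refine ((((hasDerivAt_id' (0 : ℂ)).const_mul (sexticV v w * V + sexticW v w * W)).const_add
    (sextic v w)).add ((hasDerivAt_pow 2 (0 : ℂ)).mul hKd.hasDerivAt)).congr_deriv ?_
  simp

theorem isSexticCritical_of_isLocalExtr {z : ℂ} (h : IsLocalExtr realSextic z) :
    IsSexticCritical ((starRingEnd ℂ) z) z := by
  set v := (starRingEnd ℂ) z with hv
  set d := sexticW v z with hd
  set c := (starRingEnd ℂ) d with hc
  have hV : sexticV v z = c := by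
    rw [hc, hd, hv, ← star_sexticV, Complex.conj_conj]
  have hder : HasDerivAt (fun t : ℂ => sextic (v + t * d) (z + t * c)) (c * d + d * c) 0 := by
    have := hasDerivAt_sextic_line v z d c
    rwa [hV, ← hd] at this
  have hre := hder.real_of_complex (z := 0)
  have hloc : IsLocalExtr (fun t : ℝ => (sextic (v + t * d) (z + t * c)).re) 0 := by
    have hcont : Tendsto (fun t : ℝ => z + t * c) (𝓝 0) (𝓝 ((fun t : ℝ => z + t * c) 0)) :=
      ContinuousAt.tendsto (by fun_prop)
    have hg : IsLocalExtr realSextic ((fun t : ℝ => z + t * c) 0) := by simpa using h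
    have h1 := IsExtrFilter.comp_tendsto (g := fun t : ℝ => z + t * c) hg hcont
    refine Eq.mp ?_ h1
    congr 1
    funext t
    simp [realSextic, hc, hv]
  have h0 := hloc.hasDerivAt_eq_zero hre
  have hn : c * d = ((‖d‖ ^ 2 : ℝ) : ℂ) := by
    rw [hc, Complex.conj_mul']; push_cast; rfl
  rw [mul_comm d c, hn, ← Complex.ofReal_add, Complex.ofReal_re] at h0
  have hd0 : d = 0 := by
    have : ‖d‖ ^ 2 = 0 := by linarith
    exact norm_eq_zero.1 (pow_eq_zero_iff (two_ne_zero) |>.1 this)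
  refine ⟨?_, hd0⟩
  rw [hV, hc, hd0, map_zero]

theorem eventually_ne_of_isLocalExtr {z₀ : ℂ} (h : IsLocalExtr realSextic z₀) :
    ∀ᶠ z in 𝓝[≠] z₀, realSextic z ≠ realSextic z₀ := by
  have h1 : ∀ᶠ z in 𝓝 z₀, realSextic z = realSextic z₀ →
      IsSexticCritical ((starRingEnd ℂ) z) z := by
    rcases h with h | h
    · have h' : ∀ᶠ y in 𝓝 z₀, realSextic z₀ ≤ realSextic y := h
      filter_upwards [h'.eventually_nhds] with z hz e
      apply isSexticCritical_of_isLocalExtr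
      left
      filter_upwards [hz] with y hy
      rwa [e]
    · have h' : ∀ᶠ y in 𝓝 z₀, realSextic y ≤ realSextic z₀ := h
      filter_upwards [h'.eventually_nhds] with z hz e
      apply isSexticCritical_of_isLocalExtr
      right
      filter_upwards [hz] with y hy
      rwa [e]
  have h2 : ∀ᶠ z in 𝓝[≠] z₀, z ∉ {z | IsSexticCritical ((starRingEnd ℂ) z) z} := by
    have hf := (finite_critical.subset (Set.sdiff_subset (t := {z₀}))).isClosed.isOpen_compl
    have : z₀ ∈ ({z | IsSexticCritical ((starRingEnd ℂ) z) z} \ {z₀})ᶜ := by simp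
    filter_upwards [nhdsWithin_le_nhds (hf.mem_nhds this), self_mem_nhdsWithin] with z hz hne hc
    exact hz ⟨hc, hne⟩
  filter_upwards [nhdsWithin_le_nhds h1, h2] with z ha hb e
  exact hb (ha e)

theorem not_isLocalExtr_of_eq_zero {z : ℂ} (h0 : sextic ((starRingEnd ℂ) z) z = 0) :
    ¬ IsLocalExtr realSextic z := by
  intro h
  have hev := eventually_ne_of_isLocalExtr h
  have hp := prod_lineForm ((starRingEnd ℂ) z) z
  rw [h0, Finset.prod_eq_zero_iff] at hp
  obtain ⟨i, hi, hl⟩ := hp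
  obtain ⟨d, hd⟩ := IsAlgClosed.exists_pow_nat_eq (lineRoot i)⁻¹ (n := 2) (by norm_num)
  have hs := lineRoot_ne_zero i
  have hdn : ‖d‖ = 1 := by
    have := congrArg norm hd
    rw [norm_pow, norm_inv, norm_lineRoot, inv_one] at this
    exact (pow_eq_one_iff_of_nonneg (norm_nonneg _) two_ne_zero).1 this
  have hd0 : d ≠ 0 := by intro e; rw [e] at hdn; norm_num at hdn
  have hdc : (starRingEnd ℂ) d = lineRoot i * d := by
    rw [← Complex.inv_eq_conj hdn]
    have : lineRoot i * d ^ 2 = 1 := by rw [hd]; exact mul_inv_cancel₀ hs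
    apply inv_eq_of_mul_eq_one_left
    linear_combination this
  have hzero : ∀ t : ℝ, realSextic (z + t * d) = realSextic z := by
    intro t
    have hlt : lineForm (lineRoot i) ((starRingEnd ℂ) (z + t * d)) (z + t * d) = 0 := by
      rw [map_add, map_mul, Complex.conj_ofReal, hdc]
      simp only [lineForm] at hl ⊢
      linear_combination hl
    have : sextic ((starRingEnd ℂ) (z + t * d)) (z + t * d) = 0 := by
      rw [← prod_lineForm]
      exact Finset.prod_eq_zero hi hlt
    rw [realSextic, realSextic, this, h0]
  have ht : Tendsto (fun t : ℝ => z + t * d) (𝓝[≠] 0) (𝓝[≠] z) := by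
    apply tendsto_nhdsWithin_iff.2
    constructor
    · have : ContinuousAt (fun t : ℝ => z + t * d) 0 := by fun_prop
      have h := this.tendsto
      simp only [Complex.ofReal_zero, zero_mul, add_zero] at h
      exact h.mono_left nhdsWithin_le_nhds
    · filter_upwards [self_mem_nhdsWithin] with t ht
      simp only [Set.mem_compl_iff, Set.mem_singleton_iff] at ht ⊢
      simpa [hd0] using ht
  obtain ⟨t, ht⟩ := (ht.eventually hev).exists
  exact ht (hzero t)

theorem not_isLocalMin_and_isLocalMax {z : ℂ} (h1 : IsLocalMin realSextic z)
    (h2 : IsLocalMax realSextic z) : False := by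
  have hev := eventually_ne_of_isLocalExtr (Or.inl h1)
  have h3 : ∀ᶠ y in 𝓝[≠] z, realSextic y = realSextic z := by
    refine nhdsWithin_le_nhds ?_
    filter_upwards [h1, h2] with y ha hb
    exact le_antisymm hb ha
  obtain ⟨y, hy, hy'⟩ := (hev.and h3).exists
  exact hy hy'

theorem HasDefiniteHessian.eventually_abs_sub_le {z : ℂ} {b : ℝ}
    (h : HasDefiniteHessian ((starRingEnd ℂ) z) z b)
    (hc : IsSexticCritical ((starRingEnd ℂ) z) z) :
    ∀ᶠ y in 𝓝 z, |realSextic y - realSextic z - b * ‖y - z‖ ^ 2| ≤ |b| * ‖y - z‖ ^ 2 := by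
  set v := (starRingEnd ℂ) z with hv
  have hcont : ContinuousAt (fun y : ℂ =>
      ‖sexticA v z ((starRingEnd ℂ) (y - z)) (y - z)‖
        + ‖sexticC v z ((starRingEnd ℂ) (y - z)) (y - z)‖) z := by
    have hs : Continuous (fun y : ℂ => (starRingEnd ℂ) (y - z)) :=
      Complex.continuous_conj.comp (by fun_prop)
    simp only [sexticA, sexticC, powSumA, powSumC]
    fun_prop
  have hlt : (fun y : ℂ => ‖sexticA v z ((starRingEnd ℂ) (y - z)) (y - z)‖
        + ‖sexticC v z ((starRingEnd ℂ) (y - z)) (y - z)‖) z < |b| := by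
    simpa using h.2
  filter_upwards [hcont.eventually (gt_mem_nhds hlt)] with y hy
  set V := (starRingEnd ℂ) (y - z) with hV
  set W := y - z with hW
  have hVW : V * W = ((‖W‖ ^ 2 : ℝ) : ℂ) := by
    rw [hV, Complex.conj_mul']; push_cast; rfl
  have ht : sextic ((starRingEnd ℂ) y) y = sextic v z + sexticA v z V W * V ^ 2
      + ((b * ‖W‖ ^ 2 : ℝ) : ℂ) + sexticC v z V W * W ^ 2 := by
    have e1 : y = z + W := by rw [hW]; ring
    have e2 : (starRingEnd ℂ) y = v + V := by rw [hv, hV, ← map_add, ← e1]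
    rw [e2]
    conv_lhs => rw [e1]
    rw [sextic_taylor, hc.1, hc.2, h.1, hVW]
    push_cast
    ring
  have hnV : ‖V‖ = ‖W‖ := by rw [hV, Complex.norm_conj]
  have hre : realSextic y - realSextic z - b * ‖W‖ ^ 2
      = (sexticA v z V W * V ^ 2 + sexticC v z V W * W ^ 2).re := by
    rw [realSextic, realSextic, ht]
    simp only [Complex.add_re, Complex.ofReal_re]
    rw [← hv]
    ring
  rw [hre]
  refine (Complex.abs_re_le_norm _).trans ((norm_add_le _ _).trans ?_)
  rw [norm_mul, norm_mul, norm_pow, norm_pow, hnV, ← add_mul]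
  exact mul_le_mul_of_nonneg_right hy.le (by positivity)

theorem isLocalMin_of_mem_minPts {z : ℂ} (h : z ∈ minPts) : IsLocalMin realSextic z := by
  obtain ⟨hc, -, b, hb, hH⟩ := sextic_of_mem_minPts h
  filter_upwards [hH.eventually_abs_sub_le hc] with y hy
  rw [abs_of_pos hb] at hy
  linarith [(abs_le.1 hy).1]

theorem isLocalMax_of_mem_maxPts {z : ℂ} (h : z ∈ maxPts) : IsLocalMax realSextic z := by
  obtain ⟨hc, -, b, hb, hH⟩ := sextic_of_mem_maxPts h
  filter_upwards [hH.eventually_abs_sub_le hc] with y hy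
  rw [abs_of_neg hb] at hy
  linarith [(abs_le.1 hy).2]

theorem isLocalMin_realSextic {z : ℂ} : IsLocalMin realSextic z ↔ z ∈ minPts := by
  refine ⟨fun h => ?_, isLocalMin_of_mem_minPts⟩
  rcases (isSexticCritical_of_isLocalExtr (Or.inl h)).cases with h0 | h0 | h0
  · exact absurd (Or.inl h) (not_isLocalExtr_of_eq_zero h0)
  · exact h0
  · exact (not_isLocalMin_and_isLocalMax h (isLocalMax_of_mem_maxPts h0)).elim

theorem isLocalMax_realSextic {z : ℂ} : IsLocalMax realSextic z ↔ z ∈ maxPts := by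
  refine ⟨fun h => ?_, isLocalMax_of_mem_maxPts⟩
  rcases (isSexticCritical_of_isLocalExtr (Or.inr h)).cases with h0 | h0 | h0
  · exact absurd (Or.inr h) (not_isLocalExtr_of_eq_zero h0)
  · exact (not_isLocalMin_and_isLocalMax (isLocalMin_of_mem_minPts h0) h).elim
  · exact h0

/-! ### Second order Taylor expansions of polynomials -/

/-- The directional derivative of `F` at `p` along `v`. -/
def dirDeriv {m : ℕ} (F : MvPolynomial (Fin m) ℂ) (p v : Fin m → ℂ) : ℂ :=
  ∑ i, v i * eval p (pderiv i F)

/-- `Q` is the quadratic part of `F` at `p`. -/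
def IsQuadPart {m : ℕ} (F : MvPolynomial (Fin m) ℂ) (p : Fin m → ℂ) (Q : (Fin m → ℂ) → ℂ) : Prop :=
  Continuous Q ∧ ∃ R : ℂ × (Fin m → ℂ) → ℂ, Continuous R ∧
    ∀ t v, eval (p + t • v) F = eval p F + t * dirDeriv F p v + t ^ 2 * Q v + t ^ 3 * R (t, v)

theorem continuous_dirDeriv {m : ℕ} (F : MvPolynomial (Fin m) ℂ) (p : Fin m → ℂ) :
    Continuous (dirDeriv F p) := by
  unfold dirDeriv
  fun_prop

theorem dirDeriv_mul_X {m : ℕ} (F : MvPolynomial (Fin m) ℂ) (p v : Fin m → ℂ) (j : Fin m) :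
    dirDeriv (F * X j) p v = dirDeriv F p v * p j + eval p F * v j := by
  have : ∀ i, v i * eval p (pderiv i (F * X j))
      = v i * eval p (pderiv i F) * p j + (if i = j then eval p F * v i else 0) := by
    intro i
    rw [Derivation.leibniz, pderiv_X, smul_eq_mul, smul_eq_mul, map_add, map_mul, map_mul, eval_X]
    by_cases h : i = j
    · subst h; simp; ring
    · rw [Pi.single_eq_of_ne (Ne.symm h), if_neg h]; simp; ring
  unfold dirDeriv
  rw [Finset.sum_congr rfl fun i _ => this i, Finset.sum_add_distrib, Finset.sum_mul,
    Finset.sum_ite_eq' Finset.univ j]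
  simp

theorem exists_isQuadPart {m : ℕ} (F : MvPolynomial (Fin m) ℂ) (p : Fin m → ℂ) :
    ∃ Q, IsQuadPart F p Q := by
  induction F using MvPolynomial.induction_on with
  | C a =>
    refine ⟨fun _ => 0, continuous_const, fun _ => 0, continuous_const, fun t v => ?_⟩
    simp [dirDeriv]
  | add f g hf hg =>
    obtain ⟨Q, hQ, R, hR, h⟩ := hf
    obtain ⟨Q', hQ', R', hR', h'⟩ := hg
    refine ⟨fun v => Q v + Q' v, hQ.add hQ', fun x => R x + R' x, hR.add hR', fun t v => ?_⟩
    have : dirDeriv (f + g) p v = dirDeriv f p v + dirDeriv g p v := by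
      simp [dirDeriv, mul_add, Finset.sum_add_distrib]
    rw [map_add, map_add, h, h', this]
    ring
  | mul_X f j hf =>
    obtain ⟨Q, hQ, R, hR, h⟩ := hf
    refine ⟨fun v => Q v * p j + dirDeriv f p v * v j, ?_,
      fun x => R x * p j + Q x.2 * x.2 j + x.1 * R x * x.2 j, ?_, fun t v => ?_⟩
    · exact (hQ.mul continuous_const).add ((continuous_dirDeriv f p).mul (continuous_apply j))
    · have : Continuous fun x : ℂ × (Fin m → ℂ) => Q x.2 := hQ.comp continuous_snd
      have h2 : Continuous fun x : ℂ × (Fin m → ℂ) => x.2 j :=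
        (continuous_apply j).comp continuous_snd
      exact ((hR.mul continuous_const).add (this.mul h2)).add ((continuous_fst.mul hR).mul h2)
    · rw [map_mul, map_mul, h, dirDeriv_mul_X, eval_X, eval_X, Pi.add_apply, Pi.smul_apply,
        smul_eq_mul]
      ring

theorem hasDerivAt_eval {m : ℕ} (F : MvPolynomial (Fin m) ℂ) (p v : Fin m → ℂ) :
    HasDerivAt (fun t : ℂ => eval (p + t • v) F) (dirDeriv F p v) 0 := by
  obtain ⟨Q, hQ, R, hR, h⟩ := exists_isQuadPart F p
  rw [hasDerivAt_iff_tendsto_slope]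
  have hc : Continuous fun t : ℂ => dirDeriv F p v + t * Q v + t ^ 2 * R (t, v) := by fun_prop
  have ht := (hc.tendsto 0).mono_left (nhdsWithin_le_nhds (s := {0}ᶜ))
  simp only [zero_mul, add_zero, ne_eq, OfNat.ofNat_ne_zero, not_false_eq_true, zero_pow] at ht
  refine ht.congr' ?_
  filter_upwards [self_mem_nhdsWithin] with t ht
  have ht0 : t ≠ 0 := ht
  rw [slope_def_field, h, h]
  field_simp
  ring

theorem eval_smul_of_isHomogeneous {m d : ℕ} {F : MvPolynomial (Fin m) ℂ} (hF : F.IsHomogeneous d)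
    (c : ℂ) (p : Fin m → ℂ) : eval (c • p) F = c ^ d * eval p F := by
  rw [eval_eq, eval_eq, Finset.mul_sum]
  refine Finset.sum_congr rfl fun x hx => ?_
  have hd : ∑ i ∈ x.support, x i = d := by
    have := hF (mem_support_iff.1 hx)
    rw [← this, Finsupp.weight_apply, Finsupp.sum]
    simp
  simp only [Pi.smul_apply, smul_eq_mul, mul_pow, Finset.prod_mul_distrib,
    Finset.prod_pow_eq_pow_sum, hd]
  ring

theorem sum_mul_eval_pderiv {m d : ℕ} {F : MvPolynomial (Fin m) ℂ} (hF : F.IsHomogeneous d)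
    (p : Fin m → ℂ) : ∑ i, p i * eval p (pderiv i F) = d * eval p F := by
  have := congrArg (eval p) hF.sum_X_mul_pderiv
  simpa using this

theorem IsQuadPart.add_smul {m d : ℕ} {F : MvPolynomial (Fin m) ℂ} (hF : F.IsHomogeneous d)
    {p : Fin m → ℂ} {Q : (Fin m → ℂ) → ℂ} (hQ : IsQuadPart F p Q) (h0 : eval p F = 0)
    (h1 : ∀ i, eval p (pderiv i F) = 0) (v : Fin m → ℂ) (c : ℂ) : Q (v + c • p) = Q v := by
  obtain ⟨-, R, hR, h⟩ := hQ
  have hd : ∀ v, dirDeriv F p v = 0 := fun v => by simp [dirDeriv, h1]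
  simp only [h0, hd, mul_zero, add_zero, zero_add] at h
  have hl : ContinuousAt (fun t : ℂ => Q (v + c • p) + t * R (t, v + c • p)) 0 := by fun_prop
  have hr : ContinuousAt (fun t : ℂ => (1 + t * c) ^ d *
      ((1 / (1 + t * c)) ^ 2 * Q v + t * (1 / (1 + t * c)) ^ 3 * R (t / (1 + t * c), v))) 0 := by
    have hz : (1 : ℂ) + 0 * c ≠ 0 := by simp
    have hτ : ContinuousAt (fun t : ℂ => (t / (1 + t * c), v)) 0 := by
      refine ContinuousAt.prodMk (ContinuousAt.div₀ (by fun_prop) (by fun_prop) hz)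
        continuousAt_const
    have hinv : ContinuousAt (fun t : ℂ => 1 / (1 + t * c)) 0 :=
      ContinuousAt.div₀ (by fun_prop) (by fun_prop) hz
    have hRc : ContinuousAt (fun t : ℂ => R (t / (1 + t * c), v)) 0 :=
      ContinuousAt.comp (g := R) hR.continuousAt hτ
    fun_prop
  have hne : ∀ᶠ t : ℂ in 𝓝[≠] 0, 1 + t * c ≠ 0 := by
    have hc : ContinuousAt (fun t : ℂ => 1 + t * c) 0 := by fun_prop
    exact nhdsWithin_le_nhds (hc.eventually_ne (by simp))
  have heq : (fun t : ℂ => Q (v + c • p) + t * R (t, v + c • p)) =ᶠ[𝓝[≠] 0] fun t =>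
      (1 + t * c) ^ d *
      ((1 / (1 + t * c)) ^ 2 * Q v + t * (1 / (1 + t * c)) ^ 3 * R (t / (1 + t * c), v)) := by
    filter_upwards [hne, self_mem_nhdsWithin] with t ht ht0
    have ht0 : t ≠ 0 := ht0
    have e : p + t • (v + c • p) = (1 + t * c) • (p + (t / (1 + t * c)) • v) := by
      ext k
      simp only [Pi.add_apply, Pi.smul_apply, smul_eq_mul]
      field_simp
      ring
    have h2 := h t (v + c • p)
    rw [e, eval_smul_of_isHomogeneous hF, h] at h2
    apply mul_left_cancel₀ (pow_ne_zero 2 ht0)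
    calc _ = t ^ 2 * Q (v + c • p) + t ^ 3 * R (t, v + c • p) := by ring
      _ = _ := by rw [← h2]; ring
  have := tendsto_nhds_unique ((hl.tendsto.mono_left nhdsWithin_le_nhds).congr' heq)
    (hr.tendsto.mono_left nhdsWithin_le_nhds)
  simpa using this

/-- Comparing coefficients of `1`, `t`, `t²` along a curve. -/
theorem eq_zero_of_eventually_mul_eq {f g : ℂ → ℂ} {a b : ℂ} {n : ℕ}
    (h : ∀ᶠ t in 𝓝[≠] (0 : ℂ), f t = t ^ (n + 1) * g t) (hf : Tendsto f (𝓝[≠] 0) (𝓝 a))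
    (hg : Tendsto g (𝓝[≠] 0) (𝓝 b)) : a = 0 := by
  have ht : Tendsto (fun t : ℂ => t ^ (n + 1)) (𝓝[≠] 0) (𝓝 0) := by
    have : ContinuousAt (fun t : ℂ => t ^ (n + 1)) 0 := by fun_prop
    have h := this.tendsto.mono_left (nhdsWithin_le_nhds (s := {0}ᶜ))
    simpa using h
  have h2 := (ht.mul hg).congr' (h.mono fun t e => e.symm)
  rw [zero_mul] at h2
  exact tendsto_nhds_unique hf h2

theorem IsAGerm.quadPart {n j d : ℕ} (hj : 1 ≤ j) {F : MvPolynomial (Fin (n + 2)) ℂ}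
    (hF : F.IsHomogeneous d) {p : Fin (n + 2) → ℂ} {i : Fin (n + 2)} (hp : p i ≠ 0)
    (h : IsAGerm j (fun x : Fin (n + 1) → ℂ => eval (i.insertNth 1 x : Fin (n + 2) → ℂ) F)
      (fun k => p (i.succAbove k) / p i))
    {Q : (Fin (n + 2) → ℂ) → ℂ} (hQ : IsQuadPart F p Q) :
    eval p F = 0 ∧ (∀ k, eval p (pderiv k F) = 0) ∧
      ∃ (c : ℂ) (L : (Fin (n + 1) → ℂ) ≃L[ℂ] (Fin (n + 1) → ℂ)), c ≠ 0 ∧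
        ∀ u, Q (p i • (i.insertNth 0 (L u) : Fin (n + 2) → ℂ)) =
          c * ((if j = 1 then u 0 ^ 2 else 0) + ∑ k : Fin n, u k.succ ^ 2) := by
  obtain ⟨hQc, R, hR, hT⟩ := hQ
  obtain ⟨φ, η, L, hφ, hφ0, hL, hη, hη0, hev⟩ := h
  obtain ⟨j, rfl⟩ : ∃ j', j = j' + 1 := ⟨j - 1, by omega⟩
  let c : (Fin (n + 1) → ℂ) → ℂ → Fin (n + 1) → ℂ := fun u t => t⁻¹ • (φ (t • u) - φ 0)
  let V : (Fin (n + 1) → ℂ) → ℂ → Fin (n + 2) → ℂ := fun u t => p i • i.insertNth 0 (c u t)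
  let V₀ : (Fin (n + 1) → ℂ) → Fin (n + 2) → ℂ := fun u => p i • i.insertNth 0 (L u)
  let H : (Fin (n + 1) → ℂ) → ℂ → ℂ := fun u t => p i ^ d * η (t • u) *
    (t ^ j * u 0 ^ (j + 2) + ∑ k : Fin n, u k.succ ^ 2)
  let H₀ : (Fin (n + 1) → ℂ) → ℂ := fun u => p i ^ d * η 0 *
    (0 ^ j * u 0 ^ (j + 2) + ∑ k : Fin n, u k.succ ^ 2)
  have hsm : ∀ u : Fin (n + 1) → ℂ, Tendsto (fun t : ℂ => t • u) (𝓝[≠] 0) (𝓝 0) := by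
    intro u
    have : ContinuousAt (fun t : ℂ => t • u) 0 := by fun_prop
    have h := this.tendsto.mono_left (nhdsWithin_le_nhds (s := {0}ᶜ))
    simpa using h
  have hc : ∀ u, Tendsto (c u) (𝓝[≠] 0) (𝓝 (L u)) := by
    intro u
    have h1 : HasDerivAt (fun t : ℂ => t • u) ((1 : ℂ) • u) 0 :=
      (hasDerivAt_id (0 : ℂ)).smul_const u
    have h2 : HasFDerivAt φ (L : (Fin (n + 1) → ℂ) →L[ℂ] (Fin (n + 1) → ℂ)) ((0 : ℂ) • u) := by
      rwa [zero_smul]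
    have h3 := h2.comp_hasDerivAt (0 : ℂ) h1
    rw [hasDerivAt_iff_tendsto_slope] at h3
    simp only [one_smul, ContinuousLinearEquiv.coe_coe] at h3
    refine h3.congr' ?_
    filter_upwards with t
    simp [_root_.slope, c]
  have hV : ∀ u, Tendsto (V u) (𝓝[≠] 0) (𝓝 (V₀ u)) := by
    intro u
    refine Tendsto.const_smul ?_ (p i)
    rw [tendsto_pi_nhds]
    intro k
    refine Fin.succAboveCases i ?_ (fun k => ?_) k
    · simp
    · simpa using (tendsto_pi_nhds.1 (hc u)) k
  have hH : ∀ u, Tendsto (H u) (𝓝[≠] 0) (𝓝 (H₀ u)) := by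
    intro u
    have h1 : Tendsto (fun t : ℂ => η (t • u)) (𝓝[≠] 0) (𝓝 (η 0)) :=
      hη.continuousAt.tendsto.comp (hsm u)
    have h2 : Tendsto (fun t : ℂ => t ^ j * u 0 ^ (j + 2) + ∑ k : Fin n, u k.succ ^ 2) (𝓝[≠] 0)
        (𝓝 (0 ^ j * u 0 ^ (j + 2) + ∑ k : Fin n, u k.succ ^ 2)) := by
      have : Continuous fun t : ℂ => t ^ j * u 0 ^ (j + 2) + ∑ k : Fin n, u k.succ ^ 2 := by
        fun_prop
      exact (this.tendsto 0).mono_left nhdsWithin_le_nhds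
    exact (tendsto_const_nhds.mul h1).mul h2
  have hid : Tendsto (fun t : ℂ => t) (𝓝[≠] 0) (𝓝 0) := nhdsWithin_le_nhds
  have hRt : ∀ u, Tendsto (fun t => R (t, V u t)) (𝓝[≠] 0) (𝓝 (R (0, V₀ u))) := fun u =>
    (hR.tendsto (0, V₀ u)).comp (hid.prodMk_nhds (hV u))
  have hQt : ∀ u, Tendsto (fun t => Q (V u t)) (𝓝[≠] 0) (𝓝 (Q (V₀ u))) := fun u =>
    (hQc.tendsto (V₀ u)).comp (hV u)
  have hDt : ∀ u, Tendsto (fun t => dirDeriv F p (V u t)) (𝓝[≠] 0) (𝓝 (dirDeriv F p (V₀ u))) :=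
    fun u => ((continuous_dirDeriv F p).tendsto (V₀ u)).comp (hV u)
  have hmain : ∀ u, ∀ᶠ t in 𝓝[≠] (0 : ℂ), eval p F + t * dirDeriv F p (V u t) + t ^ 2 * Q (V u t)
      + t ^ 3 * R (t, V u t) = t ^ 2 * H u t := by
    intro u
    filter_upwards [(hsm u).eventually hev, self_mem_nhdsWithin] with t ht ht0
    have ht0 : t ≠ 0 := ht0
    have e : p + t • V u t = p i • (i.insertNth 1 (φ (t • u)) : Fin (n + 2) → ℂ) := by
      ext k
      refine Fin.succAboveCases i ?_ (fun k => ?_) k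
      · simp [V]
      · simp only [V, c, Pi.add_apply, Pi.smul_apply, Fin.insertNth_apply_succAbove, smul_eq_mul,
          Pi.sub_apply, hφ0]
        field_simp
        ring
    rw [← hT, e, eval_smul_of_isHomogeneous hF, ht]
    simp only [H, Pi.smul_apply, smul_eq_mul, mul_pow, ← Finset.mul_sum]
    ring
  have h0 : eval p F = 0 := by
    have := (((tendsto_const_nhds (x := eval p F)).add (hid.mul (hDt 0))).add
      ((hid.pow 2).mul (hQt 0))).add ((hid.pow 3).mul (hRt 0))
    have h := eq_zero_of_eventually_mul_eq (hmain 0) this (hH 0)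
    simpa using h
  have hD0 : ∀ u, dirDeriv F p (V₀ u) = 0 := by
    intro u
    have := ((hDt u).add (hid.mul (hQt u))).add ((hid.pow 2).mul (hRt u))
    have hm : ∀ᶠ t in 𝓝[≠] (0 : ℂ), dirDeriv F p (V u t) + t * Q (V u t) + t ^ 2 * R (t, V u t)
        = t ^ (0 + 1) * H u t := by
      filter_upwards [hmain u, self_mem_nhdsWithin] with t ht ht0
      have ht0 : t ≠ 0 := ht0
      apply mul_left_cancel₀ ht0
      rw [h0] at ht
      linear_combination ht
    have h := eq_zero_of_eventually_mul_eq hm this (hH u)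
    simpa using h
  have hs : ∀ k, eval p (pderiv (i.succAbove k) F) = 0 := by
    intro k
    have h := hD0 (L.symm (Pi.single k 1))
    simp only [V₀, dirDeriv, ContinuousLinearEquiv.apply_symm_apply] at h
    rw [Fin.sum_univ_succAbove _ i] at h
    simp only [Pi.smul_apply, Fin.insertNth_apply_same, Fin.insertNth_apply_succAbove, smul_eq_mul,
      mul_zero, zero_mul, zero_add] at h
    rw [Finset.sum_eq_single k] at h
    · simpa [hp] using h
    · intro b _ hb; simp [hb]
    · simp
  have h1 : ∀ k, eval p (pderiv k F) = 0 := by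
    intro k
    refine Fin.succAboveCases i ?_ hs k
    have h := sum_mul_eval_pderiv hF p
    rw [Fin.sum_univ_succAbove _ i, h0] at h
    simp only [hs, mul_zero, Finset.sum_const_zero, add_zero] at h
    exact (mul_eq_zero.1 h).resolve_left hp
  refine ⟨h0, h1, p i ^ d * η 0, L, mul_ne_zero (pow_ne_zero _ hp) hη0, fun u => ?_⟩
  have hd : ∀ v, dirDeriv F p v = 0 := fun v => by simp [dirDeriv, h1]
  have hl := (hQt u).add (hid.mul (hRt u))
  have hm : ∀ᶠ t in 𝓝[≠] (0 : ℂ), Q (V u t) + t * R (t, V u t) = H u t := by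
    filter_upwards [hmain u, self_mem_nhdsWithin] with t ht ht0
    have ht0 : t ≠ 0 := ht0
    apply mul_left_cancel₀ (pow_ne_zero 2 ht0)
    rw [h0, hd] at ht
    linear_combination ht
  have h := tendsto_nhds_unique (hl.congr' hm) (hH u)
  rw [zero_mul, add_zero] at h
  change Q (V₀ u) = _
  rw [h]
  simp only [H₀]
  congr 2
  rcases Nat.eq_zero_or_pos j with rfl | hj
  · simp
  · rw [zero_pow hj.ne', if_neg (by omega), zero_mul]

theorem IsASingularity.isSingularPt {n j d : ℕ} (hj : 1 ≤ j) {F : MvPolynomial (Fin (n + 2)) ℂ}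
    (hF : F.IsHomogeneous d) {p : PSpace (n + 1)} (h : IsASingularity j F p) :
    IsSingularPt F p := by
  obtain ⟨i, hi, h⟩ := h
  obtain ⟨Q, hQ⟩ := exists_isQuadPart F p.rep
  have := h.quadPart hj hF hi hQ
  exact ⟨this.1, this.2.1⟩

theorem insertNth_sub {n : ℕ} {i : Fin (n + 2)} {p : Fin (n + 2) → ℂ} (hp : p i ≠ 0)
    (L : (Fin (n + 1) → ℂ) ≃L[ℂ] (Fin (n + 1) → ℂ)) (y : Fin (n + 2) → ℂ) :
    ∃ u, y = p i • (i.insertNth 0 (L u) : Fin (n + 2) → ℂ) + (y i / p i) • p := by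
  refine ⟨L.symm (fun k => (y (i.succAbove k) - y i / p i * p (i.succAbove k)) / p i), ?_⟩
  ext k
  refine Fin.succAboveCases i ?_ (fun k => ?_) k
  · simp [hp]
  · simp only [ContinuousLinearEquiv.apply_symm_apply, Pi.add_apply, Pi.smul_apply,
      Fin.insertNth_apply_succAbove, smul_eq_mul]
    field_simp
    ring

theorem IsASingularity.not_of_one {n j d : ℕ} (hj : 1 < j) {F : MvPolynomial (Fin (n + 2)) ℂ}
    (hF : F.IsHomogeneous d) {p : PSpace (n + 1)} (h1 : IsASingularity 1 F p) :
    ¬ IsASingularity j F p := by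
  intro h2
  obtain ⟨i, hi, h1⟩ := h1
  obtain ⟨k, hk, h2⟩ := h2
  obtain ⟨Q, hQ⟩ := exists_isQuadPart F p.rep
  obtain ⟨h0, hd, c, L, hc, hL⟩ := h1.quadPart le_rfl hF hi hQ
  obtain ⟨-, -, c', L', hc', hL'⟩ := h2.quadPart hj.le hF hk hQ
  set q := p.rep
  have htr := fun v a => hQ.add_smul hF h0 hd v a
  simp only [if_neg (show j ≠ 1 by omega), zero_add] at hL'
  simp only [if_true] at hL
  have hins : ∀ (l : Fin (n + 2)) (x y : Fin (n + 1) → ℂ),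
      (l.insertNth 0 (x + y) : Fin (n + 2) → ℂ) = l.insertNth 0 x + l.insertNth 0 y := by
    intro l x y
    ext m
    refine Fin.succAboveCases l ?_ (fun m => ?_) m <;> simp
  set v : Fin (n + 2) → ℂ := q k • k.insertNth 0 (L' (Pi.single 0 1)) with hv
  have hinv : ∀ y, Q (v + y) = Q y := by
    intro y
    obtain ⟨u, hu⟩ := insertNth_sub hk L' y
    rw [hu, ← add_assoc, htr, htr, hv, ← smul_add, ← hins, ← map_add, hL', hL']
    simp
  obtain ⟨u₁, hu₁⟩ := insertNth_sub hi L v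
  have hinv' : ∀ u : Fin (n + 1) → ℂ, (u₁ 0 + u 0) ^ 2 + ∑ m : Fin n, (u₁ m.succ + u m.succ) ^ 2
      = u 0 ^ 2 + ∑ m : Fin n, u m.succ ^ 2 := by
    intro u
    have e1 := hL (u₁ + u)
    have e2 := hinv (q i • (i.insertNth 0 (L u) : Fin (n + 2) → ℂ))
    rw [hu₁, add_right_comm, htr, ← smul_add, ← hins, ← map_add, e1, hL] at e2
    exact mul_left_cancel₀ hc e2
  have hsum : ∀ u : Fin (n + 1) → ℂ, ∑ m, (u₁ m + u m) ^ 2 = ∑ m, u m ^ 2 := by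
    intro u
    rw [Fin.sum_univ_succ, Fin.sum_univ_succ]
    exact hinv' u
  have hzero : u₁ = 0 := by
    ext m
    have e0 := hsum 0
    have e1 := hsum (Pi.single m 1)
    have : ∀ l, (u₁ l + (Pi.single m 1 : Fin (n + 1) → ℂ) l) ^ 2 =
        u₁ l ^ 2 + (Pi.single m 1 : Fin (n + 1) → ℂ) l ^ 2
          + 2 * (u₁ l * (Pi.single m 1 : Fin (n + 1) → ℂ) l) := fun l => by ring
    simp only [this, Finset.sum_add_distrib, ← Finset.mul_sum] at e1
    simp only [Pi.zero_apply, add_zero] at e0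
    rw [e0] at e1
    have e2 : ∑ l, u₁ l * (Pi.single m 1 : Fin (n + 1) → ℂ) l = u₁ m := by
      rw [Finset.sum_eq_single m]
      · simp
      · intro b _ hb; simp [hb]
      · simp
    rw [e2] at e1
    simp only [ne_eq, OfNat.ofNat_ne_zero, not_false_eq_true, zero_pow, Finset.sum_const_zero]
      at e1
    simp only [Pi.zero_apply]
    linear_combination e1 / 2
  have hvk : v k = 0 := by simp [hv]
  rw [hzero, map_zero] at hu₁
  have hins0 : (i.insertNth 0 (0 : Fin (n + 1) → ℂ) : Fin (n + 2) → ℂ) = 0 := by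
    ext m
    refine Fin.succAboveCases i ?_ (fun m => ?_) m <;> simp
  rw [hins0, smul_zero, zero_add] at hu₁
  have hvi : v i / q i = 0 := by
    have := congrFun hu₁ k
    rw [hvk, Pi.smul_apply, smul_eq_mul] at this
    exact (mul_eq_zero.1 this.symm).resolve_right hk
  rw [hvi, zero_smul] at hu₁
  have hL0 : L' (Pi.single 0 1) = 0 := by
    ext m
    have := congrFun hu₁ (k.succAbove m)
    rw [hv, Pi.smul_apply, Fin.insertNth_apply_succAbove] at this
    simpa [hk] using this
  have hs0 : (Pi.single 0 1 : Fin (n + 1) → ℂ) = 0 := by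
    apply L'.injective; rw [hL0, map_zero]
  have := congrFun hs0 0
  simp at this

/-! ### Local coordinates -/

theorem isAGerm_of_coordinates {n j : ℕ} {f : (Fin (n + 1) → ℂ) → ℂ} {a : Fin (n + 1) → ℂ}
    (Ψ : Fin (n + 1) → (Fin (n + 1) → ℂ) → ℂ) (hΨ : ∀ k, AnalyticAt ℂ (Ψ k) a)
    (h0 : ∀ k, Ψ k a = 0) (hinj : ∀ v, (∀ k, fderiv ℂ (Ψ k) a v = 0) → v = 0)
    (hf : ∀ᶠ x in 𝓝 a, f x = Ψ 0 x ^ (j + 1) + ∑ i : Fin n, Ψ i.succ x ^ 2) :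
    IsAGerm j f a := by
  set Φ : (Fin (n + 1) → ℂ) → Fin (n + 1) → ℂ := fun x k => Ψ k x with hΦ
  have hΦa : AnalyticAt ℂ Φ a := AnalyticAt.pi hΨ
  have hΦ0 : Φ a = 0 := funext h0
  have hd : ∀ v k, fderiv ℂ Φ a v k = fderiv ℂ (Ψ k) a v := by
    intro v k
    have h := (hasFDerivAt_pi'.1 hΦa.differentiableAt.hasFDerivAt) k
    have h2 : HasFDerivAt (Ψ k) _ a := h
    rw [h2.fderiv]
    rfl
  have hker : Function.Injective (fderiv ℂ Φ a).toLinearMap := by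
    rw [← LinearMap.ker_eq_bot, LinearMap.ker_eq_bot']
    intro v hv
    apply hinj
    intro k
    rw [← hd]
    exact congrFun hv k
  let e : (Fin (n + 1) → ℂ) ≃L[ℂ] (Fin (n + 1) → ℂ) :=
    (LinearEquiv.ofInjectiveEndo _ hker).toContinuousLinearEquiv
  have he : (e : (Fin (n + 1) → ℂ) →L[ℂ] (Fin (n + 1) → ℂ)) = fderiv ℂ Φ a := by
    ext v
    rfl
  have hs : HasStrictFDerivAt Φ (e : (Fin (n + 1) → ℂ) →L[ℂ] (Fin (n + 1) → ℂ)) a := by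
    rw [he]; exact hΦa.hasStrictFDerivAt
  have hinv : hs.localInverse Φ e a (Φ a) = a := hs.localInverse_apply_image
  refine ⟨hs.localInverse Φ e a, fun _ => 1, e.symm, ?_, ?_, ?_, analyticAt_const, one_ne_zero, ?_⟩
  · have h1 := (hs.toOpenPartialHomeomorph Φ).analyticAt_symm'
      hs.mem_toOpenPartialHomeomorph_source (i := e)
      (by rw [hs.toOpenPartialHomeomorph_coe]; exact hΦa)
      (by rw [hs.toOpenPartialHomeomorph_coe]; exact he.symm)
    rw [hs.toOpenPartialHomeomorph_coe, hΦ0] at h1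
    exact h1
  · rw [← hΦ0]; exact hinv
  · have h1 := hs.to_localInverse.hasFDerivAt
    rwa [hΦ0] at h1
  · have h1 := hs.eventually_right_inverse
    have h2 := hs.localInverse_tendsto
    rw [hΦ0] at h1 h2
    filter_upwards [h1, h2.eventually hf] with x hx hfx
    have hk : ∀ k, Ψ k (hs.localInverse Φ e a x) = x k := fun k => congrFun hx k
    rw [hfx, one_mul]
    simp only [hk]

theorem exists_analyticAt_root {E : Type*} [NormedAddCommGroup E] [NormedSpace ℂ E] {A : E → ℂ}
    {p : E} (hA : AnalyticAt ℂ A p) (h : A p ≠ 0) {k : ℕ} (hk : 0 < k) :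
    ∃ B : E → ℂ, AnalyticAt ℂ B p ∧ B p ≠ 0 ∧ ∀ᶠ x in 𝓝 p, B x ^ k = A x := by
  obtain ⟨c, hc⟩ := IsAlgClosed.exists_pow_nat_eq (A p) hk
  have hc0 : c ≠ 0 := by
    rintro rfl
    rw [zero_pow hk.ne'] at hc
    exact h hc.symm
  have hk0 : (k : ℂ) ≠ 0 := by exact_mod_cast hk.ne'
  refine ⟨fun x => c * Complex.exp (Complex.log (A x / A p) / k), ?_, ?_, ?_⟩
  · have h1 : AnalyticAt ℂ (fun x => A x / A p) p := hA.div analyticAt_const h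
    have h2 : AnalyticAt ℂ (fun x => Complex.log (A x / A p)) p := by
      apply h1.clog
      rw [div_self h]
      exact Complex.one_mem_slitPlane
    exact analyticAt_const.mul (h2.div analyticAt_const hk0).cexp
  · exact mul_ne_zero hc0 (Complex.exp_ne_zero _)
  · filter_upwards [hA.continuousAt.eventually_ne h] with x hx
    rw [mul_pow, ← Complex.exp_nat_mul, mul_div_cancel₀ _ hk0, Complex.exp_log (div_ne_zero hx h),
      hc, mul_div_cancel₀ _ h]

theorem fderiv_mul_of_eq_zero {E : Type*} [NormedAddCommGroup E] [NormedSpace ℂ E] {f g : E → ℂ}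
    {b : E} (hf : DifferentiableAt ℂ f b) (hg : DifferentiableAt ℂ g b) (h0 : g b = 0) :
    fderiv ℂ (fun x => f x * g x) b = f b • fderiv ℂ g b := by
  rw [fderiv_fun_mul hf hg, h0]
  ext v
  simp

/-- Up to a constant, `g` is a `k`-th power of a local coordinate at `b`. -/
def IsPowerAt (k : ℕ) (g : ℂ → ℂ) (b : ℂ) : Prop :=
  ∃ W : ℂ → ℂ, AnalyticAt ℂ W b ∧ W b = 0 ∧ (∀ v, fderiv ℂ W b v = 0 → v = 0) ∧
    ∀ᶠ z in 𝓝 b, g z = g b + W z ^ k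

theorem isPowerAt_of_eq_pow_mul {k : ℕ} (hk : 0 < k) {g u : ℂ → ℂ} {b : ℂ} (hu : AnalyticAt ℂ u b)
    (h0 : u b ≠ 0) (h : ∀ z, g z = g b + (z - b) ^ k * u z) : IsPowerAt k g b := by
  obtain ⟨B, hB, hB0, hBk⟩ := exists_analyticAt_root hu h0 hk
  have hs : AnalyticAt ℂ (fun z : ℂ => z - b) b := by fun_prop
  refine ⟨fun z => B z * (z - b), hB.mul hs, by simp, fun v hv => ?_, ?_⟩
  · rw [fderiv_mul_of_eq_zero hB.differentiableAt hs.differentiableAt (by simp)] at hv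
    simpa [hB0] using hv
  · filter_upwards [hBk] with z hz
    rw [h, ← hz, mul_pow, mul_comm]

/-- Up to a constant, `g` is the sum of the squares of two functions with independent
differentials at `b`. -/
def IsMorseAt {E : Type*} [NormedAddCommGroup E] [NormedSpace ℂ E] (g : E → ℂ) (b : E) : Prop :=
  ∃ U V : E → ℂ, AnalyticAt ℂ U b ∧ AnalyticAt ℂ V b ∧ U b = 0 ∧ V b = 0 ∧
    (∀ v, fderiv ℂ U b v = 0 → fderiv ℂ V b v = 0 → v = 0) ∧
    ∀ᶠ z in 𝓝 b, g z = g b + U z ^ 2 + V z ^ 2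

theorem isMorseAt_of_quadratic {E : Type*} [NormedAddCommGroup E] [NormedSpace ℂ E] {g : E → ℂ}
    {b : E} {K M N S T : E → ℂ} (hK : AnalyticAt ℂ K b) (hM : AnalyticAt ℂ M b)
    (hN : AnalyticAt ℂ N b) (hS : AnalyticAt ℂ S b) (hT : AnalyticAt ℂ T b)
    (hS0 : S b = 0) (hT0 : T b = 0) (hST : ∀ v, fderiv ℂ S b v = 0 → fderiv ℂ T b v = 0 → v = 0)
    (hK0 : K b ≠ 0) (hD : K b * N b - M b ^ 2 ≠ 0)
    (h : ∀ᶠ z in 𝓝 b, g z = g b + K z * S z ^ 2 + 2 * M z * S z * T z + N z * T z ^ 2) :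
    IsMorseAt g b := by
  have hQ : AnalyticAt ℂ (fun z => N z - M z ^ 2 / K z) b := hN.sub ((hM.pow 2).div hK hK0)
  have hQ0 : N b - M b ^ 2 / K b ≠ 0 := by
    intro e
    apply hD
    field_simp at e
    linear_combination e
  obtain ⟨A, hA, hA0, hAk⟩ := exists_analyticAt_root hK hK0 (k := 2) (by norm_num)
  obtain ⟨B, hB, hB0, hBk⟩ := exists_analyticAt_root hQ hQ0 (k := 2) (by norm_num)
  have hMK : AnalyticAt ℂ (fun z => M z / K z) b := hM.div hK hK0
  have hMT : AnalyticAt ℂ (fun z => M z / K z * T z) b := hMK.mul hT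
  have hL : AnalyticAt ℂ (fun z => S z + M z / K z * T z) b := hS.add hMT
  have hL0 : S b + M b / K b * T b = 0 := by rw [hS0, hT0]; ring
  refine ⟨fun z => A z * (S z + M z / K z * T z), fun z => B z * T z, hA.mul hL, hB.mul hT,
    by simp only [hL0, mul_zero], by simp only [hT0, mul_zero], fun v h1 h2 => ?_, ?_⟩
  · rw [fderiv_mul_of_eq_zero hA.differentiableAt hL.differentiableAt hL0,
      fderiv_fun_add hS.differentiableAt hMT.differentiableAt,
      fderiv_mul_of_eq_zero hMK.differentiableAt hT.differentiableAt hT0] at h1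
    rw [fderiv_mul_of_eq_zero hB.differentiableAt hT.differentiableAt hT0] at h2
    have ht : fderiv ℂ T b v = 0 := by simpa [hB0] using h2
    apply hST v _ ht
    simpa [hA0, ht] using h1
  · filter_upwards [h, hAk, hBk, hK.continuousAt.eventually_ne hK0] with z hz ha hb hk
    rw [hz, mul_pow, mul_pow, ha, hb]
    field_simp
    ring

/-- The sextic as a function of the pair `(v, w)`. -/
def sexticFun (z : ℂ × ℂ) : ℂ := sextic z.1 z.2

theorem prod_eq_zero {v : ℂ × ℂ} (h1 : v.1 = 0) (h2 : v.2 = 0) : v = 0 := Prod.ext h1 h2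

theorem HasDefiniteHessian.isMorseAt {v w : ℂ} {b : ℝ} (h : HasDefiniteHessian v w b)
    (hc : IsSexticCritical v w) : IsMorseAt sexticFun (v, w) := by
  obtain ⟨hB, hlt⟩ := h
  set A : ℂ × ℂ → ℂ := fun z => sexticA v w (z.1 - v) (z.2 - w) with hA
  set C : ℂ × ℂ → ℂ := fun z => sexticC v w (z.1 - v) (z.2 - w) with hC
  have h1 : AnalyticAt ℂ (fun z : ℂ × ℂ => z.1) (v, w) := analyticAt_fst
  have h2 : AnalyticAt ℂ (fun z : ℂ × ℂ => z.2) (v, w) := analyticAt_snd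
  have hAa : AnalyticAt ℂ A (v, w) := by
    simp only [hA, sexticA, powSumA, powSumC]
    fun_prop
  have hCa : AnalyticAt ℂ C (v, w) := by
    simp only [hC, sexticC, powSumA, powSumC]
    fun_prop
  have hA0 : A (v, w) = sexticA v w 0 0 := by simp [hA]
  have hC0 : C (v, w) = sexticC v w 0 0 := by simp [hC]
  set a := sexticA v w 0 0
  set c := sexticC v w 0 0
  have hbn : ‖(b : ℂ)‖ = |b| := by simp
  have hfd : ∀ (s : ℂ), fderiv ℂ (fun z : ℂ × ℂ => (z.1 - v) + s * (z.2 - w)) (v, w) =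
      ContinuousLinearMap.fst ℂ ℂ ℂ + s • ContinuousLinearMap.snd ℂ ℂ ℂ := by
    intro s
    apply HasFDerivAt.fderiv
    exact (hasFDerivAt_fst.sub_const v).add ((hasFDerivAt_snd.sub_const w).const_mul s)
  refine isMorseAt_of_quadratic (S := fun z => (z.1 - v) + 1 * (z.2 - w))
    (T := fun z => (z.1 - v) + (-1) * (z.2 - w))
    (K := fun z => (A z + b + C z) / 4) (M := fun z => (A z - C z) / 4)
    (N := fun z => (A z - b + C z) / 4) ?_ ?_ ?_ ?_ ?_ ?_ ?_ ?_ ?_ ?_ ?_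
  · fun_prop
  · fun_prop
  · fun_prop
  · fun_prop
  · fun_prop
  · simp
  · simp
  · intro u e1 e2
    rw [hfd] at e1 e2
    simp only [_root_.add_apply, _root_.smul_apply,
      ContinuousLinearMap.coe_fst', ContinuousLinearMap.coe_snd', smul_eq_mul] at e1 e2
    exact prod_eq_zero (by linear_combination (e1 + e2) / 2) (by linear_combination (e1 - e2) / 2)
  · simp only [hA0, hC0]
    intro e
    have e' : (b : ℂ) = -(a + c) := by linear_combination 4 * e
    have := norm_add_le a c
    rw [← norm_neg, ← e', hbn] at this
    linarith
  · simp only [hA0, hC0]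
    intro e
    have e' : (b : ℂ) ^ 2 = 4 * (a * c) := by linear_combination -16 * e
    have h3 := congrArg norm e'
    rw [norm_pow, hbn, norm_mul, norm_mul] at h3
    norm_num at h3
    have h4 : (‖a‖ + ‖c‖) ^ 2 < |b| ^ 2 := by
      apply pow_lt_pow_left₀ hlt (by positivity) two_ne_zero
    rw [sq_abs] at h4
    nlinarith [sq_nonneg (‖a‖ - ‖c‖)]
  · filter_upwards with z
    have h3 := sextic_taylor v w (z.1 - v) (z.2 - w)
    rw [add_sub_cancel, add_sub_cancel, hc.1, hc.2, hB] at h3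
    simp only [sexticFun]
    rw [h3]
    simp only [hA, hC]
    ring

theorem isMorseAt_of_two_lines {i j : ℕ} (hij : i ≠ j) (hi : i < 6) (hj : j < 6) {v w : ℂ}
    (h1 : lineForm (lineRoot i) v w = 0) (h2 : lineForm (lineRoot j) v w = 0) :
    IsMorseAt sexticFun (v, w) := by
  set s := lineRoot i
  set t := lineRoot j
  have hs : s ≠ 0 := lineRoot_ne_zero i
  have ht : t ≠ 0 := lineRoot_ne_zero j
  have hst : s ≠ t := fun e => hij (lineRoot_inj hi hj e)
  set R : ℂ × ℂ → ℂ := fun z => lineCofactor i j z.1 z.2 with hR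
  have hla : ∀ s : ℂ, AnalyticAt ℂ (fun z : ℂ × ℂ => lineForm s z.1 z.2) (v, w) := by
    intro s
    have h1 : AnalyticAt ℂ (fun z : ℂ × ℂ => z.1) (v, w) := analyticAt_fst
    have h2 : AnalyticAt ℂ (fun z : ℂ × ℂ => z.2) (v, w) := analyticAt_snd
    simp only [lineForm]
    fun_prop
  have hRa : AnalyticAt ℂ R (v, w) := Finset.analyticAt_fun_prod _ fun ν _ => hla _
  have hR0 : R (v, w) ≠ 0 := lineCofactor_ne_zero hij hi hj h1 h2
  have hfd : ∀ s : ℂ, fderiv ℂ (fun z : ℂ × ℂ => lineForm s z.1 z.2) (v, w) =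
      (-s) • ContinuousLinearMap.fst ℂ ℂ ℂ + (s ^ 2) • ContinuousLinearMap.snd ℂ ℂ ℂ := by
    intro s
    apply HasFDerivAt.fderiv
    have h := ((((hasFDerivAt_fst (𝕜 := ℂ) (p := (v, w))).const_mul (-s)).add
      ((hasFDerivAt_snd (𝕜 := ℂ) (p := (v, w))).const_mul (s ^ 2))).add_const (1 - s ^ 3))
    refine h.congr_of_eventuallyEq (Filter.Eventually.of_forall fun z => ?_)
    simp only [lineForm, Pi.add_apply]
    ring
  refine isMorseAt_of_quadratic
    (S := fun z => lineForm s z.1 z.2 + lineForm t z.1 z.2)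
    (T := fun z => lineForm s z.1 z.2 - lineForm t z.1 z.2)
    (K := fun z => R z / 4) (M := fun _ => 0) (N := fun z => -(R z / 4))
    (by fun_prop) analyticAt_const (by fun_prop) ((hla s).add (hla t)) ((hla s).sub (hla t))
    (by simp [h1, h2]) (by simp [h1, h2]) ?_ ?_ ?_ ?_
  · intro u e1 e2
    rw [fderiv_fun_add (hla s).differentiableAt (hla t).differentiableAt, hfd, hfd] at e1
    rw [fderiv_fun_sub (hla s).differentiableAt (hla t).differentiableAt, hfd, hfd] at e2
    simp only [_root_.add_apply, _root_.sub_apply,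
      _root_.smul_apply, ContinuousLinearMap.coe_fst',
      ContinuousLinearMap.coe_snd', smul_eq_mul] at e1 e2
    have a1 : s * (-u.1 + s * u.2) = 0 := by linear_combination (e1 + e2) / 2
    have a2 : t * (-u.1 + t * u.2) = 0 := by linear_combination (e1 - e2) / 2
    have b1 := (mul_eq_zero.1 a1).resolve_left hs
    have b2 := (mul_eq_zero.1 a2).resolve_left ht
    have c2 : (s - t) * u.2 = 0 := by linear_combination b1 - b2
    have d2 := (mul_eq_zero.1 c2).resolve_left (sub_ne_zero.2 hst)
    refine prod_eq_zero ?_ d2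
    rw [d2] at b1
    linear_combination -b1
  · exact div_ne_zero hR0 (by norm_num)
  · have : R (v, w) / 4 * -(R (v, w) / 4) - 0 ^ 2 = -(R (v, w) ^ 2 / 16) := by ring
    rw [this]
    exact neg_ne_zero.2 (div_ne_zero (pow_ne_zero 2 hR0) (by norm_num))
  · filter_upwards with z
    have h0 : sexticFun (v, w) = 0 := by
      simp only [sexticFun]
      rw [sextic_eq_mul_lineCofactor hij hi hj, h1]
      ring
    rw [h0]
    simp only [sexticFun]
    rw [sextic_eq_mul_lineCofactor hij hi hj]
    simp only [hR]
    ring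

theorem IsSexticCritical.isMorseAt {z : ℂ} (h : IsSexticCritical ((starRingEnd ℂ) z) z) :
    IsMorseAt sexticFun ((starRingEnd ℂ) z, z) := by
  rcases h.cases with h0 | h0 | h0
  · obtain ⟨i, j, hij, hj, h1, h2⟩ := sextic_critical_of_eq_zero h.1 h0
    exact isMorseAt_of_two_lines hij.ne (hij.trans hj) hj h1 h2
  · obtain ⟨-, -, b, -, hb⟩ := sextic_of_mem_minPts h0
    exact hb.isMorseAt h
  · obtain ⟨-, -, b, -, hb⟩ := sextic_of_mem_maxPts h0
    exact hb.isMorseAt h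

/-! ### Homogenizations and affine charts -/

theorem homogenization_isHomogeneous {n : ℕ} (f : MvPolynomial (Fin n) ℂ) :
    (homogenization f).IsHomogeneous f.totalDegree := by
  unfold homogenization
  refine IsHomogeneous.sum _ _ _ fun d hd => isHomogeneous_monomial _ ?_
  have hle : d.degree ≤ f.totalDegree := by
    rw [Finsupp.degree_eq_sum, ← Finsupp.sum_fintype d (fun _ e => e) (by simp)]
    exact le_totalDegree hd
  rw [Finsupp.degree_eq_sum, Fin.sum_univ_succ]
  simp only [Finsupp.cons_zero, Finsupp.cons_succ]
  rw [← Finsupp.degree_eq_sum]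
  omega

theorem eval_homogenization {n : ℕ} (f : MvPolynomial (Fin n) ℂ) {t : ℂ} (ht : t ≠ 0)
    (x : Fin n → ℂ) :
    eval (Fin.cons t x : Fin (n + 1) → ℂ) (homogenization f) =
      t ^ f.totalDegree * eval (fun i => x i / t) f := by
  unfold homogenization
  rw [map_sum, eval_eq' _ f, Finset.mul_sum]
  refine Finset.sum_congr rfl fun d hd => ?_
  have hle : d.degree ≤ f.totalDegree := by
    rw [Finsupp.degree_eq_sum, ← Finsupp.sum_fintype d (fun _ e => e) (by simp)]
    exact le_totalDegree hd
  rw [eval_monomial, Finsupp.prod_fintype _ _ (by simp), Fin.prod_univ_succ]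
  simp only [Finsupp.cons_zero, Finsupp.cons_succ, Fin.cons_zero, Fin.cons_succ, div_pow,
    Finset.prod_div_distrib, Finset.prod_pow_eq_pow_sum]
  rw [← Finsupp.degree_eq_sum, ← Nat.sub_add_cancel hle, pow_add, Nat.sub_add_cancel hle]
  field_simp

theorem totalDegree_map_algebraMap_le {n : ℕ} (f : MvPolynomial (Fin n) ℝ) :
    (MvPolynomial.map (algebraMap ℝ ℂ) f).totalDegree ≤ f.totalDegree :=
  Finset.sup_mono (support_map_subset _ _)

/-- The form `F` of degree `d` is given by the function `G` of the homogenizing variable and of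
the affine variables. -/
def IsFormOf {n : ℕ} (d : ℕ) (F : MvPolynomial (Fin (n + 1)) ℂ) (G : ℂ → (Fin n → ℂ) → ℂ) :
    Prop :=
  F.IsHomogeneous d ∧ ∀ t x, eval (Fin.cons t x : Fin (n + 1) → ℂ) F = G t x

theorem isFormOf_homogenization {n d : ℕ} {f : MvPolynomial (Fin n) ℂ} {G : ℂ → (Fin n → ℂ) → ℂ}
    (hd : f.totalDegree ≤ d) (hG : ∀ x, Continuous fun t => G t x)
    (h : ∀ t x, t ≠ 0 → t ^ d * eval (fun i => x i / t) f = G t x) {x₀ : Fin n → ℂ}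
    (h0 : G 0 x₀ ≠ 0) : IsFormOf d (homogenization f) G := by
  obtain ⟨e, rfl⟩ := Nat.exists_eq_add_of_le hd
  have key : ∀ t x, t ^ e * eval (Fin.cons t x : Fin (n + 1) → ℂ) (homogenization f) = G t x := by
    intro t x
    have hc : Continuous fun t : ℂ =>
        t ^ e * eval (Fin.cons t x : Fin (n + 1) → ℂ) (homogenization f) := by
      refine (continuous_pow e).mul ((MvPolynomial.continuous_eval _).comp ?_)
      refine continuous_pi fun k => ?_
      refine Fin.cases ?_ (fun k => ?_) k
      · simpa using continuous_id'
      · simpa using continuous_const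
    refine congrFun (hc.ext_on (dense_compl_singleton (0 : ℂ)) (hG x) fun s hs => ?_) t
    have hs : s ≠ 0 := hs
    change s ^ e * _ = _
    rw [eval_homogenization f hs, ← h s x hs, pow_add]
    ring
  have he : e = 0 := by
    by_contra hne
    have := key 0 x₀
    rw [zero_pow hne, zero_mul] at this
    exact h0 this.symm
  subst he
  refine ⟨homogenization_isHomogeneous f, fun t x => ?_⟩
  rw [← key t x, pow_zero, one_mul]

theorem cons_one_ne_zero {n : ℕ} (a : Fin n → ℂ) : (Fin.cons 1 a : Fin (n + 1) → ℂ) ≠ 0 := by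
  intro h
  have := congrFun h 0
  simp at this

/-- The point of projective space with affine coordinates `a`. -/
def affinePoint {n : ℕ} (a : Fin n → ℂ) : PSpace n :=
  Projectivization.mk ℂ (Fin.cons 1 a) (cons_one_ne_zero a)

theorem rep_affinePoint {n : ℕ} (a : Fin n → ℂ) :
    ∃ c : ℂ, c ≠ 0 ∧ (affinePoint a).rep = c • (Fin.cons 1 a : Fin (n + 1) → ℂ) := by
  obtain ⟨c, hc⟩ := Projectivization.exists_smul_eq_mk_rep ℂ (Fin.cons 1 a : Fin (n + 1) → ℂ)
    (cons_one_ne_zero a)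
  exact ⟨c, c.ne_zero, hc.symm⟩

theorem affinePoint_injective {n : ℕ} :
    Function.Injective (affinePoint : (Fin n → ℂ) → PSpace n) := by
  intro a b h
  obtain ⟨c, hc⟩ := (Projectivization.mk_eq_mk_iff' ℂ _ _ (cons_one_ne_zero a)
    (cons_one_ne_zero b)).1 h
  have h0 := congrFun hc 0
  simp only [Pi.smul_apply, Fin.cons_zero, smul_eq_mul, mul_one] at h0
  ext k
  have hk := congrFun hc k.succ
  simp only [Pi.smul_apply, Fin.cons_succ, smul_eq_mul, h0, one_mul] at hk
  exact hk.symm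

theorem eq_affinePoint {n : ℕ} {p : PSpace n} (h : p.rep 0 ≠ 0) :
    p = affinePoint fun k => p.rep k.succ / p.rep 0 := by
  conv_lhs => rw [← p.mk_rep]
  refine (Projectivization.mk_eq_mk_iff' ℂ _ _ p.rep_nonzero (cons_one_ne_zero _)).2
    ⟨p.rep 0, ?_⟩
  ext k
  refine Fin.cases ?_ (fun k => ?_) k
  · simp
  · simp only [Pi.smul_apply, Fin.cons_succ, smul_eq_mul]
    field_simp

theorem isRealPoint_affinePoint {n : ℕ} {a : Fin n → ℂ} (r : Fin n → ℝ) (h : ∀ k, a k = r k) :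
    IsRealPoint (affinePoint a) := by
  have e : (Fin.cons 1 a : Fin (n + 1) → ℂ) =
      fun i => (((Fin.cons 1 r : Fin (n + 1) → ℝ) i : ℝ) : ℂ) := by
    ext k
    refine Fin.cases ?_ (fun k => ?_) k <;> simp [h]
  refine ⟨Fin.cons 1 r, ?_, ?_⟩
  · rw [← e]; exact cons_one_ne_zero a
  · simp only [affinePoint, e]

theorem isASingularity_affinePoint {n j d : ℕ} {F : MvPolynomial (Fin (n + 2)) ℂ}
    {G : ℂ → (Fin (n + 1) → ℂ) → ℂ} (hF : IsFormOf d F G) {a : Fin (n + 1) → ℂ}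
    (h : IsAGerm j (G 1) a) : IsASingularity j F (affinePoint a) := by
  obtain ⟨c, hc, hr⟩ := rep_affinePoint a
  refine ⟨0, by simpa [hr] using hc, ?_⟩
  have e1 : (fun x : Fin (n + 1) → ℂ => eval (Fin.insertNth 0 1 x : Fin (n + 2) → ℂ) F) = G 1 := by
    funext x
    rw [← hF.2]
    congr 2
    exact Fin.insertNth_zero' 1 x
  have e2 : (fun k => (affinePoint a).rep (Fin.succAbove 0 k) / (affinePoint a).rep 0) = a := by
    funext k
    simp only [hr, Pi.smul_apply, Fin.zero_succAbove, Fin.cons_succ, Fin.cons_zero, smul_eq_mul,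
      mul_one]
    field_simp
  rw [e1, e2]
  exact h

theorem hasDerivAt_isFormOf {n d : ℕ} {F : MvPolynomial (Fin (n + 1)) ℂ}
    {G : ℂ → (Fin n → ℂ) → ℂ} (hF : IsFormOf d F G) {p : PSpace n} (hp : IsSingularPt F p)
    {c t : ℂ} {x : Fin n → ℂ} (h : p.rep = c • (Fin.cons t x : Fin (n + 1) → ℂ)) (hc : c ≠ 0)
    (u : Fin n → ℂ) : G t x = 0 ∧ HasDerivAt (fun s : ℂ => G t (x + s • u)) 0 0 := by
  obtain ⟨h0, h1⟩ := hp
  rw [h] at h0 h1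
  constructor
  · rw [eval_smul_of_isHomogeneous hF.1, hF.2] at h0
    exact (mul_eq_zero.1 h0).resolve_left (pow_ne_zero _ hc)
  · have hd := hasDerivAt_eval F (Fin.cons t x) (Fin.cons 0 u)
    have e : (fun s : ℂ => eval ((Fin.cons t x : Fin (n + 1) → ℂ) + s • Fin.cons 0 u) F) =
        fun s => G t (x + s • u) := by
      funext s
      rw [← hF.2]
      congr 2
      ext k
      refine Fin.cases ?_ (fun k => ?_) k <;> simp
    have h2 : dirDeriv F (Fin.cons t x) (Fin.cons 0 u) = 0 := by
      refine Finset.sum_eq_zero fun k _ => ?_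
      have := h1 k
      rw [eval_smul_of_isHomogeneous hF.1.pderiv] at this
      rw [(mul_eq_zero.1 this).resolve_left (pow_ne_zero _ hc), mul_zero]
    rwa [e, h2] at hd

/-- A hypersurface without singular points at infinity: the singular points lie in the affine
part and are singular points of the affine equation. -/
theorem IsSingularPt.exists_affinePoint {n d : ℕ} {F : MvPolynomial (Fin (n + 1)) ℂ}
    {G : ℂ → (Fin n → ℂ) → ℂ} (hF : IsFormOf d F G)
    (hinf : ∀ x : Fin n → ℂ, (∀ u, HasDerivAt (fun s : ℂ => G 0 (x + s • u)) 0 0) → x = 0)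
    {p : PSpace n} (hp : IsSingularPt F p) :
    ∃ a, p = affinePoint a ∧ G 1 a = 0 ∧
      ∀ u, HasDerivAt (fun s : ℂ => G 1 (a + s • u)) 0 0 := by
  by_cases h0 : p.rep 0 = 0
  · exfalso
    have e : p.rep = (1 : ℂ) • (Fin.cons 0 (fun k => p.rep k.succ) : Fin (n + 1) → ℂ) := by
      ext k
      refine Fin.cases ?_ (fun k => ?_) k
      · simp [h0]
      · simp
    have hx := hinf _ fun u => (hasDerivAt_isFormOf hF hp e one_ne_zero u).2
    apply p.rep_nonzero
    ext k
    refine Fin.cases h0 (fun k => congrFun hx k) k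
  · have ha := eq_affinePoint h0
    have e : p.rep = p.rep 0 •
        (Fin.cons 1 (fun k => p.rep k.succ / p.rep 0) : Fin (n + 1) → ℂ) := by
      ext k
      refine Fin.cases ?_ (fun k => ?_) k
      · simp
      · simp only [Pi.smul_apply, Fin.cons_succ, smul_eq_mul]
        field_simp
    exact ⟨_, ha, (hasDerivAt_isFormOf hF hp e h0 0).1,
      fun u => (hasDerivAt_isFormOf hF hp e h0 u).2⟩

/-! ### The product of the lines -/

theorem lineRoot_eq_exp (ν : ℕ) : lineRoot ν =
    Complex.exp (((6 * (ν : ℤ) + 1 : ℤ) * Real.pi / 36 : ℝ) * Complex.I) ^ 2 := by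
  rw [lineRoot, baseRoot, eta, ← Complex.exp_nat_mul, ← Complex.exp_nat_mul, ← Complex.exp_add]
  congr 1
  push_cast
  ring

theorem lineRoot_add_one_ne_zero (ν : ℕ) : lineRoot ν + 1 ≠ 0 := by
  intro h
  have h1 : lineRoot ν = -1 := by linear_combination h
  have h6 := lineRoot_pow ν
  rw [h1] at h6
  apply one_sub_eta_ne_zero
  rw [← h6]; norm_num

theorem eval_line (ν : ℕ) (x y : ℂ) :
    eval ![x, y] (MvPolynomial.map (algebraMap ℝ ℂ) (line 6 (6 * (ν : ℤ) + 1))) =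
      lineForm (lineRoot ν) (x - Complex.I * y) (x + Complex.I * y) /
        (Complex.I * lineRoot ν * (lineRoot ν + 1)) := by
  have hne : (6 * (ν : ℤ) + 1) ≠ 3 * ((6 : ℕ) : ℤ) := by omega
  have hs := lineRoot_ne_zero ν
  have hs1 := lineRoot_add_one_ne_zero ν
  rw [line, if_neg hne]
  set θ : ℝ := (6 * (ν : ℤ) + 1 : ℤ) * Real.pi / 36 with hθ
  have e1 : ((6 * (ν : ℤ) + 1 : ℤ) * Real.pi / (3 * (6 : ℕ)) : ℝ) = 2 * θ := by
    rw [hθ]; push_cast; ring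
  have e2 : ((6 * (ν : ℤ) + 1 : ℤ) * Real.pi / (6 * (6 : ℕ)) : ℝ) = θ := by
    rw [hθ]; push_cast; ring
  have hr : lineRoot ν = (Real.cos θ + Real.sin θ * Complex.I) ^ 2 := by
    rw [lineRoot_eq_exp, ← hθ, Complex.exp_mul_I]
    push_cast
    rfl
  rw [e1, e2, Real.cos_two_mul, Real.sin_two_mul, Real.tan_eq_sin_div_cos]
  have hcs : (Real.cos θ : ℂ) ^ 2 + (Real.sin θ : ℂ) ^ 2 = 1 := by
    exact_mod_cast Real.cos_sq_add_sin_sq θ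
  have hI : Complex.I ^ 2 = -1 := Complex.I_sq
  have hadd : lineRoot ν + 1 = 2 * Real.cos θ * (Real.cos θ + Real.sin θ * Complex.I) := by
    rw [hr]
    linear_combination (Real.sin θ : ℂ) ^ 2 * hI - hcs
  have hc : (Real.cos θ : ℂ) ≠ 0 := by
    intro e
    rw [e] at hadd
    exact hs1 (by rw [hadd]; ring)
  rw [eq_div_iff (mul_ne_zero (mul_ne_zero Complex.I_ne_zero hs) hs1), hadd, hr]
  simp only [map_sub, map_mul, map_X, map_C, eval_X, eval_C, Matrix.cons_val_zero,
    Matrix.cons_val_one, lineForm, Complex.coe_algebraMap, Complex.ofReal_pow,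
    Complex.ofReal_div, Complex.ofReal_one, Complex.ofReal_ofNat]
  set c : ℂ := (Real.cos θ : ℂ)
  set s : ℂ := (Real.sin θ : ℂ)
  set e : ℂ := c + s * Complex.I with he
  set τ : ℂ := s / c with hτ
  have hτc : τ * c = s := div_mul_cancel₀ _ hc
  have hee : e * (c - s * Complex.I) = 1 := by
    rw [he]; linear_combination hcs - s ^ 2 * hI
  have hL : 2 * Complex.I * (y * c - (2 * c ^ 2 - 1 - x) * s - 2 * s * c ^ 2) =
      (c - s * Complex.I) ^ 3 - (x - Complex.I * y) * (c - s * Complex.I)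
        + (x + Complex.I * y) * e - e ^ 3 := by
    rw [he]
    linear_combination 2 * s ^ 3 * Complex.I * hI - 2 * Complex.I * s * hcs
  linear_combination -(2 * c ^ 2 - 1 - x) * 2 * Complex.I * e ^ 3 * hτc + e ^ 3 * hL
    + ((e * (c - s * Complex.I)) ^ 2 + e * (c - s * Complex.I) + 1
      - (x - Complex.I * y) * e ^ 2) * hee

theorem prod_lineRoot_mul : ∏ ν ∈ Finset.range 6, (Complex.I * lineRoot ν * (lineRoot ν + 1)) = 1 := by
  have e2 := eta_sq
  have e3 := eta_pow_three
  have e4 : eta ^ 4 = -eta := by linear_combination eta * e3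
  have e5 : eta ^ 5 = -eta ^ 2 := by linear_combination eta ^ 2 * e3
  have b6 := baseRoot_pow
  have hI : Complex.I ^ 2 = -1 := Complex.I_sq
  simp only [Finset.prod_range_succ, Finset.prod_range_zero, lineRoot, pow_zero, pow_one, e3, e4,
    e5, mul_one, one_mul]
  have hpair : ∀ b : ℂ, (Complex.I * b * (b + 1)) * (Complex.I * (-b) * (-b + 1))
      = b ^ 2 * (1 - b ^ 2) := by
    intro b
    linear_combination (-(b ^ 2 * (1 - b ^ 2))) * hI
  have h0 := hpair baseRoot
  have h1 := hpair (baseRoot * eta)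
  have h2 := hpair (baseRoot * eta ^ 2)
  have hcube : (1 - baseRoot ^ 2) * (1 - baseRoot ^ 2 * eta ^ 2) * (1 + baseRoot ^ 2 * eta)
      = 1 - eta := by
    linear_combination (-(1 - baseRoot ^ 2) * baseRoot ^ 2 * (1 + baseRoot ^ 2 * eta)
      - (1 - baseRoot ^ 2) * baseRoot ^ 4) * e2 - b6
  calc _ = (Complex.I * baseRoot * (baseRoot + 1) * (Complex.I * (-baseRoot) * (-baseRoot + 1))) *
      (Complex.I * (baseRoot * eta) * (baseRoot * eta + 1) *
        (Complex.I * (-(baseRoot * eta)) * (-(baseRoot * eta) + 1))) *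
      (Complex.I * (baseRoot * eta ^ 2) * (baseRoot * eta ^ 2 + 1) *
        (Complex.I * (-(baseRoot * eta ^ 2)) * (-(baseRoot * eta ^ 2) + 1))) := by ring
    _ = baseRoot ^ 6 * eta ^ 6 * ((1 - baseRoot ^ 2) * (1 - baseRoot ^ 2 * eta ^ 2) *
        (1 - baseRoot ^ 2 * eta ^ 4)) := by rw [h0, h1, h2]; ring
    _ = 1 := by
      rw [b6, eta_pow_six, e4, mul_one, mul_neg, sub_neg_eq_add, hcube, eta_mul_one_sub]

/-- In the coordinates `v = x - εiy`, `w = x + εiy` the polynomial `P` is the sextic. -/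
def IsSexticEq (P : MvPolynomial (Fin 2) ℝ) (ε : ℝ) : Prop :=
  P.totalDegree ≤ 6 ∧ ∀ x y : ℂ, eval ![x, y] (MvPolynomial.map (algebraMap ℝ ℂ) P) =
    sextic (x - ε * Complex.I * y) (x + ε * Complex.I * y)

theorem barJ_two : barJ 2 = ∏ ν ∈ Finset.range 6, line 6 (6 * (ν : ℤ) + 1) := by
  have h : (3 : ℝ) ^ ((1 - (-1 : ℝ) ^ (3 * 2)) / 4) * (-1) ^ ((2 + 1) / 2 + 1) = 1 := by
    norm_num
  rw [barJ, h, C_1, one_mul]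

theorem totalDegree_line_le (y : MvPolynomial (Fin 2) ℝ) (hy : y.totalDegree ≤ 1) (a b c : ℝ) :
    (y - (C a - X 0) * C b - C c).totalDegree ≤ 1 := by
  have h1 : (C a - X 0 : MvPolynomial (Fin 2) ℝ).totalDegree ≤ 1 :=
    (totalDegree_sub _ _).trans (by simp)
  have h2 : ((C a - X 0) * C b : MvPolynomial (Fin 2) ℝ).totalDegree ≤ 1 :=
    (totalDegree_mul _ _).trans (by rw [totalDegree_C]; exact h1)
  exact (totalDegree_sub _ _).trans
    (max_le ((totalDegree_sub _ _).trans (max_le hy h2)) (by simp))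

theorem isSexticEq_barJ : IsSexticEq (barJ 2) 1 := by
  rw [barJ_two]
  constructor
  · refine (totalDegree_finsetProd _ _).trans
      ((Finset.sum_le_card_nsmul _ _ 1 fun ν _ => ?_).trans (by simp))
    rw [line, if_neg (by omega)]
    exact totalDegree_line_le _ (by simp) _ _ _
  · intro x y
    rw [map_prod, map_prod, Finset.prod_congr rfl fun ν _ => eval_line ν x y,
      Finset.prod_div_distrib, prod_lineRoot_mul, div_one, prod_lineForm]
    simp

theorem eval_aeval_mirror (p : MvPolynomial (Fin 2) ℝ) (x y : ℂ) :
    eval ![x, y] (MvPolynomial.map (algebraMap ℝ ℂ) (aeval ![X 0, -X 1] p)) =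
      eval ![x, -y] (MvPolynomial.map (algebraMap ℝ ℂ) p) := by
  induction p using MvPolynomial.induction_on with
  | C a => simp
  | add f g hf hg => simp only [map_add, hf, hg]
  | mul_X f i hf =>
    simp only [map_mul, hf, aeval_X, map_X, eval_X]
    fin_cases i <;> simp

theorem isSexticEq_plainJ : IsSexticEq (plainJ 2) (-1) := by
  constructor
  · rw [plainJ, barJ_two, map_prod]
    refine (totalDegree_finsetProd _ _).trans
      ((Finset.sum_le_card_nsmul _ _ 1 fun ν _ => ?_).trans (by simp))
    rw [line, if_neg (by omega)]
    simp only [map_sub, map_mul, aeval_X, aeval_C, algebraMap_eq, Matrix.cons_val_zero,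
      Matrix.cons_val_one]
    exact totalDegree_line_le _ (by simp) _ _ _
  · intro x y
    rw [plainJ, eval_aeval_mirror, isSexticEq_barJ.2]
    congr 1 <;> push_cast <;> ring

/-! ### Critical points on the real plane -/

/-- The plane, reflected in the real axis for `ε = -1`. -/
def twist (ε : ℝ) (z : ℂ) : ℂ := ⟨z.re, ε * z.im⟩

theorem twist_twist {ε : ℝ} (hε : ε ^ 2 = 1) (z : ℂ) : twist ε (twist ε z) = z := by
  apply Complex.ext
  · rfl
  · simp only [twist]; linear_combination z.im * hε

theorem continuous_twist (ε : ℝ) : Continuous (twist ε) := by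
  have e : twist ε = fun z : ℂ => (z.re : ℂ) + (ε * z.im : ℝ) * Complex.I := by
    funext z
    apply Complex.ext <;> simp [twist]
  rw [e]
  fun_prop

theorem image_twist {ε : ℝ} (hε : ε ^ 2 = 1) (S : Set ℂ) : twist ε '' S = {z | twist ε z ∈ S} := by
  ext z
  constructor
  · rintro ⟨y, hy, rfl⟩
    simpa [twist_twist hε] using hy
  · intro h
    exact ⟨twist ε z, h, twist_twist hε z⟩

theorem twist_add (ε : ℝ) (z : ℂ) :
    ((z.re : ℂ) + ε * Complex.I * z.im) = twist ε z := by
  apply Complex.ext <;> simp [twist]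

theorem twist_sub (ε : ℝ) (z : ℂ) :
    ((z.re : ℂ) - ε * Complex.I * z.im) = (starRingEnd ℂ) (twist ε z) := by
  apply Complex.ext <;> simp [twist]

theorem ofReal_planeFun (P : MvPolynomial (Fin 2) ℝ) (z : ℂ) :
    (planeFun P z : ℂ) =
      eval ![(z.re : ℂ), (z.im : ℂ)] (MvPolynomial.map (algebraMap ℝ ℂ) P) := by
  unfold planeFun
  induction P using MvPolynomial.induction_on with
  | C a => simp
  | add f g hf hg => simp only [map_add, Complex.ofReal_add, hf, hg]
  | mul_X f i hf =>
    simp only [map_mul, Complex.ofReal_mul, hf, map_X, eval_X]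
    fin_cases i <;> simp

theorem IsSexticEq.planeFun_eq {P : MvPolynomial (Fin 2) ℝ} {ε : ℝ} (h : IsSexticEq P ε) :
    planeFun P = fun z => realSextic (twist ε z) := by
  funext z
  apply Complex.ofReal_injective
  rw [ofReal_planeFun, h.2, realSextic_cast, twist_add, twist_sub]

theorem IsSexticEq.dirDeriv_eq {P : MvPolynomial (Fin 2) ℝ} {ε : ℝ} (h : IsSexticEq P ε)
    (x y : ℂ) (u : Fin 2 → ℂ) :
    dirDeriv (MvPolynomial.map (algebraMap ℝ ℂ) P) ![x, y] u =
      sexticV (x - ε * Complex.I * y) (x + ε * Complex.I * y) * (u 0 - ε * Complex.I * u 1)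
      + sexticW (x - ε * Complex.I * y) (x + ε * Complex.I * y) * (u 0 + ε * Complex.I * u 1) := by
  have h1 := hasDerivAt_eval (MvPolynomial.map (algebraMap ℝ ℂ) P) ![x, y] u
  have h2 := hasDerivAt_sextic_line (x - ε * Complex.I * y) (x + ε * Complex.I * y)
    (u 0 - ε * Complex.I * u 1) (u 0 + ε * Complex.I * u 1)
  refine h1.unique ?_
  refine h2.congr_of_eventuallyEq (Filter.Eventually.of_forall fun t => ?_)
  have e : ![x, y] + t • u = ![x + t * u 0, y + t * u 1] := by
    ext i; fin_cases i <;> simp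
  simp only [e, h.2]
  congr 1 <;> ring

theorem IsSexticEq.isCritical_iff {P : MvPolynomial (Fin 2) ℝ} {ε : ℝ} (h : IsSexticEq P ε)
    (hε : ε ^ 2 = 1) (z : ℂ) :
    IsCritical P z ↔ IsSexticCritical ((starRingEnd ℂ) (twist ε z)) (twist ε z) := by
  have hd := h.dirDeriv_eq z.re z.im
  rw [twist_add, twist_sub] at hd
  have hk : ∀ i, (planeFun (pderiv i P) z : ℂ) =
      eval ![(z.re : ℂ), (z.im : ℂ)] (pderiv i (MvPolynomial.map (algebraMap ℝ ℂ) P)) := by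
    intro i
    rw [ofReal_planeFun, pderiv_map]
  have h0 : (planeFun (pderiv 0 P) z : ℂ) = _ := (hk 0).trans (by
    have := hd ![1, 0]
    simpa [dirDeriv] using this)
  have h1 : (planeFun (pderiv 1 P) z : ℂ) = _ := (hk 1).trans (by
    have := hd ![0, 1]
    simpa [dirDeriv] using this)
  have hε' : (ε : ℂ) ^ 2 = 1 := by exact_mod_cast hε
  set a := sexticV ((starRingEnd ℂ) (twist ε z)) (twist ε z)
  set b := sexticW ((starRingEnd ℂ) (twist ε z)) (twist ε z)
  constructor
  · intro hc
    rw [hc 0, Complex.ofReal_zero] at h0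
    rw [hc 1, Complex.ofReal_zero] at h1
    have e : b - a = 0 := by
      linear_combination ε * Complex.I * h1 + (a - b) * hε'
        - ε ^ 2 * (a - b) * Complex.I_sq
    exact ⟨show a = 0 by linear_combination -(h0 + e) / 2,
      show b = 0 by linear_combination (-h0 + e) / 2⟩
  · rintro ⟨ha, hb⟩ i
    have ha : a = 0 := ha
    have hb : b = 0 := hb
    apply Complex.ofReal_injective
    fin_cases i
    · change (planeFun (pderiv 0 P) z : ℂ) = _
      rw [h0, ha, hb]; simp
    · change (planeFun (pderiv 1 P) z : ℂ) = _
      rw [h1, ha, hb]; simp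

theorem IsSexticEq.setOf_isCritical {P : MvPolynomial (Fin 2) ℝ} {ε : ℝ} (h : IsSexticEq P ε)
    (hε : ε ^ 2 = 1) (c : ℝ) :
    {z | IsCritical P z ∧ planeFun P z = c} = twist ε '' levelPts c := by
  rw [image_twist hε]
  ext z
  simp only [Set.mem_ofPred_eq, levelPts, h.isCritical_iff hε, h.planeFun_eq, ← realSextic_cast,
    Complex.ofReal_inj]

theorem twist_injective {ε : ℝ} (hε : ε ^ 2 = 1) : Function.Injective (twist ε) :=
  Function.LeftInverse.injective (twist_twist hε)

theorem IsSexticEq.isLocalMin_iff {P : MvPolynomial (Fin 2) ℝ} {ε : ℝ} (h : IsSexticEq P ε)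
    (hε : ε ^ 2 = 1) (z : ℂ) : IsLocalMin (planeFun P) z ↔ twist ε z ∈ minPts := by
  rw [← isLocalMin_realSextic, h.planeFun_eq]
  constructor
  · intro hm
    have ht : Tendsto (twist ε) (𝓝 (twist ε z)) (𝓝 z) := by
      have := (continuous_twist ε).tendsto (twist ε z)
      rwa [twist_twist hε] at this
    filter_upwards [ht.eventually hm] with y hy
    simpa only [twist_twist hε] using hy
  · intro hm
    exact ((continuous_twist ε).tendsto z).eventually hm

theorem IsSexticEq.isLocalMax_iff {P : MvPolynomial (Fin 2) ℝ} {ε : ℝ} (h : IsSexticEq P ε)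
    (hε : ε ^ 2 = 1) (z : ℂ) : IsLocalMax (planeFun P) z ↔ twist ε z ∈ maxPts := by
  rw [← isLocalMax_realSextic, h.planeFun_eq]
  constructor
  · intro hm
    have ht : Tendsto (twist ε) (𝓝 (twist ε z)) (𝓝 z) := by
      have := (continuous_twist ε).tendsto (twist ε z)
      rwa [twist_twist hε] at this
    filter_upwards [ht.eventually hm] with y hy
    simpa only [twist_twist hε] using hy
  · intro hm
    exact ((continuous_twist ε).tendsto z).eventually hm

theorem IsSexticEq.critical_points {P : MvPolynomial (Fin 2) ℝ} {ε : ℝ} (h : IsSexticEq P ε)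
    (hε : ε ^ 2 = 1) :
    (∀ z, IsCritical P z → planeFun P z = 0 ∨ planeFun P z = -1 ∨ planeFun P z = 8) ∧
      {z | IsCritical P z ∧ planeFun P z = 0}.ncard = 15 ∧
      {z | IsCritical P z ∧ planeFun P z = -1} = twist ε '' minPts ∧
      {z | IsLocalMin (planeFun P) z} = twist ε '' minPts ∧
      {z | IsCritical P z ∧ planeFun P z = 8} = twist ε '' maxPts ∧
      {z | IsLocalMax (planeFun P) z} = twist ε '' maxPts := by
  refine ⟨fun z hz => ?_, ?_, ?_, ?_, ?_, ?_⟩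
  · rw [h.isCritical_iff hε] at hz
    simp only [h.planeFun_eq]
    have hcast := realSextic_cast (twist ε z)
    rcases hz.cases with h0 | h0 | h0
    · left; apply Complex.ofReal_injective; rw [hcast, h0]; simp
    · right; left; apply Complex.ofReal_injective
      rw [hcast, (sextic_of_mem_minPts h0).2.1]; simp
    · right; right; apply Complex.ofReal_injective
      rw [hcast, (sextic_of_mem_maxPts h0).2.1]; simp
  · rw [h.setOf_isCritical hε 0, Set.ncard_image_of_injective _ (twist_injective hε),
      Complex.ofReal_zero, ncard_levelPts_zero]
  · rw [h.setOf_isCritical hε (-1), Complex.ofReal_neg, Complex.ofReal_one, levelPts_neg_one]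
  · rw [image_twist hε]
    ext z
    exact h.isLocalMin_iff hε z
  · rw [h.setOf_isCritical hε 8, Complex.ofReal_ofNat, levelPts_eight]
  · rw [image_twist hε]
    ext z
    exact h.isLocalMax_iff hε z

theorem twist_one : twist 1 = id := by
  funext z
  apply Complex.ext <;> simp [twist]

theorem twist_neg_one : twist (-1) = star := by
  funext z
  apply Complex.ext <;> simp [twist]

/-! ### The homogeneous equations -/

/-- The homogenized power sum. -/
def powSumHom (t v w : ℂ) : ℂ :=
  v ^ 6 - 6 * v ^ 4 * w * t + 6 * v ^ 3 * t ^ 3 + 9 * v ^ 2 * w ^ 2 * t ^ 2 - 12 * v * w * t ^ 4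
    - 2 * w ^ 3 * t ^ 3 + 3 * t ^ 6

/-- The homogenized sextic. -/
def sexticHom (t v w : ℂ) : ℂ :=
  2 * t ^ 6 - eta * powSumHom t v w - (1 - eta) * powSumHom t w v

theorem sexticHom_one (v w : ℂ) : sexticHom 1 v w = sextic v w := by
  simp only [sexticHom, sextic, powSumHom, powSum]; ring

theorem sexticHom_zero (v w : ℂ) :
    sexticHom 0 v w = -eta * v ^ 6 - (1 - eta) * w ^ 6 := by
  simp only [sexticHom, powSumHom]; ring

theorem pow_mul_sextic_div {t : ℂ} (ht : t ≠ 0) (v w : ℂ) :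
    t ^ 6 * sextic (v / t) (w / t) = sexticHom t v w := by
  simp only [sexticHom, sextic, powSumHom, powSum]
  field_simp

theorem continuous_sexticHom (v w : ℂ) : Continuous fun t => sexticHom t v w := by
  simp only [sexticHom, powSumHom]
  fun_prop

/-- The coordinates `v = x - εiy`, `w = x + εiy` on the plane of the coordinates `i`, `j`. -/
def planeMap {n : ℕ} (ε : ℝ) (i j : Fin n) : (Fin n → ℂ) →L[ℂ] ℂ × ℂ :=
  ContinuousLinearMap.prod
    (ContinuousLinearMap.proj i - ((ε : ℂ) * Complex.I) • ContinuousLinearMap.proj j)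
    (ContinuousLinearMap.proj i + ((ε : ℂ) * Complex.I) • ContinuousLinearMap.proj j)

theorem planeMap_apply {n : ℕ} (ε : ℝ) (i j : Fin n) (x : Fin n → ℂ) :
    planeMap ε i j x = (x i - ε * Complex.I * x j, x i + ε * Complex.I * x j) := rfl

theorem epsilon_mul_I_sq {ε : ℝ} (hε : ε ^ 2 = 1) : ((ε : ℂ) * Complex.I) ^ 2 = -1 := by
  have : (ε : ℂ) ^ 2 = 1 := by exact_mod_cast hε
  rw [mul_pow, this, Complex.I_sq]; ring

theorem eq_zero_of_planeMap {n : ℕ} {ε : ℝ} (hε : ε ^ 2 = 1) {i j : Fin n} {x : Fin n → ℂ}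
    (h : planeMap ε i j x = 0) : x i = 0 ∧ x j = 0 := by
  rw [planeMap_apply, Prod.mk_eq_zero] at h
  have hk := epsilon_mul_I_sq hε
  refine ⟨by linear_combination (h.1 + h.2) / 2, ?_⟩
  linear_combination (ε * Complex.I) * (h.1 - h.2) / 2 + x j * hk

theorem planeMap_eq_iff {n : ℕ} {ε : ℝ} (hε : ε ^ 2 = 1) {i j : Fin n} {x : Fin n → ℂ} {z : ℂ} :
    planeMap ε i j x = ((starRingEnd ℂ) z, z) ↔ x i = z.re ∧ x j = (ε * z.im : ℝ) := by
  have hk := epsilon_mul_I_sq hε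
  have hε' : (ε : ℂ) ^ 2 = 1 := by exact_mod_cast hε
  have e1 : z = z.re + z.im * Complex.I := (Complex.re_add_im z).symm
  have e2 : (starRingEnd ℂ) z = z.re - z.im * Complex.I := by
    apply Complex.ext <;> simp
  rw [planeMap_apply, Prod.mk.injEq]
  push_cast
  constructor
  · rintro ⟨h1, h2⟩
    rw [e2] at h1
    rw [e1] at h2
    refine ⟨by linear_combination (h1 + h2) / 2, ?_⟩
    linear_combination (ε * Complex.I) * (h1 - h2) / 2 + x j * hk - ε * z.im * Complex.I_sq
  · rintro ⟨h1, h2⟩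
    rw [h1, h2]
    constructor
    · rw [e2]; linear_combination -Complex.I * z.im * hε'
    · conv_rhs => rw [e1]
      linear_combination Complex.I * z.im * hε'

theorem hasDerivAt_sextic_planeMap {n : ℕ} (ε : ℝ) (i j : Fin n) (x u : Fin n → ℂ) :
    HasDerivAt (fun s : ℂ => sexticFun (planeMap ε i j (x + s • u)))
      (sexticV (planeMap ε i j x).1 (planeMap ε i j x).2 * (planeMap ε i j u).1
        + sexticW (planeMap ε i j x).1 (planeMap ε i j x).2 * (planeMap ε i j u).2) 0 := by
  have h := hasDerivAt_sextic_line (planeMap ε i j x).1 (planeMap ε i j x).2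
    (planeMap ε i j u).1 (planeMap ε i j u).2
  refine h.congr_of_eventuallyEq (Filter.Eventually.of_forall fun s => ?_)
  simp [sexticFun]

theorem hasDerivAt_sexticHom_zero {n : ℕ} (ε : ℝ) (i j : Fin n) (x u : Fin n → ℂ) :
    HasDerivAt (fun s : ℂ => sexticHom 0 (planeMap ε i j (x + s • u)).1
        (planeMap ε i j (x + s • u)).2)
      (-6 * eta * (planeMap ε i j x).1 ^ 5 * (planeMap ε i j u).1
        - 6 * (1 - eta) * (planeMap ε i j x).2 ^ 5 * (planeMap ε i j u).2) 0 := by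
  have hl : ∀ a b : ℂ, HasDerivAt (fun s : ℂ => (a + s * b) ^ 6) (6 * a ^ 5 * b) 0 := by
    intro a b
    have h := (((hasDerivAt_id' (0 : ℂ)).mul_const b).const_add a).pow 6
    refine h.congr_deriv ?_
    simp
  have h := ((hl (planeMap ε i j x).1 (planeMap ε i j u).1).const_mul (-eta)).sub
    ((hl (planeMap ε i j x).2 (planeMap ε i j u).2).const_mul (1 - eta))
  refine (h.congr_deriv (by ring)).congr_of_eventuallyEq (Filter.Eventually.of_forall fun s => ?_)
  simp only [sexticHom_zero, map_add, map_smul, Prod.fst_add, Prod.snd_add, Prod.smul_fst,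
    Prod.smul_snd, smul_eq_mul, Pi.sub_apply]

/-- The vectors in which `v`, respectively `w`, is a coordinate vector. -/
theorem exists_planeMap_eq {n : ℕ} {ε : ℝ} (hε : ε ^ 2 = 1) {i j : Fin n} (hij : i ≠ j)
    (a b : ℂ) : ∃ u : Fin n → ℂ, planeMap ε i j u = (a, b) ∧ ∀ k, k ≠ i → k ≠ j → u k = 0 := by
  have hk := epsilon_mul_I_sq hε
  refine ⟨Function.update (Function.update 0 j (ε * Complex.I * (a - b) / 2)) i ((a + b) / 2),
    ?_, fun k h1 h2 => by simp [h1, h2]⟩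
  rw [planeMap_apply]
  simp only [Function.update_self, Function.update_of_ne hij.symm, Prod.mk.injEq]
  constructor
  · linear_combination -(a - b) / 2 * hk
  · linear_combination (a - b) / 2 * hk

theorem fderiv_comp_continuousLinearMap {E F : Type*} [NormedAddCommGroup E] [NormedSpace ℂ E]
    [NormedAddCommGroup F] [NormedSpace ℂ F] {g : F → ℂ} (l : E →L[ℂ] F) {a : E}
    (h : DifferentiableAt ℂ g (l a)) (v : E) :
    fderiv ℂ (fun x => g (l x)) a v = fderiv ℂ g (l a) (l v) := by
  have h1 := h.hasFDerivAt.comp a l.hasFDerivAt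
  have h2 : fderiv ℂ (fun x => g (l x)) a = (fderiv ℂ g (l a)).comp l := h1.fderiv
  rw [h2]
  rfl

/-! ### The surface -/

theorem polyG_two_two_four :
    polyG 2 2 4 = Polynomial.C (1 / 16) * (Polynomial.X ^ 2 * (Polynomial.X - 3) ^ 4) := by
  have h : (jacobiPoly (2 - 1) (((2 : ℕ) : ℝ) / (4 : ℕ)) (-((2 : ℕ) : ℝ))).comp
      (1 - 2 * Polynomial.X) = Polynomial.C (-1 / 2) * (Polynomial.X - 3) := by
    apply Polynomial.funext
    intro r
    simp [jacobiPoly, Finset.sum_range_succ, ascPochhammer_one]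
    ring
  rw [polyG, h, mul_pow, ← Polynomial.C_pow]
  have : ((-1 / 2 : ℝ)) ^ 4 = 1 / 16 := by norm_num
  rw [this]
  ring

/-- The function `z²(z - 3)⁴/16`. -/
def quarticG (z : ℂ) : ℂ := 1 / 16 * (z ^ 2 * (z - 3) ^ 4)

/-- The homogeneous equation of the surface. -/
def surfaceForm (ε : ℝ) (t : ℂ) (x : Fin 3 → ℂ) : ℂ :=
  sexticHom t (planeMap ε 0 1 x).1 (planeMap ε 0 1 x).2
    + 1 / 16 * (x 2 ^ 2 * (x 2 - 3 * t) ^ 4)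

theorem surfaceForm_one (ε : ℝ) (x : Fin 3 → ℂ) :
    surfaceForm ε 1 x = sexticFun (planeMap ε 0 1 x) + quarticG (x 2) := by
  rw [surfaceForm, sexticHom_one, mul_one]; rfl

theorem eval_rename_pair {n : ℕ} {P : MvPolynomial (Fin 2) ℝ} {ε : ℝ} (h : IsSexticEq P ε)
    (i j : Fin n) (x : Fin n → ℂ) :
    eval x (MvPolynomial.map (algebraMap ℝ ℂ) (rename ![i, j] P)) =
      sexticFun (planeMap ε i j x) := by
  have e : x ∘ ![i, j] = ![x i, x j] := by
    ext k; fin_cases k <;> rfl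
  rw [map_rename, eval_rename, e, h.2]
  rfl

theorem planeMap_div {n : ℕ} (ε : ℝ) (i j : Fin n) (x : Fin n → ℂ) (t : ℂ) :
    planeMap ε i j (fun k => x k / t) =
      ((planeMap ε i j x).1 / t, (planeMap ε i j x).2 / t) := by
  simp only [planeMap_apply, Prod.mk.injEq]
  constructor <;> ring

theorem isFormOf_surface {P : MvPolynomial (Fin 2) ℝ} {ε : ℝ} (h : IsSexticEq P ε) :
    IsFormOf 6 (projForm (surfaceEq P (polyG 2 2 4))) (surfaceForm ε) := by
  refine isFormOf_homogenization (x₀ := ![0, 0, 1]) ?_ ?_ ?_ ?_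
  · refine (totalDegree_map_algebraMap_le _).trans ((totalDegree_add _ _).trans
      (max_le ((totalDegree_rename_le _ _).trans h.1) ?_))
    rw [polyG_two_two_four]
    simp only [map_mul, map_pow, map_sub, Polynomial.aeval_X, Polynomial.aeval_C, map_ofNat]
    have h3 : (X 2 - 3 : MvPolynomial (Fin 3) ℝ).totalDegree ≤ 1 := by
      have : (3 : MvPolynomial (Fin 3) ℝ) = C 3 := rfl
      rw [this]
      exact (totalDegree_sub _ _).trans (by simp)
    refine (totalDegree_mul _ _).trans ?_
    rw [algebraMap_eq, totalDegree_C, zero_add]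
    refine (totalDegree_mul _ _).trans ?_
    have h4 := totalDegree_pow (X 2 - 3 : MvPolynomial (Fin 3) ℝ) 4
    rw [totalDegree_X_pow]
    omega
  · intro x
    simp only [surfaceForm]
    have := continuous_sexticHom (planeMap ε 0 1 x).1 (planeMap ε 0 1 x).2
    fun_prop
  · intro t x ht
    rw [surfaceEq, map_add, map_add, eval_rename_pair h, polyG_two_two_four, planeMap_div,
      surfaceForm, ← pow_mul_sextic_div ht, mul_add]
    congr 1
    simp only [map_mul, map_pow, map_sub, Polynomial.aeval_X, Polynomial.aeval_C, map_ofNat,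
      algebraMap_eq, map_C, map_X, eval_C, eval_X]
    simp only [one_div, map_inv₀, map_ofNat]
    field_simp
  · have e : planeMap ε 0 1 (![0, 0, 1] : Fin 3 → ℂ) = 0 := by
      rw [planeMap_apply]; simp
    rw [surfaceForm, e, sexticHom_zero]
    simp

theorem surface_no_singular_at_infinity {ε : ℝ} (hε : ε ^ 2 = 1) (x : Fin 3 → ℂ)
    (h : ∀ u, HasDerivAt (fun s : ℂ => surfaceForm ε 0 (x + s • u)) 0 0) : x = 0 := by
  have hz : ∀ a b : ℂ, HasDerivAt (fun s : ℂ => 1 / 16 * ((a + s * b) ^ 2 * (a + s * b - 3 * 0) ^ 4))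
      (6 / 16 * a ^ 5 * b) 0 := by
    intro a b
    have h := ((((hasDerivAt_id' (0 : ℂ)).mul_const b).const_add a).pow 6).const_mul (1 / 16)
    refine (h.congr_deriv ?_).congr_of_eventuallyEq (Filter.Eventually.of_forall fun s => ?_)
    · simp; ring
    · simp only [Pi.pow_apply]; ring
  have key : ∀ u, -6 * eta * (planeMap ε 0 1 x).1 ^ 5 * (planeMap ε 0 1 u).1
      - 6 * (1 - eta) * (planeMap ε 0 1 x).2 ^ 5 * (planeMap ε 0 1 u).2
      + 6 / 16 * x 2 ^ 5 * u 2 = 0 := fun u =>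
    ((hasDerivAt_sexticHom_zero ε 0 1 x u).add (hz (x 2) (u 2))).unique (h u)
  obtain ⟨u, hu, hu2⟩ := exists_planeMap_eq hε (show (0 : Fin 3) ≠ 1 by decide) 1 0
  obtain ⟨u', hu', hu2'⟩ := exists_planeMap_eq hε (show (0 : Fin 3) ≠ 1 by decide) 0 1
  have k1 := key u
  have k2 := key u'
  have k3 := key ![0, 0, 1]
  rw [hu, hu2 2 (by decide) (by decide)] at k1
  rw [hu', hu2' 2 (by decide) (by decide)] at k2
  have e : planeMap ε 0 1 (![0, 0, 1] : Fin 3 → ℂ) = 0 := by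
    rw [planeMap_apply]; simp
  rw [e] at k3
  simp only [mul_one, mul_zero, sub_zero, add_zero, zero_sub, neg_eq_zero, mul_eq_zero,
    pow_eq_zero_iff, ne_eq, OfNat.ofNat_ne_zero, not_false_eq_true, eta_ne_zero,
    one_sub_eta_ne_zero, or_false, false_or, neg_eq_zero] at k1 k2
  have k3' : x 2 = 0 := by simpa using k3
  have hp := eq_zero_of_planeMap hε (Prod.ext k1 k2 : planeMap ε 0 1 x = 0)
  ext k
  fin_cases k
  · exact hp.1
  · exact hp.2
  · exact k3'

/-- The point of the surface over the point `p.1` of the real plane and with third coordinate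
`p.2`. -/
def surfacePoint (ε : ℝ) (p : ℂ × ℂ) : PSpace 3 :=
  affinePoint ![(p.1.re : ℂ), ((ε * p.1.im : ℝ) : ℂ), p.2]

theorem surfacePoint_injective {ε : ℝ} (hε : ε ^ 2 = 1) :
    Function.Injective (surfacePoint ε) := by
  intro p q h
  have h := affinePoint_injective h
  have h0 : (p.1.re : ℂ) = q.1.re := congrFun h 0
  have h1 : ((ε * p.1.im : ℝ) : ℂ) = ((ε * q.1.im : ℝ) : ℂ) := congrFun h 1
  have h2 : p.2 = q.2 := congrFun h 2
  have h0 := Complex.ofReal_injective h0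
  have h1 := Complex.ofReal_injective h1
  refine Prod.ext (Complex.ext h0 ?_) h2
  linear_combination ε * h1 + (q.1.im - p.1.im) * hε

theorem planeMap_surfacePoint {ε : ℝ} (hε : ε ^ 2 = 1) (p : ℂ × ℂ) :
    planeMap ε 0 1 (![(p.1.re : ℂ), ((ε * p.1.im : ℝ) : ℂ), p.2] : Fin 3 → ℂ) =
      ((starRingEnd ℂ) p.1, p.1) :=
  (planeMap_eq_iff hε).2 ⟨rfl, rfl⟩

theorem isASingularity_surfacePoint {P : MvPolynomial (Fin 2) ℝ} {ε : ℝ} (h : IsSexticEq P ε)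
    (hε : ε ^ 2 = 1) {j : ℕ} {p : ℂ × ℂ} {c : ℂ} (hp : p.1 ∈ levelPts c)
    (hg : quarticG p.2 = -c) (hz : IsPowerAt (j + 1) quarticG p.2) :
    IsASingularity j (projForm (surfaceEq P (polyG 2 2 4))) (surfacePoint ε p) := by
  apply isASingularity_affinePoint (isFormOf_surface h)
  have hpl := planeMap_surfacePoint hε p
  set a : Fin 3 → ℂ := ![(p.1.re : ℂ), ((ε * p.1.im : ℝ) : ℂ), p.2]
  obtain ⟨U, V, hU, hV, hU0, hV0, hUV, hJ⟩ := hp.1.isMorseAt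
  obtain ⟨W, hW, hW0, hWi, hG⟩ := hz
  rw [← hpl] at hU hV hU0 hV0 hUV hJ
  let π : (Fin 3 → ℂ) →L[ℂ] ℂ := ContinuousLinearMap.proj 2
  have hWa : AnalyticAt ℂ W (π a) := hW
  refine isAGerm_of_coordinates ![fun x => W (π x), fun x => U (planeMap ε 0 1 x),
    fun x => V (planeMap ε 0 1 x)] ?_ ?_ ?_ ?_
  · intro k
    fin_cases k
    · exact hWa.comp (π.analyticAt a)
    · exact hU.comp ((planeMap ε 0 1).analyticAt a)
    · exact hV.comp ((planeMap ε 0 1).analyticAt a)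
  · intro k
    fin_cases k
    · exact hW0
    · exact hU0
    · exact hV0
  · intro v hv
    have h0 : fderiv ℂ (fun x => W (π x)) a v = 0 := hv 0
    have h1 : fderiv ℂ (fun x => U (planeMap ε 0 1 x)) a v = 0 := hv 1
    have h2 : fderiv ℂ (fun x => V (planeMap ε 0 1 x)) a v = 0 := hv 2
    rw [fderiv_comp_continuousLinearMap _ hWa.differentiableAt] at h0
    rw [fderiv_comp_continuousLinearMap _ hU.differentiableAt] at h1
    rw [fderiv_comp_continuousLinearMap _ hV.differentiableAt] at h2
    have e0 := hWi _ h0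
    have e1 := eq_zero_of_planeMap hε (hUV _ h1 h2)
    ext k
    fin_cases k
    · exact e1.1
    · exact e1.2
    · exact e0
  · have t1 : Tendsto (planeMap ε 0 1) (𝓝 a) (𝓝 (planeMap ε 0 1 a)) :=
      (planeMap ε 0 1).continuous.tendsto a
    have t2 : Tendsto π (𝓝 a) (𝓝 p.2) := π.continuous.tendsto a
    filter_upwards [t1.eventually hJ, t2.eventually hG] with x hx hx'
    have hx' : quarticG (x 2) = quarticG p.2 + W (π x) ^ (j + 1) := hx'
    rw [surfaceForm_one, hx, hx', hg]
    have : sexticFun (planeMap ε 0 1 a) = c := by rw [hpl]; exact hp.2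
    rw [this, Fin.sum_univ_two]
    change c + U (planeMap ε 0 1 x) ^ 2 + V (planeMap ε 0 1 x) ^ 2 + (-c + W (π x) ^ (j + 1)) =
      W (π x) ^ (j + 1) + (U (planeMap ε 0 1 x) ^ 2 + V (planeMap ε 0 1 x) ^ 2)
    ring

theorem isPowerAt_quarticG_zero : IsPowerAt 2 quarticG 0 := by
  refine isPowerAt_of_eq_pow_mul (u := fun z => 1 / 16 * (z - 3) ^ 4) (by norm_num)
    (by fun_prop) (by norm_num) fun z => ?_
  simp only [quarticG]; ring

theorem isPowerAt_quarticG_one : IsPowerAt 2 quarticG 1 := by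
  refine isPowerAt_of_eq_pow_mul
    (u := fun z => 1 / 16 * (z ^ 4 - 10 * z ^ 3 + 33 * z ^ 2 - 32 * z - 16)) (by norm_num)
    (by fun_prop) (by norm_num) fun z => ?_
  simp only [quarticG]; ring

theorem isPowerAt_quarticG_three : IsPowerAt 4 quarticG 3 := by
  refine isPowerAt_of_eq_pow_mul (u := fun z => 1 / 16 * z ^ 2) (by norm_num)
    (by fun_prop) (by norm_num) fun z => ?_
  simp only [quarticG]; ring

/-- The nodes of the surface. -/
def surfaceNodes (ε : ℝ) : Set (PSpace 3) :=
  surfacePoint ε '' (levelPts 0 ×ˢ {0} ∪ levelPts (-1) ×ˢ {1})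

/-- The `A₃`-points of the surface. -/
def surfaceCusps (ε : ℝ) : Set (PSpace 3) := surfacePoint ε '' (levelPts 0 ×ˢ {3})

theorem finite_levelPts_neg_one : (levelPts (-1)).Finite := by
  rw [levelPts_neg_one]
  exact finite_minPts

theorem ncard_surfaceNodes {ε : ℝ} (hε : ε ^ 2 = 1) : (surfaceNodes ε).ncard = 22 := by
  have hd : Disjoint (levelPts 0 ×ˢ ({0} : Set ℂ)) (levelPts (-1) ×ˢ ({1} : Set ℂ)) := by
    rw [Set.disjoint_left]
    rintro ⟨a, b⟩ ⟨-, h1⟩ ⟨-, h2⟩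
    have h1 : b = 0 := h1
    have h2 : b = 1 := h2
    rw [h1] at h2
    norm_num at h2
  rw [surfaceNodes, Set.ncard_image_of_injective _ (surfacePoint_injective hε),
    Set.ncard_union_eq hd (finite_levelPts_zero.prod (Set.finite_singleton _))
      (finite_levelPts_neg_one.prod (Set.finite_singleton _)),
    Set.ncard_prod, Set.ncard_prod, ncard_levelPts_zero, levelPts_neg_one,
    ncard_minPts, Set.ncard_singleton, Set.ncard_singleton]

theorem ncard_surfaceCusps {ε : ℝ} (hε : ε ^ 2 = 1) : (surfaceCusps ε).ncard = 15 := by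
  rw [surfaceCusps, Set.ncard_image_of_injective _ (surfacePoint_injective hε),
    Set.ncard_prod, ncard_levelPts_zero, Set.ncard_singleton]

theorem isRealPoint_surfacePoint (ε : ℝ) (z : ℂ) (r : ℝ) :
    IsRealPoint (surfacePoint ε (z, (r : ℂ))) := by
  refine isRealPoint_affinePoint ![z.re, ε * z.im, r] fun k => ?_
  fin_cases k <;> rfl

theorem isASingularity_one_of_mem {P : MvPolynomial (Fin 2) ℝ} {ε : ℝ} (h : IsSexticEq P ε)
    (hε : ε ^ 2 = 1) {p : PSpace 3} (hp : p ∈ surfaceNodes ε) :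
    IsASingularity 1 (projForm (surfaceEq P (polyG 2 2 4))) p := by
  obtain ⟨⟨z, r⟩, ⟨hz, hr⟩ | ⟨hz, hr⟩, rfl⟩ := hp
  · have hr : r = 0 := hr
    subst hr
    exact isASingularity_surfacePoint h hε hz (by simp [quarticG]) isPowerAt_quarticG_zero
  · have hr : r = 1 := hr
    subst hr
    exact isASingularity_surfacePoint h hε hz (by simp only [quarticG]; norm_num)
      isPowerAt_quarticG_one

theorem isASingularity_three_of_mem {P : MvPolynomial (Fin 2) ℝ} {ε : ℝ} (h : IsSexticEq P ε)
    (hε : ε ^ 2 = 1) {p : PSpace 3} (hp : p ∈ surfaceCusps ε) :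
    IsASingularity 3 (projForm (surfaceEq P (polyG 2 2 4))) p := by
  obtain ⟨⟨z, r⟩, ⟨hz, hr⟩, rfl⟩ := hp
  have hr : r = 3 := hr
  subst hr
  exact isASingularity_surfacePoint h hε hz (by simp [quarticG]) isPowerAt_quarticG_three

theorem mem_levelPts_of_planeMap {n : ℕ} {ε : ℝ} (hε : ε ^ 2 = 1) {i j : Fin n} {a : Fin n → ℂ}
    (hc : IsSexticCritical (planeMap ε i j a).1 (planeMap ε i j a).2) :
    ∃ z, z ∈ levelPts (sexticFun (planeMap ε i j a)) ∧ a i = z.re ∧ a j = (ε * z.im : ℝ) := by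
  have hs := hc.eq_star
  have e : planeMap ε i j a = ((starRingEnd ℂ) (planeMap ε i j a).2, (planeMap ε i j a).2) :=
    Prod.ext hs rfl
  refine ⟨(planeMap ε i j a).2, ⟨?_, ?_⟩, (planeMap_eq_iff hε).1 e⟩
  · rwa [← hs]
  · rw [← hs]; rfl

theorem level_cases {c z : ℂ} (h : z ∈ levelPts c) : c = 0 ∨ c = -1 ∨ c = 8 := by
  have hc := h.2
  rcases h.1.cases with h0 | h0 | h0
  · left; rw [← hc, h0]
  · right; left; rw [← hc, (sextic_of_mem_minPts h0).2.1]
  · right; right; rw [← hc, (sextic_of_mem_maxPts h0).2.1]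

theorem surface_singular {P : MvPolynomial (Fin 2) ℝ} {ε : ℝ} (h : IsSexticEq P ε)
    (hε : ε ^ 2 = 1) {p : PSpace 3} (hp : IsSingularPt (projForm (surfaceEq P (polyG 2 2 4))) p) :
    IsRealPoint p ∧ p ∈ surfaceNodes ε ∪ surfaceCusps ε := by
  obtain ⟨a, rfl, h0, hd⟩ := hp.exists_affinePoint (isFormOf_surface h)
    (surface_no_singular_at_infinity hε)
  simp only [surfaceForm_one] at h0 hd
  have hg : ∀ b c : ℂ, HasDerivAt (fun s : ℂ => quarticG (b + s * c))
      (3 / 8 * b * (b - 1) * (b - 3) ^ 3 * c) 0 := by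
    intro b c
    have h1 := ((hasDerivAt_id' (0 : ℂ)).mul_const c).const_add b
    have h2 := ((h1.pow 2).mul ((h1.sub_const 3).pow 4)).const_mul (1 / 16)
    refine h2.congr_deriv ?_
    simp
    ring
  have key : ∀ u, sexticV (planeMap ε 0 1 a).1 (planeMap ε 0 1 a).2 * (planeMap ε 0 1 u).1
        + sexticW (planeMap ε 0 1 a).1 (planeMap ε 0 1 a).2 * (planeMap ε 0 1 u).2
        + 3 / 8 * a 2 * (a 2 - 1) * (a 2 - 3) ^ 3 * u 2 = 0 := fun u =>
    ((hasDerivAt_sextic_planeMap ε 0 1 a u).add (hg (a 2) (u 2))).unique (hd u)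
  obtain ⟨u, hu, hu2⟩ := exists_planeMap_eq hε (show (0 : Fin 3) ≠ 1 by decide) 1 0
  obtain ⟨u', hu', hu2'⟩ := exists_planeMap_eq hε (show (0 : Fin 3) ≠ 1 by decide) 0 1
  have k1 := key u
  have k2 := key u'
  have k3 := key ![0, 0, 1]
  rw [hu, hu2 2 (by decide) (by decide)] at k1
  rw [hu', hu2' 2 (by decide) (by decide)] at k2
  have e : planeMap ε 0 1 (![0, 0, 1] : Fin 3 → ℂ) = 0 := by
    rw [planeMap_apply]; simp
  rw [e] at k3
  have hc : IsSexticCritical (planeMap ε 0 1 a).1 (planeMap ε 0 1 a).2 :=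
    ⟨by simpa using k1, by simpa using k2⟩
  have k3' : (a 2 = 0 ∨ a 2 - 1 = 0) ∨ a 2 - 3 = 0 := by simpa using k3
  obtain ⟨z, hz, ha0, ha1⟩ := mem_levelPts_of_planeMap hε hc
  have hpt : affinePoint a = surfacePoint ε (z, a 2) := by
    unfold surfacePoint
    congr 1
    ext k
    fin_cases k
    · exact ha0
    · exact ha1
    · rfl
  have hlev := level_cases hz
  set c := sexticFun (planeMap ε 0 1 a)
  rw [hpt]
  rcases k3' with (k3' | k3') | k3'
  · rw [k3'] at h0 ⊢
    have hc0 : c = 0 := by simpa [quarticG] using h0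
    rw [hc0] at hz
    refine ⟨?_, Or.inl ⟨(z, 0), Or.inl ⟨hz, rfl⟩, rfl⟩⟩
    have hr := isRealPoint_surfacePoint ε z 0
    rwa [Complex.ofReal_zero] at hr
  · have k3' : a 2 = 1 := by linear_combination k3'
    rw [k3'] at h0 ⊢
    have hq : quarticG 1 = 1 := by simp only [quarticG]; norm_num
    rw [hq] at h0
    have hc0 : c = -1 := by linear_combination h0
    rw [hc0] at hz
    refine ⟨?_, Or.inl ⟨(z, 1), Or.inr ⟨hz, rfl⟩, rfl⟩⟩
    have hr := isRealPoint_surfacePoint ε z 1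
    rwa [Complex.ofReal_one] at hr
  · have k3' : a 2 = 3 := by linear_combination k3'
    rw [k3'] at h0 ⊢
    have hc0 : c = 0 := by simpa [quarticG] using h0
    rw [hc0] at hz
    refine ⟨?_, Or.inr ⟨(z, 3), ⟨hz, rfl⟩, rfl⟩⟩
    have hr := isRealPoint_surfacePoint ε z 3
    rwa [Complex.ofReal_ofNat] at hr

theorem surface_singularities {P : MvPolynomial (Fin 2) ℝ} {ε : ℝ} (h : IsSexticEq P ε)
    (hε : ε ^ 2 = 1) :
    {p : PSpace 3 | IsASingularity 1 (projForm (surfaceEq P (polyG 2 2 4))) p}.ncard = 22 ∧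
      {p : PSpace 3 | IsASingularity 3 (projForm (surfaceEq P (polyG 2 2 4))) p}.ncard = 15 ∧
      ∀ p : PSpace 3, IsSingularPt (projForm (surfaceEq P (polyG 2 2 4))) p →
        IsRealPoint p ∧ (IsASingularity 1 (projForm (surfaceEq P (polyG 2 2 4))) p ∨
          IsASingularity 3 (projForm (surfaceEq P (polyG 2 2 4))) p) := by
  have hF := (isFormOf_surface h).1
  have h1 : {p : PSpace 3 | IsASingularity 1 (projForm (surfaceEq P (polyG 2 2 4))) p} =
      surfaceNodes ε := by
    ext p
    refine ⟨fun hp => ?_, isASingularity_one_of_mem h hε⟩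
    have hp : IsASingularity 1 (projForm (surfaceEq P (polyG 2 2 4))) p := hp
    refine (surface_singular h hε (hp.isSingularPt le_rfl hF)).2.resolve_right fun hc => ?_
    exact hp.not_of_one (by norm_num) hF (isASingularity_three_of_mem h hε hc)
  have h3 : {p : PSpace 3 | IsASingularity 3 (projForm (surfaceEq P (polyG 2 2 4))) p} =
      surfaceCusps ε := by
    ext p
    refine ⟨fun hp => ?_, isASingularity_three_of_mem h hε⟩
    have hp : IsASingularity 3 (projForm (surfaceEq P (polyG 2 2 4))) p := hp
    refine (surface_singular h hε (hp.isSingularPt (by norm_num) hF)).2.resolve_left fun hc => ?_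
    exact (isASingularity_one_of_mem h hε hc).not_of_one (by norm_num) hF hp
  refine ⟨by rw [h1, ncard_surfaceNodes hε], by rw [h3, ncard_surfaceCusps hε], fun p hp => ?_⟩
  obtain ⟨hr, hm⟩ := surface_singular h hε hp
  exact ⟨hr, hm.imp (isASingularity_one_of_mem h hε) (isASingularity_three_of_mem h hε)⟩

/-! ### The three-fold -/

/-- The homogeneous equation of the three-fold. -/
def threefoldForm (ε : ℝ) (t : ℂ) (x : Fin 4 → ℂ) : ℂ :=
  sexticHom t (planeMap ε 0 1 x).1 (planeMap ε 0 1 x).2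
    - sexticHom t (planeMap ε 2 3 x).1 (planeMap ε 2 3 x).2

theorem threefoldForm_one (ε : ℝ) (x : Fin 4 → ℂ) :
    threefoldForm ε 1 x = sexticFun (planeMap ε 0 1 x) - sexticFun (planeMap ε 2 3 x) := by
  rw [threefoldForm, sexticHom_one, sexticHom_one]; rfl

theorem exists_planeMap_left {ε : ℝ} (hε : ε ^ 2 = 1) (a b : ℂ) :
    ∃ u : Fin 4 → ℂ, planeMap ε 0 1 u = (a, b) ∧ planeMap ε 2 3 u = 0 := by
  obtain ⟨u, hu, h0⟩ := exists_planeMap_eq hε (show (0 : Fin 4) ≠ 1 by decide) a b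
  refine ⟨u, hu, ?_⟩
  rw [planeMap_apply, h0 2 (by decide) (by decide), h0 3 (by decide) (by decide)]
  simp

theorem exists_planeMap_right {ε : ℝ} (hε : ε ^ 2 = 1) (a b : ℂ) :
    ∃ u : Fin 4 → ℂ, planeMap ε 0 1 u = 0 ∧ planeMap ε 2 3 u = (a, b) := by
  obtain ⟨u, hu, h0⟩ := exists_planeMap_eq hε (show (2 : Fin 4) ≠ 3 by decide) a b
  refine ⟨u, ?_, hu⟩
  rw [planeMap_apply, h0 0 (by decide) (by decide), h0 1 (by decide) (by decide)]
  simp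

theorem isFormOf_threefold {P : MvPolynomial (Fin 2) ℝ} {ε : ℝ} (h : IsSexticEq P ε)
    (hε : ε ^ 2 = 1) : IsFormOf 6 (projForm (threefoldEq P)) (threefoldForm ε) := by
  obtain ⟨u, hu, hu'⟩ := exists_planeMap_left hε 1 0
  refine isFormOf_homogenization (x₀ := u) ?_ ?_ ?_ ?_
  · exact (totalDegree_map_algebraMap_le _).trans ((totalDegree_sub _ _).trans
      (max_le ((totalDegree_rename_le _ _).trans h.1) ((totalDegree_rename_le _ _).trans h.1)))
  · intro x
    exact (continuous_sexticHom _ _).sub (continuous_sexticHom _ _)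
  · intro t x ht
    rw [threefoldEq, map_sub, map_sub, eval_rename_pair h, eval_rename_pair h, planeMap_div,
      planeMap_div, threefoldForm, ← pow_mul_sextic_div ht, ← pow_mul_sextic_div ht, mul_sub]
    rfl
  · rw [threefoldForm, hu, hu', sexticHom_zero, sexticHom_zero]
    simpa using eta_ne_zero

theorem threefold_no_singular_at_infinity {ε : ℝ} (hε : ε ^ 2 = 1) (x : Fin 4 → ℂ)
    (h : ∀ u, HasDerivAt (fun s : ℂ => threefoldForm ε 0 (x + s • u)) 0 0) : x = 0 := by
  have key := fun u => ((hasDerivAt_sexticHom_zero ε 0 1 x u).sub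
    (hasDerivAt_sexticHom_zero ε 2 3 x u)).unique (h u)
  obtain ⟨u1, hu1, hu1'⟩ := exists_planeMap_left hε 1 0
  obtain ⟨u2, hu2, hu2'⟩ := exists_planeMap_left hε 0 1
  obtain ⟨u3, hu3, hu3'⟩ := exists_planeMap_right hε 1 0
  obtain ⟨u4, hu4, hu4'⟩ := exists_planeMap_right hε 0 1
  have k1 := key u1
  have k2 := key u2
  have k3 := key u3
  have k4 := key u4
  rw [hu1, hu1'] at k1
  rw [hu2, hu2'] at k2
  rw [hu3, hu3'] at k3
  rw [hu4, hu4'] at k4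
  simp only [Prod.fst_zero, Prod.snd_zero, mul_one, mul_zero, sub_zero, zero_sub, neg_eq_zero,
    mul_eq_zero, pow_eq_zero_iff, ne_eq, OfNat.ofNat_ne_zero, not_false_eq_true, eta_ne_zero,
    one_sub_eta_ne_zero, false_or] at k1 k2 k3 k4
  have hp := eq_zero_of_planeMap hε (Prod.ext k1 k2 : planeMap ε 0 1 x = 0)
  have hq := eq_zero_of_planeMap hε (Prod.ext k3 k4 : planeMap ε 2 3 x = 0)
  ext k
  fin_cases k
  · exact hp.1
  · exact hp.2
  · exact hq.1
  · exact hq.2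

/-- The affine coordinates of the point of the three-fold over a pair of points of the plane. -/
def threefoldVec (ε : ℝ) (p : ℂ × ℂ) : Fin 4 → ℂ :=
  ![(p.1.re : ℂ), ((ε * p.1.im : ℝ) : ℂ), (p.2.re : ℂ), ((ε * p.2.im : ℝ) : ℂ)]

/-- The point of the three-fold over a pair of points of the real plane. -/
def threefoldPoint (ε : ℝ) (p : ℂ × ℂ) : PSpace 4 := affinePoint (threefoldVec ε p)

theorem threefoldPoint_injective {ε : ℝ} (hε : ε ^ 2 = 1) :
    Function.Injective (threefoldPoint ε) := by
  intro p q h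
  have h := affinePoint_injective h
  have h0 := Complex.ofReal_injective (show (p.1.re : ℂ) = q.1.re from congrFun h 0)
  have h1 := Complex.ofReal_injective
    (show ((ε * p.1.im : ℝ) : ℂ) = ((ε * q.1.im : ℝ) : ℂ) from congrFun h 1)
  have h2 := Complex.ofReal_injective (show (p.2.re : ℂ) = q.2.re from congrFun h 2)
  have h3 := Complex.ofReal_injective
    (show ((ε * p.2.im : ℝ) : ℂ) = ((ε * q.2.im : ℝ) : ℂ) from congrFun h 3)
  refine Prod.ext (Complex.ext h0 ?_) (Complex.ext h2 ?_)
  · linear_combination ε * h1 + (q.1.im - p.1.im) * hε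
  · linear_combination ε * h3 + (q.2.im - p.2.im) * hε

theorem isRealPoint_threefoldPoint (ε : ℝ) (p : ℂ × ℂ) : IsRealPoint (threefoldPoint ε p) := by
  refine isRealPoint_affinePoint ![p.1.re, ε * p.1.im, p.2.re, ε * p.2.im] fun k => ?_
  fin_cases k <;> rfl

theorem isASingularity_threefoldPoint {P : MvPolynomial (Fin 2) ℝ} {ε : ℝ} (h : IsSexticEq P ε)
    (hε : ε ^ 2 = 1) {p : ℂ × ℂ} {c : ℂ} (hp : p.1 ∈ levelPts c) (hq : p.2 ∈ levelPts c) :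
    IsASingularity 1 (projForm (threefoldEq P)) (threefoldPoint ε p) := by
  apply isASingularity_affinePoint (isFormOf_threefold h hε)
  have h01 : planeMap ε 0 1 (threefoldVec ε p) = ((starRingEnd ℂ) p.1, p.1) :=
    (planeMap_eq_iff hε).2 ⟨rfl, rfl⟩
  have h23 : planeMap ε 2 3 (threefoldVec ε p) = ((starRingEnd ℂ) p.2, p.2) :=
    (planeMap_eq_iff hε).2 ⟨rfl, rfl⟩
  set a := threefoldVec ε p
  obtain ⟨U, V, hU, hV, hU0, hV0, hUV, hJ⟩ := hp.1.isMorseAt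
  obtain ⟨U', V', hU', hV', hU0', hV0', hUV', hJ'⟩ := hq.1.isMorseAt
  rw [← h01] at hU hV hU0 hV0 hUV hJ
  rw [← h23] at hU' hV' hU0' hV0' hUV' hJ'
  have aU' : AnalyticAt ℂ (fun x => U' (planeMap ε 2 3 x)) a :=
    hU'.comp ((planeMap ε 2 3).analyticAt a)
  have aV' : AnalyticAt ℂ (fun x => V' (planeMap ε 2 3 x)) a :=
    hV'.comp ((planeMap ε 2 3).analyticAt a)
  refine isAGerm_of_coordinates ![fun x => U (planeMap ε 0 1 x), fun x => V (planeMap ε 0 1 x),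
    fun x => Complex.I * U' (planeMap ε 2 3 x), fun x => Complex.I * V' (planeMap ε 2 3 x)]
    ?_ ?_ ?_ ?_
  · intro k
    fin_cases k
    · exact hU.comp ((planeMap ε 0 1).analyticAt a)
    · exact hV.comp ((planeMap ε 0 1).analyticAt a)
    · exact analyticAt_const.mul aU'
    · exact analyticAt_const.mul aV'
  · intro k
    fin_cases k
    · exact hU0
    · exact hV0
    · change Complex.I * U' (planeMap ε 2 3 a) = 0
      rw [hU0', mul_zero]
    · change Complex.I * V' (planeMap ε 2 3 a) = 0
      rw [hV0', mul_zero]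
  · intro v hv
    have h0 : fderiv ℂ (fun x => U (planeMap ε 0 1 x)) a v = 0 := hv 0
    have h1 : fderiv ℂ (fun x => V (planeMap ε 0 1 x)) a v = 0 := hv 1
    have h2 : fderiv ℂ (fun x => Complex.I * U' (planeMap ε 2 3 x)) a v = 0 := hv 2
    have h3 : fderiv ℂ (fun x => Complex.I * V' (planeMap ε 2 3 x)) a v = 0 := hv 3
    rw [fderiv_comp_continuousLinearMap _ hU.differentiableAt] at h0
    rw [fderiv_comp_continuousLinearMap _ hV.differentiableAt] at h1
    rw [fderiv_const_mul aU'.differentiableAt, _root_.smul_apply, smul_eq_mul,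
      fderiv_comp_continuousLinearMap _ hU'.differentiableAt] at h2
    rw [fderiv_const_mul aV'.differentiableAt, _root_.smul_apply, smul_eq_mul,
      fderiv_comp_continuousLinearMap _ hV'.differentiableAt] at h3
    have e1 := eq_zero_of_planeMap hε (hUV _ h0 h1)
    have e2 := eq_zero_of_planeMap hε (hUV' _ ((mul_eq_zero.1 h2).resolve_left Complex.I_ne_zero)
      ((mul_eq_zero.1 h3).resolve_left Complex.I_ne_zero))
    ext k
    fin_cases k
    · exact e1.1
    · exact e1.2
    · exact e2.1
    · exact e2.2
  · have t1 := (planeMap ε 0 1).continuous.tendsto a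
    have t2 := (planeMap ε 2 3).continuous.tendsto a
    filter_upwards [t1.eventually hJ, t2.eventually hJ'] with x hx hx'
    have e1 : sexticFun (planeMap ε 0 1 a) = c := by rw [h01]; exact hp.2
    have e2 : sexticFun (planeMap ε 2 3 a) = c := by rw [h23]; exact hq.2
    rw [threefoldForm_one, hx, hx', e1, e2, Fin.sum_univ_three]
    change c + U (planeMap ε 0 1 x) ^ 2 + V (planeMap ε 0 1 x) ^ 2
      - (c + U' (planeMap ε 2 3 x) ^ 2 + V' (planeMap ε 2 3 x) ^ 2) =
      U (planeMap ε 0 1 x) ^ (1 + 1) + (V (planeMap ε 0 1 x) ^ 2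
        + (Complex.I * U' (planeMap ε 2 3 x)) ^ 2 + (Complex.I * V' (planeMap ε 2 3 x)) ^ 2)
    linear_combination -(U' (planeMap ε 2 3 x) ^ 2 + V' (planeMap ε 2 3 x) ^ 2) * Complex.I_sq

/-- The pairs of critical points of the sextic with the same value. -/
def criticalPairs : Set (ℂ × ℂ) :=
  levelPts 0 ×ˢ levelPts 0 ∪ (levelPts (-1) ×ˢ levelPts (-1) ∪ levelPts 8 ×ˢ levelPts 8)

theorem disjoint_levelPts_prod {c d : ℂ} (h : c ≠ d) :
    Disjoint (levelPts c ×ˢ levelPts c) (levelPts d ×ˢ levelPts d) := by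
  rw [Set.disjoint_left]
  rintro ⟨a, b⟩ ⟨h1, -⟩ ⟨h2, -⟩
  exact h (h1.2.symm.trans h2.2)

theorem ncard_criticalPairs : criticalPairs.ncard = 283 := by
  have f0 := finite_levelPts_zero.prod finite_levelPts_zero
  have f1 := finite_levelPts_neg_one.prod finite_levelPts_neg_one
  have f8 : (levelPts 8 ×ˢ levelPts 8).Finite := by
    rw [levelPts_eight]; exact finite_maxPts.prod finite_maxPts
  have d1 : Disjoint (levelPts 0 ×ˢ levelPts 0)
      (levelPts (-1) ×ˢ levelPts (-1) ∪ levelPts 8 ×ˢ levelPts 8) :=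
    (disjoint_levelPts_prod (by norm_num)).union_right (disjoint_levelPts_prod (by norm_num))
  have d2 : Disjoint (levelPts (-1) ×ˢ levelPts (-1)) (levelPts 8 ×ˢ levelPts 8) :=
    disjoint_levelPts_prod (by norm_num)
  rw [criticalPairs, Set.ncard_union_eq d1 f0 (f1.union f8), Set.ncard_union_eq d2 f1 f8,
    Set.ncard_prod, Set.ncard_prod, Set.ncard_prod, ncard_levelPts_zero, levelPts_neg_one,
    levelPts_eight, ncard_minPts, ncard_maxPts]

theorem mem_criticalPairs {p : ℂ × ℂ} :
    p ∈ criticalPairs ↔ ∃ c, p.1 ∈ levelPts c ∧ p.2 ∈ levelPts c := by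
  constructor
  · rintro (h | h | h)
    · exact ⟨0, h⟩
    · exact ⟨-1, h⟩
    · exact ⟨8, h⟩
  · rintro ⟨c, h⟩
    rcases level_cases h.1 with rfl | rfl | rfl
    · exact Or.inl h
    · exact Or.inr (Or.inl h)
    · exact Or.inr (Or.inr h)

theorem threefold_singular {P : MvPolynomial (Fin 2) ℝ} {ε : ℝ} (h : IsSexticEq P ε)
    (hε : ε ^ 2 = 1) {p : PSpace 4} (hp : IsSingularPt (projForm (threefoldEq P)) p) :
    p ∈ threefoldPoint ε '' criticalPairs := by
  obtain ⟨a, rfl, h0, hd⟩ := hp.exists_affinePoint (isFormOf_threefold h hε)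
    (threefold_no_singular_at_infinity hε)
  simp only [threefoldForm_one] at h0 hd
  have key := fun u => ((hasDerivAt_sextic_planeMap ε 0 1 a u).sub
    (hasDerivAt_sextic_planeMap ε 2 3 a u)).unique (hd u)
  obtain ⟨u1, hu1, hu1'⟩ := exists_planeMap_left hε 1 0
  obtain ⟨u2, hu2, hu2'⟩ := exists_planeMap_left hε 0 1
  obtain ⟨u3, hu3, hu3'⟩ := exists_planeMap_right hε 1 0
  obtain ⟨u4, hu4, hu4'⟩ := exists_planeMap_right hε 0 1
  have k1 := key u1
  have k2 := key u2
  have k3 := key u3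
  have k4 := key u4
  rw [hu1, hu1'] at k1
  rw [hu2, hu2'] at k2
  rw [hu3, hu3'] at k3
  rw [hu4, hu4'] at k4
  obtain ⟨z, hz, ha0, ha1⟩ := mem_levelPts_of_planeMap hε (i := 0) (j := 1) (a := a)
    ⟨by simpa using k1, by simpa using k2⟩
  obtain ⟨y, hy, ha2, ha3⟩ := mem_levelPts_of_planeMap hε (i := 2) (j := 3) (a := a)
    ⟨by simpa using k3, by simpa using k4⟩
  rw [← sub_eq_zero.1 h0] at hy
  refine ⟨(z, y), mem_criticalPairs.2 ⟨_, hz, hy⟩, ?_⟩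
  unfold threefoldPoint
  congr 1
  ext k
  fin_cases k
  · exact ha0.symm
  · exact ha1.symm
  · exact ha2.symm
  · exact ha3.symm

theorem threefold_singularities {P : MvPolynomial (Fin 2) ℝ} {ε : ℝ} (h : IsSexticEq P ε)
    (hε : ε ^ 2 = 1) :
    {p : PSpace 4 | IsASingularity 1 (projForm (threefoldEq P)) p}.ncard = 283 ∧
      ∀ p : PSpace 4, IsSingularPt (projForm (threefoldEq P)) p →
        IsRealPoint p ∧ IsASingularity 1 (projForm (threefoldEq P)) p := by
  have hF := (isFormOf_threefold h hε).1
  have hmem : ∀ p ∈ threefoldPoint ε '' criticalPairs,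
      IsASingularity 1 (projForm (threefoldEq P)) p := by
    rintro _ ⟨q, hq, rfl⟩
    obtain ⟨c, h1, h2⟩ := mem_criticalPairs.1 hq
    exact isASingularity_threefoldPoint h hε h1 h2
  have h1 : {p : PSpace 4 | IsASingularity 1 (projForm (threefoldEq P)) p} =
      threefoldPoint ε '' criticalPairs := by
    ext p
    refine ⟨fun hp => ?_, hmem p⟩
    have hp : IsASingularity 1 (projForm (threefoldEq P)) p := hp
    exact threefold_singular h hε (hp.isSingularPt le_rfl hF)
  refine ⟨?_, fun p hp => ?_⟩
  · rw [h1, Set.ncard_image_of_injective _ (threefoldPoint_injective hε), ncard_criticalPairs]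
  · have hm := threefold_singular h hε hp
    refine ⟨?_, hmem p hm⟩
    obtain ⟨q, -, rfl⟩ := hm
    exact isRealPoint_threefoldPoint ε q

end SexticHypersurfaces

end

open SexticHypersurfaces in
theorem proposition1 :
    -- the singularities of the surface and of the three-fold, for `J_6` and its mirror image
    (∀ P : MvPolynomial (Fin 2) ℝ, P = plainJ 2 ∨ P = barJ 2 →
      ({p : PSpace 3 | IsASingularity 1 (projForm (surfaceEq P (polyG 2 2 4))) p}.ncard = 22 ∧
        {p : PSpace 3 | IsASingularity 3 (projForm (surfaceEq P (polyG 2 2 4))) p}.ncard = 15 ∧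
        ∀ p : PSpace 3, IsSingularPt (projForm (surfaceEq P (polyG 2 2 4))) p →
          IsRealPoint p ∧ (IsASingularity 1 (projForm (surfaceEq P (polyG 2 2 4))) p ∨
            IsASingularity 3 (projForm (surfaceEq P (polyG 2 2 4))) p)) ∧
      ({p : PSpace 4 | IsASingularity 1 (projForm (threefoldEq P)) p}.ncard = 283 ∧
        ∀ p : PSpace 4, IsSingularPt (projForm (threefoldEq P)) p →
          IsRealPoint p ∧ IsASingularity 1 (projForm (threefoldEq P)) p)) ∧
    -- the critical points of `J̄_6`, and of `J_6` by complex conjugation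
    (∀ (P : MvPolynomial (Fin 2) ℝ) (σ : ℂ → ℂ),
      (P = barJ 2 ∧ σ = id) ∨ (P = plainJ 2 ∧ σ = star) →
      (∀ z, IsCritical P z → planeFun P z = 0 ∨ planeFun P z = -1 ∨ planeFun P z = 8) ∧
      {z | IsCritical P z ∧ planeFun P z = 0}.ncard = 15 ∧
      {z | IsCritical P z ∧ planeFun P z = -1} = σ '' minPts ∧
      {z | IsLocalMin (planeFun P) z} = σ '' minPts ∧
      {z | IsCritical P z ∧ planeFun P z = 8} = σ '' maxPts ∧
      {z | IsLocalMax (planeFun P) z} = σ '' maxPts) ∧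
    minPts.ncard = 7 ∧ maxPts.ncard = 3 ∧
    -- these points are, up to threefold rotation, intersections of the lines
    minPts = {z | ∃ i : ℕ, z = rot ^ i * crossing 6 0 6 ∨ z = rot ^ i * crossing 6 0 12 ∨
      z = rot ^ i * crossing 6 2 8} ∧
    maxPts = {z | ∃ i : ℕ, z = rot ^ i * crossing 6 4 10} := by
  refine ⟨fun P hP => ?_, fun P σ hP => ?_, ncard_minPts, ncard_maxPts, minPts_eq_crossing,
    maxPts_eq_crossing⟩
  · rcases hP with rfl | rfl
    · have hε : (-1 : ℝ) ^ 2 = 1 := by norm_num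
      exact ⟨surface_singularities isSexticEq_plainJ hε,
        threefold_singularities isSexticEq_plainJ hε⟩
    · have hε : (1 : ℝ) ^ 2 = 1 := by norm_num
      exact ⟨surface_singularities isSexticEq_barJ hε,
        threefold_singularities isSexticEq_barJ hε⟩
  · rcases hP with ⟨rfl, rfl⟩ | ⟨rfl, rfl⟩
    · rw [← twist_one]
      exact isSexticEq_barJ.critical_points (by norm_num)
    · rw [← twist_neg_one]
      exact isSexticEq_plainJ.critical_points (by norm_num)
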